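/- **Setting.** Let $d\ge 0$. Write $X=(x_0,x)\in\mathbb R^{1+d}$, let $\pi(x_0,x)=x$ and $\mathcal P_0=\{x_0=0\}\subset\mathbb R^{1+d}$. For $\xi\in\mathbb R^d$, $\|\xi\|\le 1$, put $\sigma(\xi)=(\sqrt{1-\|\xi\|^2},\xi)$. Let $G\in \mathrm{GL}_{1+d}(\mathbb R)$, $\gamma\in\mathbb R^{1+d}$, $\mathcal G(X)=GX+\gamma$, and $$g(\xi)=\pi({}^tG\,\sigma(\xi)),\qquad S(\xi)=\langle\gamma,\sigma(\xi)\rangle,\qquad J(\xi)=|\det dg(\xi)|^{-1},$$ $$\kappa_{U_{\mathcal G}}(x,\xi)=\big(({}^tdg(\xi))^{-1}(x-dS(\xi)),\,g(\xi)\big).$$ For $0<\hbar\le1$ let $\mathcal F_\hbar\psi(\xi)=\int e^{-\frac i\hbar\langle x,\xi\rangle}\psi(x)\,dx$ and $$U_{\mathcal G}\psi(\tilde x)=\frac1{(2\pi\hbar)^d}\int e^{\frac i\hbar\langle \mathcal G(0,\tilde x),\sigma(\xi)\rangle}\,\mathcal F_\hbar\psi(\xi)\,d\xi ,$$ for Schwartz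 functions $\psi$ such that $\mathcal F_\hbar\psi$ is supported in a compact subset of $\{\|\xi\|<1,\ \sigma(\xi)\notin G\mathcal P_0\}$. Let $P=\mathrm{Op}^w_\hbar(p_0)$ be the Weyl quantization $$\mathrm{Op}^w_\hbar(p)u(x)=\frac1{(2\pi\hbar)^d}\iint e^{\frac i\hbar\langle x-y,\xi\rangle}p\big(\tfrac{x+y}2,\xi\big)u(y)\,dy\,d\xi$$ of an $\hbar$-independent symbol $p_0$: a smooth complex function on $\mathbb R^{2d}$ for which there is $N$ such that all derivatives are $O((1+|(x,\xi)|)^N)$. Let $T=U_{\mathcal G}^*PU_{\mathcal G}$, that is, $\langle T\psi,\varphi\rangle=\langle PU_{\mathcal G}\psi,U_{\mathcal G}\varphi\rangle_{L^2}$. **Theorem.** Let $\varepsilon>0$ and let $K$ be a compact subset of $\{\xi:\ \|\xi\|\le 1-\varepsilon,\ \sigma(\xi)\notin G\mathcal P_0\}$. Then there is a family $(t_\hbar)_{0<\hbar\le1}$ of smooth functions on $\mathbb R^{2d}$, whose derivatives of order $k$ are $O((1+|x|)^{M_k})$ uniformly in $\hbar$ and $\xi$ for each $k$, such that: 1. In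 the region $\mathbb R^d\times K$, $t_\hbar=t_0+O(\hbar^2)$ with $$t_0(x,\xi)=J(\xi)\;p_0\circ\kappa_{U_{\mathcal G}}(x,\xi);$$ precisely, for each $k$ there are $C,M$ such that $\|D^k(t_\hbar-t_0)(x,\xi)\|\le C\hbar^2(1+|x|)^M$ for all $x\in\mathbb R^d$, $\xi\in K$, $0<\hbar\le1$. In particular, the subprincipal term $\hbar t_1$ vanishes. 2. $t_\hbar$ is the Weyl symbol of $T$, microlocally over every compact $L\subset K$ on which $g$ is injective (for instance, over the part of $K$ in a sufficiently small closed ball around any of its points, since $dg$ is invertible on $K$): there is $M$ such that for every $n$ there is $C$ such that, for all $0<\hbar\le 1$ and all Schwartz functions $\psi,\varphi$ with $\mathcal F_\hbar\psi$ and $\mathcal F_\hbar\varphi$ vanishing outside $L$, $$\big|\langle T\psi,\varphi\rangle-\langle \mathrm{Op}^w_\hbar(t_\hbar)\psi,\varphi\rangle\big|\le C\hbar^n\,\|(1+|x|)^M\psi\|_{L^2}\,\|(1+|x|)^M\varphi\|_{L^2}.$$ -/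

import Mathlib

open scoped ContDiff SchwartzMap

noncomputable section

namespace TiltedHologram

/-- The space `ℝ^d` of positions `x` and of frequencies `ξ`. -/
abbrev E (d : ℕ) : Type := EuclideanSpace ℝ (Fin d)

/-- The ambient space `ℝ^{1+d}`, with coordinates `(x₀, x₁, …, x_d)`, where `x₀` has index `0`. -/
abbrev A (d : ℕ) : Type := EuclideanSpace ℝ (Fin (d + 1))

/-- The vector `(s, x)` of `ℝ^{1+d}`. -/
def cons {d : ℕ} (s : ℝ) (x : E d) : A d :=
  WithLp.toLp 2 (Fin.cons s x.ofLp : Fin (d + 1) → ℝ)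

/-- The projection `π : ℝ^{1+d} → ℝ^d` that forgets `x₀`. -/
def proj {d : ℕ} (X : A d) : E d :=
  WithLp.toLp 2 (Fin.tail X.ofLp : Fin d → ℝ)

/-- The hyperplane `𝒫₀ = {ξ₀ = 0}` of `ℝ^{1+d}`. -/
def hyperplane (d : ℕ) : Set (A d) := {X | X 0 = 0}

/-- The lift `σ(ξ) = (√(1 - ‖ξ‖²), ξ)` to the right unit hemisphere (meaningful for `‖ξ‖ ≤ 1`). -/
def sigma {d : ℕ} (ξ : E d) : A d := cons (Real.sqrt (1 - ‖ξ‖ ^ 2)) ξ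

/-- The affine map `τ_γ ∘ G : X ↦ G X + γ`. -/
def affine {d : ℕ} (G : A d ≃L[ℝ] A d) (γ : A d) : A d → A d := fun X => G X + γ

/-- `g(ξ) = π (ᵗG σ(ξ))`. -/
def gMap {d : ℕ} (G : A d ≃L[ℝ] A d) (ξ : E d) : E d :=
  proj (ContinuousLinearMap.adjoint (G : A d →L[ℝ] A d) (sigma ξ))

/-- The Jacobian `J(ξ) = |det dg(ξ)|⁻¹`. -/
def jac {d : ℕ} (G : A d ≃L[ℝ] A d) (ξ : E d) : ℝ := |(fderiv ℝ (gMap G) ξ).det|⁻¹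

/-- The set of frequencies where `σ(ξ)` is defined, at distance `ε` from the unit sphere, and where
the light ray `σ(ξ)` is not parallel to `G 𝒫₀`. -/
def region {d : ℕ} (G : A d ≃L[ℝ] A d) (ε : ℝ) : Set (E d) :=
  {ξ | ‖ξ‖ ≤ 1 - ε ∧ sigma ξ ∉ G '' hyperplane d}

/-- `κ_{U_G}(x, ξ) = ((ᵗdg(ξ))⁻¹ x, g(ξ))`. -/
def kappaLin {d : ℕ} (G : A d ≃L[ℝ] A d) (z : E d × E d) : E d × E d :=
  ((ContinuousLinearMap.adjoint (fderiv ℝ (gMap G) z.2)).inverse z.1, gMap G z.2)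

/-- `κ_{U_γ}(x, ξ) = (x - dS(ξ), ξ)`, where `S(ξ) = ⟨γ, σ(ξ)⟩`. -/
def kappaTrans {d : ℕ} (γ : A d) (z : E d × E d) : E d × E d :=
  (z.1 - gradient (fun ξ : E d => inner ℝ γ (sigma ξ)) z.2, z.2)

/-- The canonical transformation of `U_𝒢`, `𝒢 = τ_γ ∘ G`: it is `κ_{U_G} ∘ κ_{U_γ}`. -/
def kappa {d : ℕ} (G : A d ≃L[ℝ] A d) (γ : A d) (z : E d × E d) : E d × E d :=
  kappaLin G (kappaTrans γ z)

/-- The semiclassical Fourier transform `ℱ_ħ ψ(ξ) = ∫ e^{-(i/ħ)⟨x, ξ⟩} ψ(x) dx`. -/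
def fourierH {d : ℕ} (ħ : ℝ) (ψ : E d → ℂ) (ξ : E d) : ℂ :=
  ∫ x, Complex.exp (-(Complex.I / ħ) * (inner ℝ x ξ : ℝ)) * ψ x

/-- `V_𝒢 φ(x̃) = (2πħ)^{-d} ∫ e^{(i/ħ)⟨𝒢(0, x̃), σ(ξ)⟩} φ(ξ) dξ`. -/
def opV {d : ℕ} (ħ : ℝ) (𝒢 : A d → A d) (φ : E d → ℂ) (x : E d) : ℂ :=
  ((2 * Real.pi * ħ : ℝ) ^ d : ℂ)⁻¹ *
    ∫ ξ, Complex.exp ((Complex.I / ħ) * (inner ℝ (𝒢 (cons 0 x)) (sigma ξ) : ℝ)) * φ ξ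

/-- The rotated angular spectrum propagator `U_𝒢 = V_𝒢 ∘ ℱ_ħ`. -/
def opU {d : ℕ} (ħ : ℝ) (𝒢 : A d → A d) (ψ : E d → ℂ) : E d → ℂ := opV ħ 𝒢 (fourierH ħ ψ)

/-- Weyl quantization,
`Op_ħ^w(p) u(x) = (2πħ)^{-d} ∫ (∫ e^{(i/ħ)⟨x - y, ξ⟩} p((x + y)/2, ξ) u(y) dy) dξ`.
For a Schwartz function `u` and a symbol `p` in one of the two classes below, both of the iterated
integrals converge absolutely. -/
def weylOp {d : ℕ} (ħ : ℝ) (p : E d × E d → ℂ) (u : E d → ℂ) (x : E d) : ℂ :=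
  ((2 * Real.pi * ħ : ℝ) ^ d : ℂ)⁻¹ *
    ∫ ξ, ∫ y, Complex.exp ((Complex.I / ħ) * (inner ℝ (x - y) ξ : ℝ)) *
      p ((2⁻¹ : ℝ) • (x + y), ξ) * u y

/-- The `L²` scalar product, linear in the first argument. -/
def pairing {d : ℕ} (u v : E d → ℂ) : ℂ := ∫ x, u x * (starRingEnd ℂ) (v x)

/-- The norm `‖(1 + |x|)^M u‖_{L²}`. -/
def weightedNorm {d : ℕ} (M : ℕ) (u : E d → ℂ) : ℝ :=
  Real.sqrt (∫ x, ((1 + ‖x‖) ^ M * ‖u x‖) ^ 2)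

/-- Symbols on phase space: smooth functions all of whose derivatives are `O((1 + |(x, ξ)|)^N)` with
one and the same `N`. This is the union of the classes `S(m)` over all order functions `m`. -/
def IsSymbol {d : ℕ} (p : E d × E d → ℂ) : Prop :=
  ContDiff ℝ ∞ p ∧
    ∃ N : ℕ, ∀ k : ℕ, ∃ C : ℝ, ∀ z, ‖iteratedFDeriv ℝ k p z‖ ≤ C * (1 + ‖z‖) ^ N

/-- Families `(t_ħ)`, `0 < ħ ≤ 1`, of symbols that are bounded uniformly in `ħ`: the derivatives of
order `k` are `O((1 + |x|)^{M_k})`, uniformly in `ħ` and in `ξ`. -/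
def IsSymbolFamily {d : ℕ} (t : ℝ → E d × E d → ℂ) : Prop :=
  (∀ ħ : ℝ, 0 < ħ → ħ ≤ 1 → ContDiff ℝ ∞ (t ħ)) ∧
    ∀ k : ℕ, ∃ (C : ℝ) (M : ℕ), ∀ ħ : ℝ, 0 < ħ → ħ ≤ 1 → ∀ z : E d × E d,
      ‖iteratedFDeriv ℝ k (t ħ) z‖ ≤ C * (1 + ‖z.1‖) ^ M

/-- `t_ħ = t₀ + O(ħ²)` over the set of frequencies `K`, for the derivatives of all orders, with
constants that are uniform in `ħ` and in `ξ ∈ K`, and at most polynomial in `x`. -/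
def EqUpToSq {d : ℕ} (t : ℝ → E d × E d → ℂ) (t₀ : E d × E d → ℂ) (K : Set (E d)) : Prop :=
  ∀ k : ℕ, ∃ (C : ℝ) (M : ℕ), ∀ ħ : ℝ, 0 < ħ → ħ ≤ 1 → ∀ x : E d, ∀ ξ ∈ K,
    ‖iteratedFDeriv ℝ k (fun z => t ħ z - t₀ z) (x, ξ)‖ ≤ C * ħ ^ 2 * (1 + ‖x‖) ^ M

/-- A family `T_ħ` of sesquilinear forms (`T_ħ ψ φ` stands for `⟨T_ħ ψ, φ⟩`) is represented,
microlocally over the set of frequencies `K`, by the Weyl symbol `t_ħ`: one has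
`T_ħ = Op_ħ^w(t_ħ) + O(ħ^∞)` on the functions whose semiclassical Fourier transform lives in `K`. -/
def HasWeylSymbolOn {d : ℕ} (T : ℝ → (E d → ℂ) → (E d → ℂ) → ℂ) (t : ℝ → E d × E d → ℂ)
    (K : Set (E d)) : Prop :=
  ∃ M : ℕ, ∀ n : ℕ, ∃ C : ℝ, ∀ ħ : ℝ, 0 < ħ → ħ ≤ 1 → ∀ ψ φ : 𝓢(E d, ℂ),
    (∀ ξ, ξ ∉ K → fourierH ħ ψ ξ = 0) → (∀ ξ, ξ ∉ K → fourierH ħ φ ξ = 0) →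
      ‖T ħ ψ φ - pairing (weylOp ħ (t ħ) ψ) φ‖ ≤
        C * ħ ^ n * weightedNorm M ψ * weightedNorm M φ

/-- The operator `U_𝒢^* Op_ħ^w(p) U_𝒢`, as the form `⟨U_𝒢^* P U_𝒢 ψ, φ⟩ = ⟨P U_𝒢 ψ, U_𝒢 φ⟩`. -/
def conjForm {d : ℕ} (𝒢 : A d → A d) (p : E d × E d → ℂ) (ħ : ℝ) (ψ φ : E d → ℂ) : ℂ :=
  pairing (weylOp ħ p (opU ħ 𝒢 ψ)) (opU ħ 𝒢 φ)

end TiltedHologram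

end

open scoped ContDiff SchwartzMap

set_option linter.unusedSectionVars false

noncomputable section

namespace TiltedHologram

open Function MeasureTheory Real
open scoped FourierTransform

/-! ### Functions of temperate growth and the elementary wave -/

section Temperate

variable {X Y V W : Type} [NormedAddCommGroup X] [NormedSpace ℝ X]
  [NormedAddCommGroup Y] [NormedSpace ℝ Y] [NormedAddCommGroup V] [NormedSpace ℝ V]
  [NormedAddCommGroup W] [NormedSpace ℝ W]

/-! Over a bounded set of frequencies, `p₀` is a weight `(1 + ‖x‖²)^N` times a superposition of
plane waves `e^{2πi(⟨k,x⟩+⟨l,ξ⟩)}` whose density `Q` decreases rapidly (`IsSymbol.exists_density`).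
The weight is produced by applying `bessel^[N]` in `k` to the wave, so it suffices to treat plane
waves, with control of their dependence on `k` and `l`.

The Weyl quantization of a plane wave has the matrix elements `∫ e^{2πi⟨l,ξ⟩} û(ξ - πħk) conj v̂(ξ +
πħk) dξ`, up to `(2πħ)^{-d}` (`pairing_weylOp`, `integral_fourier_slice_mul`). For `u = U ψ` one has
`û(g(θ)) = J(θ) e^{iS(θ)/ħ} ψ̂(θ)` on `L`. With `κ = 2πħk`, the points `ξ ∓ κ/2` are the images of
the ends `θ ∓ w/2` of a chord, where `w = w(θ, κ)` solves `g(θ + w/2) - g(θ - w/2) = κ`. Taking the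
middle point `θ` as the variable (`PhaseData.integral_chord`) gives an integral of `ψ̂(θ - w/2) conj
φ̂(θ + w/2)`. Writing `w = B κ` and `S(θ + w/2) - S(θ - w/2) = D κ`, this integral is again a matrix
element of a Weyl operator, with symbol `c e^{2πi(⟨l,m⟩ + ⟨x,Bk⟩ - Dk)}`, where `m` is the middle
point of the image chord and `c` an amplitude. The superposition of these symbols, with `s = 2πħ` as
a parameter, is `t_ħ`.

The chord `w` is odd in `κ`, as exchanging the ends reverses both chords. Hence `m`, `c`, `Bk` and
`Dk` are even in `s`, the symbol is even in `s`, and Hadamard's lemma applied twice gives `t_ħ - t₀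
= O(ħ²)` (`PhaseData.symbolOf_neg`, `eqUpToSq_of_even`). At `s = 0` the operator `B` is `dg⁻¹`, and
the kernel is `J` times the plane wave at `κ_U(x, θ)` (`PhaseData.symbolOf_zero`).

The chord equation is solved only for `‖κ‖ < δ`. The remaining waves have `‖k‖ ≥ δ/(2πħ)`; the rapid
decay of `Q` makes their contribution `O(ħ^∞)`, against bounds that lose only a fixed power of `ħ⁻¹`
(`exists_remainder_bound`). -/

@[fun_prop]
theorem _root_.Function.HasTemperateGrowth.prodMk {f : X → V} {g : X → W} (hf : HasTemperateGrowth f)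
    (hg : HasTemperateGrowth g) : HasTemperateGrowth (fun x => (f x, g x)) := by
  have h := ((ContinuousLinearMap.inl ℝ V W).hasTemperateGrowth.comp hf).add
    ((ContinuousLinearMap.inr ℝ V W).hasTemperateGrowth.comp hg)
  convert h using 1
  ext x <;> simp

@[fun_prop]
theorem _root_.Function.HasTemperateGrowth.fst {f : X → V × W} (hf : HasTemperateGrowth f) :
    HasTemperateGrowth (fun x => (f x).1) :=
  (ContinuousLinearMap.fst ℝ V W).hasTemperateGrowth.comp hf

@[fun_prop]
theorem _root_.Function.HasTemperateGrowth.snd {f : X → V × W} (hf : HasTemperateGrowth f) :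
    HasTemperateGrowth (fun x => (f x).2) :=
  (ContinuousLinearMap.snd ℝ V W).hasTemperateGrowth.comp hf

@[fun_prop]
theorem _root_.Function.HasTemperateGrowth.clm_apply {f : X → V →L[ℝ] W} {g : X → V} (hf : HasTemperateGrowth f)
    (hg : HasTemperateGrowth g) : HasTemperateGrowth (fun x => f x (g x)) :=
  (ContinuousLinearMap.id ℝ (V →L[ℝ] W)).bilinear_hasTemperateGrowth hf hg

@[fun_prop]
theorem _root_.Function.HasTemperateGrowth.inner {d : ℕ} {f g : X → E d} (hf : HasTemperateGrowth f)
    (hg : HasTemperateGrowth g) : HasTemperateGrowth (fun x => (inner ℝ (f x) (g x) : ℝ)) :=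
  (innerSL ℝ).bilinear_hasTemperateGrowth hf hg

@[fun_prop]
theorem _root_.Function.HasTemperateGrowth.ofReal {f : X → ℝ} (hf : HasTemperateGrowth f) :
    HasTemperateGrowth (fun x => (f x : ℂ)) :=
  Complex.ofRealCLM.hasTemperateGrowth.comp hf

theorem _root_.Function.HasTemperateGrowth.fderiv_comp {f : X → V} (hf : HasTemperateGrowth f) :
    HasTemperateGrowth (fderiv ℝ f) := by
  refine ⟨hf.1.fderiv_right (by simp), fun n => ?_⟩
  obtain ⟨k, C, h⟩ := hf.2 (n + 1)
  exact ⟨k, C, fun x => by rw [norm_iteratedFDeriv_fderiv]; exact h x⟩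

theorem _root_.Function.HasTemperateGrowth.bound {f : X → V} (hf : HasTemperateGrowth f) :
    ∃ (n : ℕ) (C : ℝ), 0 ≤ C ∧ ∀ x, ‖f x‖ ≤ C * (1 + ‖x‖) ^ n := by
  obtain ⟨k, C, hC, h⟩ := hf.norm_iteratedFDeriv_le_uniform 0
  exact ⟨k, C, hC, fun x => by simpa using h 0 le_rfl x⟩

/-- The elementary wave `e^{2πit}`. -/
def wave (t : ℝ) : ℂ := Complex.exp (2 * π * Complex.I * t)

theorem norm_wave (t : ℝ) : ‖wave t‖ = 1 := by
  have : (2 * π * Complex.I * t : ℂ) = ((2 * π * t : ℝ) : ℂ) * Complex.I := by push_cast; ring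
  rw [wave, this, Complex.norm_exp_ofReal_mul_I]

theorem wave_add (s t : ℝ) : wave (s + t) = wave s * wave t := by
  rw [wave, wave, wave, ← Complex.exp_add]; congr 1; push_cast; ring

theorem conj_wave (t : ℝ) : (starRingEnd ℂ) (wave t) = wave (-t) := by
  rw [wave, wave, ← Complex.exp_conj]; congr 1; simp [Complex.conj_ofNat]

theorem wave_eq_fourierChar (t : ℝ) : wave t = (Real.fourierChar t : ℂ) := by
  rw [wave, Real.fourierChar_apply]; congr 1; push_cast; ring

theorem hasDerivAt_wave (t : ℝ) : HasDerivAt wave (2 * π * Complex.I * wave t) t := by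
  have h : HasDerivAt (fun s : ℝ => 2 * π * Complex.I * (s : ℂ)) (2 * π * Complex.I * 1) t :=
    (Complex.ofRealCLM.hasDerivAt (x := t)).const_mul (2 * π * Complex.I)
  have h' := h.cexp
  rw [mul_one, mul_comm (Complex.exp _)] at h'
  exact h'

/-- Every derivative is a constant multiple of `wave`, hence bounded. -/
theorem hasTemperateGrowth_wave : HasTemperateGrowth wave := by
  have hd : deriv wave = fun t => 2 * π * Complex.I * wave t :=
    funext fun t => (hasDerivAt_wave t).deriv
  have hit : ∀ n, iteratedDeriv n wave = fun t => (2 * π * Complex.I) ^ n * wave t := by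
    intro n
    induction n with
    | zero => simp
    | succ n ih =>
      rw [iteratedDeriv_succ, ih]
      ext t
      rw [deriv_const_mul _ (hasDerivAt_wave t).differentiableAt, hd]; ring
  refine ⟨?_, fun n => ⟨0, ‖(2 * π * Complex.I : ℂ) ^ n‖, fun t => ?_⟩⟩
  · change ContDiff ℝ ∞ (fun t : ℝ => Complex.exp (2 * π * Complex.I * t))
    exact (contDiff_const.mul Complex.ofRealCLM.contDiff).cexp
  · rw [norm_iteratedFDeriv_eq_norm_iteratedDeriv, hit, norm_mul, norm_wave]; simp

@[fun_prop]
theorem _root_.Function.HasTemperateGrowth.wave_comp {f : X → ℝ} (hf : HasTemperateGrowth f) :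
    HasTemperateGrowth (fun x => wave (f x)) :=
  hasTemperateGrowth_wave.comp hf

theorem one_add_norm_prod_le (x : X) (y : Y) : 1 + ‖(x, y)‖ ≤ (1 + ‖x‖) * (1 + ‖y‖) := by
  rw [Prod.norm_def]
  have hx := norm_nonneg x
  have hy := norm_nonneg y
  rcases max_cases ‖x‖ ‖y‖ with ⟨h, -⟩ | ⟨h, -⟩ <;> rw [h] <;> nlinarith [mul_nonneg hx hy]

/-- The derivatives of a slice of a function of temperate growth. -/
theorem _root_.Function.HasTemperateGrowth.slice_bound {f : X × Y → V} (hf : HasTemperateGrowth f) (k : ℕ) :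
    ∃ (n : ℕ) (C : ℝ), 0 ≤ C ∧ ∀ x y,
      ‖iteratedFDeriv ℝ k (fun x' => f (x', y)) x‖ ≤ C * (1 + ‖(x, y)‖) ^ n := by
  obtain ⟨n, C, hC, h⟩ := hf.norm_iteratedFDeriv_le_uniform k
  refine ⟨n, C, hC, fun x y => ?_⟩
  have e : (fun x' => f (x', y)) =
      (fun z => f (z + (0, y))) ∘ (ContinuousLinearMap.inl ℝ X Y) := by
    ext x'; simp
  have hsm : ContDiff ℝ ∞ (fun z => f (z + (0, y))) := hf.1.comp (by fun_prop)
  rw [e, ContinuousLinearMap.iteratedFDeriv_comp_right _ hsm _ (mod_cast le_top)]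
  refine (ContinuousMultilinearMap.norm_compContinuousLinearMap_le _ _).trans ?_
  rw [iteratedFDeriv_comp_add_right]
  have h1 : ∏ _i : Fin k, ‖ContinuousLinearMap.inl ℝ X Y‖ ≤ 1 :=
    Finset.prod_le_one (fun _ _ => norm_nonneg _) fun _ _ =>
      ContinuousLinearMap.opNorm_le_bound _ zero_le_one fun x => by simp
  have h2 := h k le_rfl (x, y)
  calc _ ≤ ‖iteratedFDeriv ℝ k f (x, y)‖ * 1 := by
        gcongr
        simp
    _ ≤ _ := by simpa using h2

end Temperate

/-! ### Integrals against rapidly decreasing densities -/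

section Rapid

variable {X Y V : Type} [NormedAddCommGroup X] [NormedSpace ℝ X]
  [NormedAddCommGroup Y] [NormedSpace ℝ Y] [MeasurableSpace Y] [OpensMeasurableSpace Y]
  [SecondCountableTopology Y]
  {𝕜 : Type} [RCLike 𝕜]
  [NormedAddCommGroup V] [NormedSpace ℝ V] [NormedSpace 𝕜 V] [IsScalarTower ℝ 𝕜 V]
  {μ : Measure Y}

/-- Rapid decay in the mean: all the moments are integrable. -/
structure Rapid {Y 𝕜 : Type} [NormedAddCommGroup Y] [MeasurableSpace Y] [RCLike 𝕜]
    (μ : Measure Y) (q : Y → 𝕜) : Prop where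
  meas : AEStronglyMeasurable q μ
  int : ∀ n : ℕ, Integrable (fun y => (1 + ‖y‖) ^ n * ‖q y‖) μ

theorem Rapid.integrable {q : Y → 𝕜} (hq : Rapid μ q) : Integrable q μ := by
  have := hq.int 0
  simp only [pow_zero, one_mul] at this
  exact (integrable_norm_iff hq.meas).1 this

theorem Rapid.integrable_of_bound {q : Y → 𝕜} (hq : Rapid μ q) {F : Y → V} (hF : Continuous F)
    {n : ℕ} {C : ℝ} (h : ∀ y, ‖F y‖ ≤ C * (1 + ‖y‖) ^ n) :
    Integrable (fun y => q y • F y) μ := by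
  refine ((hq.int n).const_mul C).mono' (hq.meas.smul hF.aestronglyMeasurable)
    (Filter.Eventually.of_forall fun y => ?_)
  rw [norm_smul]
  calc _ ≤ ‖q y‖ * (C * (1 + ‖y‖) ^ n) := by gcongr; exact h y
    _ = _ := by ring

theorem Rapid.integrable_smul {q : Y → 𝕜} (hq : Rapid μ q) {F : X × Y → V}
    (hF : HasTemperateGrowth F) (x : X) : Integrable (fun y => q y • F (x, y)) μ := by
  obtain ⟨n, C, hC, h⟩ := hF.bound
  refine hq.integrable_of_bound (hF.1.continuous.comp (by fun_prop)) (n := n)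
    (C := C * (1 + ‖x‖) ^ n) fun y => (h _).trans ?_
  rw [mul_assoc, ← mul_pow]
  gcongr
  exact one_add_norm_prod_le x y

theorem Rapid.norm_integral_le {q : Y → 𝕜} (hq : Rapid μ q) {F : X × Y → V}
    {n : ℕ} {C : ℝ} (h : ∀ z, ‖F z‖ ≤ C * (1 + ‖z‖) ^ n) (hC : 0 ≤ C) (x : X) :
    ‖∫ y, q y • F (x, y) ∂μ‖ ≤
      (C * ∫ y, (1 + ‖y‖) ^ n * ‖q y‖ ∂μ) * (1 + ‖x‖) ^ n := by
  rw [mul_right_comm, ← integral_const_mul]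
  refine norm_integral_le_of_norm_le ((hq.int n).const_mul _)
    (Filter.Eventually.of_forall fun y => ?_)
  rw [norm_smul]
  calc _ ≤ ‖q y‖ * (C * ((1 + ‖x‖) * (1 + ‖y‖)) ^ n) := by
        gcongr
        refine (h _).trans ?_
        gcongr
        exact one_add_norm_prod_le x y
    _ = _ := by rw [mul_pow]; ring

theorem Rapid.hasFDerivAt_integral {q : Y → 𝕜} (hq : Rapid μ q) {F : X × Y → V}
    (hF : HasTemperateGrowth F) (x : X) :
    HasFDerivAt (fun x => ∫ y, q y • F (x, y) ∂μ)
      (∫ y, q y • (fderiv ℝ F (x, y)).comp (ContinuousLinearMap.inl ℝ X Y) ∂μ) x := by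
  have hF' : HasTemperateGrowth
      (fun z => (fderiv ℝ F z).comp (ContinuousLinearMap.inl ℝ X Y)) :=
    (((ContinuousLinearMap.compL ℝ X (X × Y) V).flip
      (ContinuousLinearMap.inl ℝ X Y)).hasTemperateGrowth).comp (HasTemperateGrowth.fderiv_comp hF)
  obtain ⟨n, C, hC, h⟩ := hF'.bound
  refine hasFDerivAt_integral_of_dominated_of_fderiv_le (s := Metric.ball x 1)
    (F' := fun x y => q y • (fderiv ℝ F (x, y)).comp (ContinuousLinearMap.inl ℝ X Y))
    (bound := fun y => (C * (2 + ‖x‖) ^ n) * ((1 + ‖y‖) ^ n * ‖q y‖))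
    (Metric.ball_mem_nhds x one_pos)
    (Filter.Eventually.of_forall fun x' => (hq.integrable_smul hF x').aestronglyMeasurable)
    (hq.integrable_smul hF x) (hq.integrable_smul hF' x).aestronglyMeasurable
    (Filter.Eventually.of_forall fun y x' hx' => ?_) ((hq.int n).const_mul _)
    (Filter.Eventually.of_forall fun y x' _ => ?_)
  · rw [norm_smul]
    have h1 : ‖x'‖ ≤ 1 + ‖x‖ := by
      have := norm_sub_norm_le x' x
      have := mem_ball_iff_norm.1 hx'
      linarith
    calc _ ≤ ‖q y‖ * (C * ((2 + ‖x‖) * (1 + ‖y‖)) ^ n) := by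
          gcongr
          refine (h (x', y)).trans ?_
          gcongr
          refine (one_add_norm_prod_le x' y).trans ?_
          refine mul_le_mul_of_nonneg_right (by linarith) (by positivity)
      _ = _ := by rw [mul_pow]; ring
  · have h1 : HasFDerivAt F (fderiv ℝ F (x', y)) (x', y) :=
      (hF.1.differentiable (by simp)).differentiableAt.hasFDerivAt
    have h2 : HasFDerivAt (fun x' : X => (x', y)) (ContinuousLinearMap.inl ℝ X Y) x' :=
      (hasFDerivAt_id x').prodMk (hasFDerivAt_const y x')
    exact (h1.comp x' h2).const_smul (q y)

/-- The polynomial growth of each derivative of `F` in `y` is absorbed by a moment of `q`, so one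
may differentiate under the integral any number of times. -/
theorem Rapid.temperate_integral {q : Y → 𝕜} (hq : Rapid μ q) {F : X × Y → V}
    (hF : HasTemperateGrowth F) : HasTemperateGrowth (fun x => ∫ y, q y • F (x, y) ∂μ) := by
  -- The target space varies with the induction: the step applies the case `k` to the derivative,
  -- which takes values in `X →L[ℝ] V`.
  have key : ∀ (k : ℕ) (V : Type) [NormedAddCommGroup V] [NormedSpace ℝ V] [NormedSpace 𝕜 V]
      [IsScalarTower ℝ 𝕜 V] (F : X × Y → V), HasTemperateGrowth F →
      ContDiff ℝ k (fun x => ∫ y, q y • F (x, y) ∂μ) ∧ ∃ (n : ℕ) (C : ℝ), ∀ x,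
        ‖iteratedFDeriv ℝ k (fun x => ∫ y, q y • F (x, y) ∂μ) x‖ ≤ C * (1 + ‖x‖) ^ n := by
    intro k
    induction k with
    | zero =>
      intro V _ _ _ _ F hF
      refine ⟨contDiff_zero.2 (continuous_iff_continuousAt.2 fun x =>
        (hq.hasFDerivAt_integral hF x).continuousAt), ?_⟩
      obtain ⟨n, C, hC, h⟩ := hF.bound
      exact ⟨n, _, fun x => by simpa using hq.norm_integral_le h hC x⟩
    | succ k ih =>
      intro V _ _ _ _ F hF
      have hF' : HasTemperateGrowth
          (fun z => (fderiv ℝ F z).comp (ContinuousLinearMap.inl ℝ X Y)) :=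
        (((ContinuousLinearMap.compL ℝ X (X × Y) V).flip
          (ContinuousLinearMap.inl ℝ X Y)).hasTemperateGrowth).comp
            (HasTemperateGrowth.fderiv_comp hF)
      obtain ⟨h1, n, C, h2⟩ := ih (X →L[ℝ] V) _ hF'
      have hfd : fderiv ℝ (fun x => ∫ y, q y • F (x, y) ∂μ) = fun x =>
          ∫ y, q y • (fderiv ℝ F (x, y)).comp (ContinuousLinearMap.inl ℝ X Y) ∂μ :=
        funext fun x => (hq.hasFDerivAt_integral hF x).fderiv
      refine ⟨?_, n, C, fun x => ?_⟩
      · rw [show ((k + 1 : ℕ) : WithTop ℕ∞) = (k : WithTop ℕ∞) + 1 by norm_cast,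
          contDiff_succ_iff_fderiv]
        refine ⟨fun x => (hq.hasFDerivAt_integral hF x).differentiableAt, by simp, ?_⟩
        rw [hfd]; exact h1
      · rw [← norm_iteratedFDeriv_fderiv, hfd]; exact h2 x
  refine ⟨contDiff_infty.2 fun k => (key k V F hF).1, fun k => (key k V F hF).2⟩

theorem Rapid.fderiv_integral_apply {q : Y → 𝕜} (hq : Rapid μ q) {F : X × Y → V} [CompleteSpace V]
    (hF : HasTemperateGrowth F) (x v : X) :
    fderiv ℝ (fun x => ∫ y, q y • F (x, y) ∂μ) x v =
      ∫ y, q y • fderiv ℝ F (x, y) (v, 0) ∂μ := by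
  have hF' : HasTemperateGrowth
      (fun z => (fderiv ℝ F z).comp (ContinuousLinearMap.inl ℝ X Y)) :=
    (((ContinuousLinearMap.compL ℝ X (X × Y) V).flip
      (ContinuousLinearMap.inl ℝ X Y)).hasTemperateGrowth).comp (HasTemperateGrowth.fderiv_comp hF)
  rw [(hq.hasFDerivAt_integral hF x).fderiv,
    ContinuousLinearMap.integral_apply (hq.integrable_smul hF' x)]
  simp

theorem rapid_one_unitInterval :
    Rapid (volume.restrict (Set.Icc (0 : ℝ) 1)) (fun _ : ℝ => (1 : ℝ)) := by
  refine ⟨by fun_prop, fun n => ?_⟩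
  exact Continuous.integrableOn_Icc (by fun_prop)

/-- Division by a variable: Hadamard's lemma for functions of temperate growth. -/
theorem exists_temperate_factor {U W : Type} [NormedAddCommGroup U] [NormedSpace ℝ U]
    [NormedAddCommGroup W] [NormedSpace ℝ W] [CompleteSpace W] {f : X × U → W}
    (hf : HasTemperateGrowth f) (h0 : ∀ x, f (x, 0) = 0) :
    ∃ F : X × U → U →L[ℝ] W, HasTemperateGrowth F ∧ (∀ x v, f (x, v) = F (x, v) v) ∧
      ∀ x, F (x, 0) = fderiv ℝ (fun v => f (x, v)) 0 := by
  set D : X × U → U →L[ℝ] W :=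
    fun z => (fderiv ℝ f z).comp (ContinuousLinearMap.inr ℝ X U) with hD
  have hDt : HasTemperateGrowth D :=
    (((ContinuousLinearMap.compL ℝ U (X × U) W).flip
      (ContinuousLinearMap.inr ℝ X U)).hasTemperateGrowth).comp (HasTemperateGrowth.fderiv_comp hf)
  have hD' : ∀ x v, HasFDerivAt (fun v => f (x, v)) (D (x, v)) v := fun x v =>
    ((hf.1.differentiable (by simp)).differentiableAt.hasFDerivAt (x := (x, v))).comp v
      ((hasFDerivAt_const x v).prodMk (hasFDerivAt_id v))
  have hF : HasTemperateGrowth (fun z : (X × U) × ℝ => D (z.1.1, z.2 • z.1.2)) :=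
    hDt.comp (f := fun z : (X × U) × ℝ => (z.1.1, z.2 • z.1.2)) (by fun_prop)
  -- The mean of the partial derivative over the segment from `0` to `v`. The factor `1` is the
  -- density of `rapid_one_unitInterval`, so that the mean inherits temperate growth.
  refine ⟨fun z => ∫ r, (1 : ℝ) • D (z.1, r • z.2) ∂(volume.restrict (Set.Icc (0 : ℝ) 1)),
    rapid_one_unitInterval.temperate_integral hF, fun x v => ?_, fun x => ?_⟩
  · rw [ContinuousLinearMap.integral_apply (rapid_one_unitInterval.integrable_smul hF (x, v))]
    have hc : Continuous fun r : ℝ => D (x, r • v) v :=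
      (hDt.1.continuous.comp (by fun_prop : Continuous fun r : ℝ => (x, r • v))).clm_apply
        continuous_const
    have := intervalIntegral.integral_eq_sub_of_hasDerivAt (a := 0) (b := 1)
      (f := fun r : ℝ => f (x, r • v)) (f' := fun r => D (x, r • v) v)
      (fun r _ => by
        have h1 : HasDerivAt (fun r : ℝ => r • v) ((1 : ℝ) • v) r :=
          (hasDerivAt_id r).smul_const v
        have h2 := (hD' x (r • v)).comp_hasDerivAt r h1
        rw [one_smul] at h2
        exact h2) (hc.intervalIntegrable _ _)
    rw [intervalIntegral.integral_of_le zero_le_one, ← integral_Icc_eq_integral_Ioc] at this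
    simpa [h0] using this.symm
  · simp [(hD' x 0).fderiv]

end Rapid

/-! ### The operator that turns a wave into a weighted wave -/

section Bessel

variable {d : ℕ} {X : Type} [NormedAddCommGroup X] [NormedSpace ℝ X]

/-- The operator `1 - Δ / (4π²)`, which acts on `e^{2πi⟨k, m⟩}` as the factor `1 + ‖m‖²`. -/
def bessel (f : E d → ℂ) : E d → ℂ := fun k =>
  f k - ((4 * π ^ 2 : ℝ) : ℂ)⁻¹ * ∑ j : Fin d, fderiv ℝ
    (fun k' => fderiv ℝ f k' (EuclideanSpace.single j (1 : ℝ))) k (EuclideanSpace.single j (1 : ℝ))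

/-- The operator `1 - Δ / (4π²)` in the first variable. -/
def besselFst (F : E d × X → ℂ) : E d × X → ℂ := fun z =>
  F z - ((4 * π ^ 2 : ℝ) : ℂ)⁻¹ * ∑ j : Fin d, fderiv ℝ
    (fun z' => fderiv ℝ F z' (EuclideanSpace.single j (1 : ℝ), 0)) z
      (EuclideanSpace.single j (1 : ℝ), 0)

theorem temperate_fderiv_apply {V : Type} [NormedAddCommGroup V] [NormedSpace ℝ V] {F : X → V}
    (hF : HasTemperateGrowth F) (v : X) : HasTemperateGrowth (fun z => fderiv ℝ F z v) :=
  (ContinuousLinearMap.apply ℝ V v).hasTemperateGrowth.comp (HasTemperateGrowth.fderiv_comp hF)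

theorem temperate_besselFst {F : E d × X → ℂ} (hF : HasTemperateGrowth F) :
    HasTemperateGrowth (besselFst F) := by
  refine hF.sub ((HasTemperateGrowth.const _).mul (HasTemperateGrowth.sum fun j _ => ?_))
  exact temperate_fderiv_apply (temperate_fderiv_apply hF _) _

theorem fderiv_slice {F : E d × X → ℂ} (hF : HasTemperateGrowth F) (k v : E d) (x : X) :
    fderiv ℝ (fun k => F (k, x)) k v = fderiv ℝ F (k, x) (v, 0) := by
  have h1 : HasFDerivAt F (fderiv ℝ F (k, x)) (k, x) :=
    (hF.1.differentiable (by simp)).differentiableAt.hasFDerivAt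
  have h2 : HasFDerivAt (fun k : E d => (k, x)) (ContinuousLinearMap.inl ℝ (E d) X) k :=
    (hasFDerivAt_id k).prodMk (hasFDerivAt_const x k)
  rw [HasFDerivAt.fderiv (f := fun k => F (k, x)) (h1.comp k h2)]; rfl

theorem bessel_slice {F : E d × X → ℂ} (hF : HasTemperateGrowth F) (x : X) :
    bessel (fun k => F (k, x)) = fun k => besselFst F (k, x) := by
  ext k
  simp only [bessel, besselFst]
  congr 2
  refine Finset.sum_congr rfl fun j _ => ?_
  simp only [fderiv_slice hF]
  exact fderiv_slice (temperate_fderiv_apply hF (EuclideanSpace.single j (1 : ℝ), 0)) _ _ _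

theorem bessel_iterate_slice (N : ℕ) : ∀ {F : E d × X → ℂ}, HasTemperateGrowth F → ∀ x : X,
    bessel^[N] (fun k => F (k, x)) = fun k => besselFst^[N] F (k, x) := by
  induction N with
  | zero => intro F _ x; rfl
  | succ N ih =>
    intro F hF x
    rw [Function.iterate_succ_apply, bessel_slice hF, ih (temperate_besselFst hF)]
    rfl

theorem temperate_besselFst_iterate (N : ℕ) : ∀ {F : E d × X → ℂ}, HasTemperateGrowth F →
    HasTemperateGrowth (besselFst^[N] F) := by
  induction N with
  | zero => intro F hF; exact hF
  | succ N ih => intro F hF; exact ih (temperate_besselFst hF)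

theorem bessel_iterate_integral {Y : Type} [NormedAddCommGroup Y] [NormedSpace ℝ Y]
    [MeasurableSpace Y] [OpensMeasurableSpace Y] [SecondCountableTopology Y] {μ : Measure Y}
    {q : Y → ℂ} (hq : Rapid μ q) (N : ℕ) : ∀ {F : E d × Y → ℂ}, HasTemperateGrowth F →
    bessel^[N] (fun k => ∫ y, q y * F (k, y) ∂μ) =
      fun k => ∫ y, q y * besselFst^[N] F (k, y) ∂μ := by
  induction N with
  | zero => intro F _; rfl
  | succ N ih =>
    intro F hF
    rw [Function.iterate_succ_apply, Function.iterate_succ_apply, ← ih (temperate_besselFst hF)]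
    congr 1
    ext k
    have h1 : ∀ v, (fun k' => fderiv ℝ (fun k => ∫ y, q y * F (k, y) ∂μ) k' v) =
        fun k' => ∫ y, q y • fderiv ℝ F (k', y) (v, 0) ∂μ := fun v =>
      funext fun k' => hq.fderiv_integral_apply hF k' v
    have h2 : ∀ v, fderiv ℝ (fun k' => fderiv ℝ (fun k => ∫ y, q y * F (k, y) ∂μ) k' v) k v =
        ∫ y, q y • fderiv ℝ (fun z => fderiv ℝ F z (v, 0)) (k, y) (v, 0) ∂μ := fun v => by
      rw [h1]
      exact hq.fderiv_integral_apply (temperate_fderiv_apply hF (v, 0)) k v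
    simp only [bessel, besselFst, h2]
    rw [← integral_finsetSum _ fun j _ => hq.integrable_smul (temperate_fderiv_apply
      (temperate_fderiv_apply hF (EuclideanSpace.single j (1 : ℝ), 0)) _) k,
      ← integral_const_mul,
      ← integral_sub (show Integrable (fun y => q y * F (k, y)) μ from hq.integrable_smul hF k)]
    · refine integral_congr_ae (Filter.Eventually.of_forall fun y => ?_)
      simp only [smul_eq_mul, ← Finset.mul_sum]
      ring
    · refine Integrable.const_mul (integrable_finsetSum _ fun j _ => ?_) _
      exact hq.integrable_smul (temperate_fderiv_apply
        (temperate_fderiv_apply hF (EuclideanSpace.single j (1 : ℝ), 0)) _) k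

/-- Differential operators are local. In the remainder estimate this carries an identity valid only
for small `k` through `bessel^[N]`. -/
theorem bessel_congr {f g : E d → ℂ} {s : Set (E d)} (hs : IsOpen s) (h : Set.EqOn f g s) :
    Set.EqOn (bessel f) (bessel g) s := by
  have key : ∀ {f g : E d → ℂ}, Set.EqOn f g s → ∀ v, Set.EqOn (fun k => fderiv ℝ f k v)
      (fun k => fderiv ℝ g k v) s := fun h v k hk => by
    simp only [(h.eventuallyEq_of_mem (hs.mem_nhds hk)).fderiv_eq]
  intro k hk
  simp only [bessel, h hk]
  congr 2
  exact Finset.sum_congr rfl fun j _ => key (key h _) _ hk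

theorem bessel_iterate_congr (N : ℕ) : ∀ {f g : E d → ℂ} {s : Set (E d)}, IsOpen s →
    Set.EqOn f g s → Set.EqOn (bessel^[N] f) (bessel^[N] g) s := by
  induction N with
  | zero => intro f g s _ h; exact h
  | succ N ih => intro f g s hs h; exact ih hs (bessel_congr hs h)

theorem bessel_wave (m : E d) (a : ℂ) :
    bessel (fun k => a * wave (inner ℝ k m)) =
      fun k => ((1 + ‖m‖ ^ 2 : ℝ) : ℂ) * a * wave (inner ℝ k m) := by
  have hd : ∀ (a : ℂ) (v k : E d), fderiv ℝ (fun k => a * wave (inner ℝ k m)) k v =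
      (a * (2 * π * Complex.I * (inner ℝ v m : ℝ))) * wave (inner ℝ k m) := by
    intro a v k
    have h1 : HasFDerivAt (fun k : E d => (inner ℝ k m : ℝ)) ((innerSL ℝ).flip m) k :=
      ((innerSL ℝ).flip m).hasFDerivAt
    have h2 := ((hasDerivAt_wave (inner ℝ k m)).hasFDerivAt.comp k h1).const_mul a
    rw [HasFDerivAt.fderiv (f := fun k => a * wave (inner ℝ k m)) h2, ← real_inner_comm v m]
    simp only [smul_apply, ContinuousLinearMap.comp_apply, smul_eq_mul,
      ContinuousLinearMap.toSpanSingleton_apply, ContinuousLinearMap.flip_apply]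
    rw [show innerSL ℝ v m = inner ℝ v m from rfl, real_inner_comm, Complex.real_smul]
    ring
  ext k
  simp only [bessel, hd]
  have hn : ‖m‖ ^ 2 = ∑ j, (m j) ^ 2 := by
    rw [EuclideanSpace.norm_sq_eq]; simp
  have hi : ∀ j, (inner ℝ (EuclideanSpace.single j (1 : ℝ)) m : ℝ) = m j := fun j => by
    simp [EuclideanSpace.inner_single_left]
  simp only [hi]
  rw [← Finset.sum_mul, hn]
  have : ∑ j, a * (2 * π * Complex.I * ((m j : ℝ) : ℂ)) * (2 * π * Complex.I * ((m j : ℝ) : ℂ)) =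
      -(a * (4 * π ^ 2) * ∑ j, ((m j : ℝ) : ℂ) ^ 2) := by
    rw [Finset.mul_sum, ← Finset.sum_neg_distrib]
    refine Finset.sum_congr rfl fun j _ => ?_
    ring_nf
    rw [Complex.I_sq]; ring
  rw [this]
  have hpi : (π : ℂ) ≠ 0 := by exact_mod_cast Real.pi_ne_zero
  push_cast
  field_simp
  ring

theorem bessel_iterate_wave (N : ℕ) (m : E d) : ∀ a : ℂ,
    bessel^[N] (fun k => a * wave (inner ℝ k m)) =
      fun k => ((1 + ‖m‖ ^ 2 : ℝ) : ℂ) ^ N * a * wave (inner ℝ k m) := by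
  induction N with
  | zero => intro a; simp
  | succ N ih =>
    intro a
    rw [Function.iterate_succ_apply, bessel_wave, ih]
    ext k; ring

end Bessel

/-! ### Derivatives bounded by a weight: Leibniz calculus -/

section Weighted

variable {X V W U : Type} [NormedAddCommGroup X] [NormedSpace ℝ X]
  [NormedAddCommGroup V] [NormedSpace ℝ V] [NormedAddCommGroup W] [NormedSpace ℝ W]
  [NormedAddCommGroup U] [NormedSpace ℝ U]

/-- The derivatives of order at most `n` are bounded by multiples of the weight `w`. -/
def DerivBounded (n : ℕ) (w : X → ℝ) (f : X → V) : Prop :=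
  ∀ j ≤ n, ∃ C, 0 ≤ C ∧ ∀ x, ‖iteratedFDeriv ℝ j f x‖ ≤ C * w x

theorem DerivBounded.bilinear (B : V →L[ℝ] W →L[ℝ] U) {n : ℕ} {w₁ w₂ : X → ℝ} {f : X → V}
    {g : X → W} (hf : ContDiff ℝ ∞ f) (hg : ContDiff ℝ ∞ g) (h₁ : DerivBounded n w₁ f)
    (h₂ : DerivBounded n w₂ g) :
    DerivBounded n (fun x => w₁ x * w₂ x) (fun x => B (f x) (g x)) := by
  intro j hj
  choose C₁ hC₁ h₁ using h₁
  choose C₂ hC₂ h₂ using h₂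
  refine ⟨‖B‖ * ∑ i ∈ (Finset.range (j + 1)).attach, (j.choose i : ℝ) *
    C₁ i (by have := Finset.mem_range.1 i.2; omega) * C₂ (j - i) (by omega), ?_, fun x => ?_⟩
  · exact mul_nonneg (norm_nonneg B) (Finset.sum_nonneg fun i _ =>
      mul_nonneg (mul_nonneg (by positivity) (hC₁ _ _)) (hC₂ _ _))
  · refine (B.norm_iteratedFDeriv_le_of_bilinear hf hg x (mod_cast le_top)).trans ?_
    rw [mul_assoc, Finset.sum_mul]
    gcongr
    rw [← Finset.sum_attach]
    refine Finset.sum_le_sum fun i _ => ?_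
    have hi : (i : ℕ) ≤ n := by have := Finset.mem_range.1 i.2; omega
    calc _ ≤ (j.choose i : ℝ) * (C₁ i hi * w₁ x) * (C₂ (j - i) (by omega) * w₂ x) :=
          mul_le_mul (mul_le_mul_of_nonneg_left (h₁ _ _ x) (by positivity)) (h₂ _ _ x)
            (norm_nonneg _) (mul_nonneg (by positivity) ((norm_nonneg _).trans (h₁ _ hi x)))
      _ = _ := by ring

theorem DerivBounded.succ {n : ℕ} {w : X → ℝ} {f : X → V} {C : ℝ} (hC : 0 ≤ C)
    (h0 : ∀ x, ‖f x‖ ≤ C * w x) (h : DerivBounded n w (fderiv ℝ f)) :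
    DerivBounded (n + 1) w f := by
  intro j hj
  rcases j with _ | j
  · exact ⟨C, hC, fun x => by simpa using h0 x⟩
  · obtain ⟨C', hC', h'⟩ := h j (by omega)
    exact ⟨C', hC', fun x => by rw [← norm_iteratedFDeriv_fderiv]; exact h' x⟩

theorem DerivBounded.add {n : ℕ} {w : X → ℝ} {f g : X → V}
    (hf : ContDiff ℝ ∞ f) (hg : ContDiff ℝ ∞ g) (h₁ : DerivBounded n w f)
    (h₂ : DerivBounded n w g) : DerivBounded n w (fun x => f x + g x) := by
  intro j hj
  obtain ⟨C₁, hC₁, h₁⟩ := h₁ j hj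
  obtain ⟨C₂, hC₂, h₂⟩ := h₂ j hj
  refine ⟨C₁ + C₂, by positivity, fun x => ?_⟩
  have := iteratedFDeriv_add_apply (i := j) (f := f) (g := g) (x := x)
    (hf.of_le (mod_cast le_top)).contDiffAt (hg.of_le (mod_cast le_top)).contDiffAt
  change ‖iteratedFDeriv ℝ j (f + g) x‖ ≤ _
  rw [this, add_mul]
  exact (norm_add_le _ _).trans (add_le_add (h₁ x) (h₂ x))

theorem DerivBounded.comp_clm {n : ℕ} {w : V → ℝ} {f : V → W} (hf : ContDiff ℝ ∞ f)
    (h : DerivBounded n w f) (L : X →L[ℝ] V) :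
    DerivBounded n (fun x => w (L x)) (fun x => f (L x)) := by
  intro j hj
  obtain ⟨C, hC, h⟩ := h j hj
  refine ⟨C * ‖L‖ ^ j, by positivity, fun x => ?_⟩
  change ‖iteratedFDeriv ℝ j (f ∘ L) x‖ ≤ _
  rw [L.iteratedFDeriv_comp_right hf x (mod_cast le_top)]
  refine (ContinuousMultilinearMap.norm_compContinuousLinearMap_le _ _).trans ?_
  rw [Finset.prod_const, Finset.card_univ, Fintype.card_fin]
  calc _ ≤ (C * w (L x)) * ‖L‖ ^ j := by gcongr; exact h (L x)
    _ = _ := by ring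

theorem DerivBounded.mono {n : ℕ} {w₁ w₂ : X → ℝ} {f : X → V} (h : DerivBounded n w₁ f)
    {C : ℝ} (hC : 0 ≤ C) (hw : ∀ x, w₁ x ≤ C * w₂ x) : DerivBounded n w₂ f := by
  intro j hj
  obtain ⟨C', hC', h⟩ := h j hj
  refine ⟨C' * C, by positivity, fun x => (h x).trans ?_⟩
  rw [mul_assoc]
  gcongr
  exact hw x

theorem derivBounded_const (n : ℕ) (c : V) : DerivBounded n (fun _ : X => (1 : ℝ)) (fun _ => c) := by
  intro j hj
  rcases j with _ | j
  · exact ⟨‖c‖, norm_nonneg _, fun x => by simp⟩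
  · exact ⟨0, le_rfl, fun x => by simp [iteratedFDeriv_const_of_ne (Nat.succ_ne_zero j)]⟩

theorem DerivBounded.smulRight {n : ℕ} {w₁ w₂ : X → ℝ} {f : X → V →L[ℝ] ℝ} {g : X → W}
    (hf : ContDiff ℝ ∞ f) (hg : ContDiff ℝ ∞ g) (h₁ : DerivBounded n w₁ f)
    (h₂ : DerivBounded n w₂ g) :
    DerivBounded n (fun x => w₁ x * w₂ x) (fun x => (f x).smulRight (g x)) :=
  h₁.bilinear (ContinuousLinearMap.smulRightL ℝ V W) hf hg h₂

theorem DerivBounded.smul {n : ℕ} {w₁ w₂ : X → ℝ} {f : X → ℝ} {g : X → W}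
    (hf : ContDiff ℝ ∞ f) (hg : ContDiff ℝ ∞ g) (h₁ : DerivBounded n w₁ f)
    (h₂ : DerivBounded n w₂ g) :
    DerivBounded n (fun x => w₁ x * w₂ x) (fun x => f x • g x) :=
  h₁.bilinear (ContinuousLinearMap.lsmul ℝ ℝ) hf hg h₂

theorem DerivBounded.mul {n : ℕ} {w₁ w₂ : X → ℝ} {f g : X → ℂ}
    (hf : ContDiff ℝ ∞ f) (hg : ContDiff ℝ ∞ g) (h₁ : DerivBounded n w₁ f)
    (h₂ : DerivBounded n w₂ g) :
    DerivBounded n (fun x => w₁ x * w₂ x) (fun x => f x * g x) :=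
  h₁.bilinear (ContinuousLinearMap.mul ℝ ℂ) hf hg h₂

end Weighted

/-! ### The weight `(1 + ‖m‖²)⁻¹` and its derivatives -/

section Bracket

variable {d : ℕ}

/-- The weight `(1 + ‖m‖²)⁻¹`. -/
def invSq (m : E d) : ℝ := (1 + ‖m‖ ^ 2)⁻¹

/-- The scalar product of `E d` as a real bilinear map. -/
def innerReal : E d →L[ℝ] E d →L[ℝ] ℝ := innerSL ℝ

theorem innerReal_apply (m v : E d) : innerReal m v = inner ℝ m v := rfl

theorem norm_innerReal (m : E d) : ‖innerReal m‖ = ‖m‖ := innerSL_apply_norm (𝕜 := ℝ) m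

theorem invSq_pos (m : E d) : 0 < invSq m := by unfold invSq; positivity

theorem invSq_le_one (m : E d) : invSq m ≤ 1 := by
  unfold invSq
  exact inv_le_one_of_one_le₀ (by nlinarith [sq_nonneg ‖m‖])

theorem contDiff_invSq : ContDiff ℝ ∞ (invSq : E d → ℝ) :=
  ContDiff.inv (contDiff_const.add (contDiff_norm_sq ℝ)) fun m => by positivity

theorem fderiv_invSq (m : E d) :
    fderiv ℝ invSq m = (-2 : ℝ) • invSq m • invSq m • innerReal m := by
  have h1 : HasFDerivAt (fun m : E d => 1 + ‖m‖ ^ 2) (2 • innerSL ℝ m) m := by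
    simpa using (HasStrictFDerivAt.hasFDerivAt (hasStrictFDerivAt_norm_sq m)).const_add 1
  have h2 := (hasDerivAt_inv (by positivity : (1 + ‖m‖ ^ 2 : ℝ) ≠ 0)).comp_hasFDerivAt m h1
  have h3 : fderiv ℝ invSq m = _ := HasFDerivAt.fderiv (f := invSq) h2
  rw [h3]
  ext v
  simp only [invSq, innerReal_apply, innerSL_apply_apply, neg_smul, smul_apply, smul_eq_mul, nsmul_eq_mul, neg_apply]
  rw [← inv_pow]
  push_cast
  ring

/-- With `u(m) = invSq m • ⟨m, ·⟩`, one has `d(invSq) = -2 invSq u` and `du = -2 u ⊗ u + invSq ⟨·,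
·⟩`. The system is closed, so the two bounds are proved by one induction. -/
theorem derivBounded_invSq (n : ℕ) : DerivBounded n invSq (invSq : E d → ℝ) ∧
    DerivBounded n (fun _ => 1) (fun m : E d => invSq m • innerReal m) := by
  have hu : ContDiff ℝ ∞ (fun m : E d => invSq m • innerReal m) :=
    contDiff_invSq.smul innerReal.contDiff
  have hb0 : ∀ m : E d, ‖invSq m‖ ≤ 1 * invSq m := fun m => by
    rw [Real.norm_of_nonneg (invSq_pos m).le, one_mul]
  have hu0 : ∀ m : E d, ‖invSq m • innerReal m‖ ≤ 1 * 1 := fun m => by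
    rw [norm_smul, norm_innerReal, Real.norm_of_nonneg (invSq_pos m).le, invSq, one_mul,
      inv_mul_le_iff₀ (by positivity)]
    nlinarith [sq_nonneg (‖m‖ - 1)]
  induction n with
  | zero =>
    refine ⟨fun j hj => ?_, fun j hj => ?_⟩ <;> obtain rfl : j = 0 := by omega
    · exact ⟨1, zero_le_one, fun x => by simpa using hb0 x⟩
    · exact ⟨1, zero_le_one, fun x => by simpa using hu0 x⟩
  | succ n ih =>
    obtain ⟨ih1, ih2⟩ := ih
    refine ⟨DerivBounded.succ zero_le_one hb0 ?_, DerivBounded.succ zero_le_one hu0 ?_⟩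
    · have h := (derivBounded_const n (-2 : ℝ)).smul contDiff_const (contDiff_invSq.smul hu)
        (ih1.smul contDiff_invSq hu ih2)
      rw [show fderiv ℝ (invSq : E d → ℝ) = _ from funext fderiv_invSq]
      exact h.mono zero_le_one fun x => by simp
    · have h1 := (derivBounded_const n (-2 : ℝ)).smul contDiff_const (hu.smulRight hu)
        (ih2.smulRight hu hu ih2)
      have h2 := ih1.smul contDiff_invSq contDiff_const
        (derivBounded_const n (innerReal (d := d)))
      have h1' := h1.mono (w₂ := fun _ => (1 : ℝ)) zero_le_one fun x => by simp
      have h2' := h2.mono (w₂ := fun _ => (1 : ℝ)) zero_le_one fun x => by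
        simpa using invSq_le_one x
      have e : fderiv ℝ (fun m : E d => invSq m • innerReal m) = fun m =>
          (-2 : ℝ) • (invSq m • innerReal m).smulRight
            (invSq m • innerReal m) +
            invSq m • innerReal := by
        ext m v w
        have h3 : HasFDerivAt (invSq : E d → ℝ) (fderiv ℝ invSq m) m :=
          (contDiff_invSq.differentiable (by simp)).differentiableAt.hasFDerivAt
        have h4 := h3.smul innerReal.hasFDerivAt
        rw [HasFDerivAt.fderiv (f := fun m : E d => invSq m • innerReal m) h4,
          fderiv_invSq]
        simp
        ring
      rw [e]
      exact DerivBounded.add ((hu.smulRight hu).const_smul (-2 : ℝ))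
        (contDiff_invSq.smul contDiff_const) h1' h2'

theorem derivBounded_invSq_pow (n N : ℕ) :
    DerivBounded n (fun m => invSq m ^ N) (fun m : E d => invSq m ^ N) := by
  induction N with
  | zero => simpa using derivBounded_const (X := E d) n (1 : ℝ)
  | succ N ih =>
    simp only [pow_succ]
    exact ih.smul (contDiff_invSq.pow N) contDiff_invSq (derivBounded_invSq n).1

theorem integrable_invSq_pow (n : ℕ) :
    Integrable (fun m : E d => (1 + ‖m‖) ^ n * invSq m ^ (n + d + 1)) := by
  have h0 : Integrable (fun m : E d => (1 + ‖m‖) ^ (-((d + 1 : ℕ) : ℝ))) :=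
    integrable_one_add_norm (by simp)
  refine (h0.const_mul (2 ^ (n + d + 1))).mono' ?_ (Filter.Eventually.of_forall fun m => ?_)
  · exact (((continuous_const.add continuous_norm).pow n).mul
      (contDiff_invSq.continuous.pow _)).aestronglyMeasurable
  · have hm := norm_nonneg m
    have h1 : invSq m ≤ 2 * ((1 + ‖m‖) ^ 2)⁻¹ := by
      rw [invSq, ← div_eq_mul_inv, inv_eq_one_div, div_le_div_iff₀ (by positivity) (by positivity)]
      nlinarith [sq_nonneg (‖m‖ - 1)]
    have h2 := (invSq_pos m).le
    rw [Real.norm_of_nonneg (by positivity), Real.rpow_neg (by positivity), Real.rpow_natCast]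
    calc (1 + ‖m‖) ^ n * invSq m ^ (n + d + 1)
        ≤ (1 + ‖m‖) ^ n * (2 * ((1 + ‖m‖) ^ 2)⁻¹) ^ (n + d + 1) := by gcongr
      _ = 2 ^ (n + d + 1) * ((1 + ‖m‖) ^ n / ((1 + ‖m‖) ^ 2) ^ (n + d + 1)) := by
          rw [mul_pow, inv_pow]; ring
      _ ≤ 2 ^ (n + d + 1) * ((1 + ‖m‖) ^ (d + 1))⁻¹ := by
          gcongr
          rw [div_le_iff₀ (by positivity), inv_mul_eq_div, le_div_iff₀ (by positivity), ← pow_add,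
            ← pow_mul]
          exact pow_le_pow_right₀ (by linarith) (by omega)

end Bracket

/-! ### Criteria for rapid decay -/

section RapidCriteria

theorem rapid_of_bound {Y 𝕜 : Type} [NormedAddCommGroup Y] [MeasurableSpace Y] [RCLike 𝕜]
    [OpensMeasurableSpace Y] {μ : Measure Y} [μ.HasTemperateGrowth] {q : Y → 𝕜}
    (hm : AEStronglyMeasurable q μ) (h : ∀ n : ℕ, ∃ C, ∀ y, (1 + ‖y‖) ^ n * ‖q y‖ ≤ C) :
    Rapid μ q := by
  refine ⟨hm, fun n => ?_⟩
  obtain ⟨C, hC⟩ := h (n + μ.integrablePower)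
  refine ((Measure.integrable_pow_neg_integrablePower μ).const_mul C).mono' ?_
    (Filter.Eventually.of_forall fun y => ?_)
  · exact AEStronglyMeasurable.mul
      ((continuous_const.add continuous_norm).pow n).measurable.aestronglyMeasurable hm.norm
  · have hy := norm_nonneg y
    rw [Real.norm_of_nonneg (by positivity), Real.rpow_neg (by positivity), Real.rpow_natCast,
      ← div_eq_mul_inv, le_div_iff₀ (by positivity)]
    calc _ = (1 + ‖y‖) ^ (n + μ.integrablePower) * ‖q y‖ := by rw [pow_add]; ring
      _ ≤ C := hC y

theorem one_add_pow_mul_le {x y : ℝ} (hx : 0 ≤ x) (hy : 0 ≤ y) {n : ℕ} {C₀ C : ℝ} (h0 : y ≤ C₀)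
    (hn : x ^ n * y ≤ C) : (1 + x) ^ n * y ≤ 2 ^ n * (C₀ + C) := by
  have h1 : (1 + x) ^ n ≤ 2 ^ n * (1 + x ^ n) := by
    rcases le_total x 1 with h | h
    · calc (1 + x) ^ n ≤ 2 ^ n := by gcongr; linarith
        _ ≤ _ := by nlinarith [pow_nonneg hx n, pow_pos (two_pos : (0 : ℝ) < 2) n]
    · calc (1 + x) ^ n ≤ (2 * x) ^ n := by gcongr; linarith
        _ = 2 ^ n * x ^ n := mul_pow _ _ _
        _ ≤ _ := by gcongr; linarith
  calc _ ≤ 2 ^ n * (1 + x ^ n) * y := by gcongr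
    _ = 2 ^ n * (y + x ^ n * y) := by ring
    _ ≤ _ := by gcongr

theorem rapid_of_pow_bound {Y 𝕜 : Type} [NormedAddCommGroup Y] [MeasurableSpace Y] [RCLike 𝕜]
    [OpensMeasurableSpace Y] {μ : Measure Y} [μ.HasTemperateGrowth] {q : Y → 𝕜}
    (hm : AEStronglyMeasurable q μ) (h : ∀ n : ℕ, ∃ C, ∀ y, ‖y‖ ^ n * ‖q y‖ ≤ C) :
    Rapid μ q := by
  refine rapid_of_bound hm fun n => ?_
  obtain ⟨C₀, h0⟩ := h 0
  obtain ⟨C, hC⟩ := h n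
  exact ⟨_, fun y => one_add_pow_mul_le (norm_nonneg y) (norm_nonneg _) (by simpa using h0 y)
    (hC y)⟩

theorem Rapid.prod {Y Z : Type} [NormedAddCommGroup Y] [MeasurableSpace Y]
    [NormedAddCommGroup Z] [MeasurableSpace Z] [OpensMeasurableSpace Y] [OpensMeasurableSpace Z]
    [SecondCountableTopology Y]
    {μ : Measure Y} {ν : Measure Z} [SFinite μ] [SFinite ν] {q₁ : Y → ℂ} {q₂ : Z → ℂ}
    (h₁ : Rapid μ q₁) (h₂ : Rapid ν q₂) : Rapid (μ.prod ν) (fun z => q₁ z.1 * q₂ z.2) := by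
  have hm : AEStronglyMeasurable (fun z : Y × Z => q₁ z.1 * q₂ z.2) (μ.prod ν) :=
    h₁.meas.comp_fst.mul h₂.meas.comp_snd
  refine ⟨hm, fun n => ?_⟩
  refine ((h₁.int n).mul_prod (h₂.int n)).mono' ?_ (Filter.Eventually.of_forall fun z => ?_)
  · exact AEStronglyMeasurable.mul
      ((continuous_const.add continuous_norm).pow n).measurable.aestronglyMeasurable hm.norm
  · rw [Real.norm_of_nonneg (by positivity), norm_mul]
    have : 1 + ‖z‖ ≤ (1 + ‖z.1‖) * (1 + ‖z.2‖) := by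
      rw [Prod.norm_def]
      have hx := norm_nonneg z.1
      have hy := norm_nonneg z.2
      rcases max_cases ‖z.1‖ ‖z.2‖ with ⟨h, -⟩ | ⟨h, -⟩ <;> rw [h] <;> nlinarith [mul_nonneg hx hy]
    calc _ ≤ ((1 + ‖z.1‖) * (1 + ‖z.2‖)) ^ n * (‖q₁ z.1‖ * ‖q₂ z.2‖) := by gcongr
      _ = _ := by rw [mul_pow]; ring

theorem rapid_schwartz {V : Type} [NormedAddCommGroup V] [NormedSpace ℝ V] [MeasurableSpace V]
    [BorelSpace V] [SecondCountableTopology V] {μ : Measure V} [μ.HasTemperateGrowth]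
    (f : 𝓢(V, ℂ)) : Rapid μ f := by
  refine rapid_of_pow_bound f.continuous.aestronglyMeasurable fun n => ?_
  obtain ⟨C, hC⟩ := f.decay n 0
  exact ⟨C, fun y => by simpa using hC.2 y⟩

end RapidCriteria

/-! ### Symbols as superpositions of plane waves -/

section Structure

variable {d : ℕ}

/-- The volume has to be displayed as a product measure for its Haar property to be found. -/
instance : (volume : Measure (E d × E d)).HasTemperateGrowth := by
  have h : Measure.IsAddHaarMeasure ((volume : Measure (E d)).prod (volume : Measure (E d))) :=
    inferInstance
  exact Measure.IsAddHaarMeasure.instHasTemperateGrowth (h := h)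

theorem derivBounded_of_hasCompactSupport {X V : Type} [NormedAddCommGroup X] [NormedSpace ℝ X]
    [NormedAddCommGroup V] [NormedSpace ℝ V] {f : X → V} (hf : ContDiff ℝ ∞ f)
    (hc : HasCompactSupport f) {w : X → ℝ} (hw : Continuous w) (hpos : ∀ x, 0 < w x) (n : ℕ) :
    DerivBounded n w f := by
  intro j _
  have h1 : Continuous fun x => (w x)⁻¹ * ‖iteratedFDeriv ℝ j f x‖ :=
    (hw.inv₀ fun x => (hpos x).ne').mul (hf.continuous_iteratedFDeriv (mod_cast le_top)).norm
  have h2 : HasCompactSupport fun x => ‖iteratedFDeriv ℝ j f x‖ := (hc.iteratedFDeriv j).norm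
  obtain ⟨x₀, hx₀⟩ := h1.exists_forall_ge_of_hasCompactSupport h2.mul_left
  refine ⟨(w x₀)⁻¹ * ‖iteratedFDeriv ℝ j f x₀‖,
    mul_nonneg (inv_nonneg.2 (hpos x₀).le) (norm_nonneg _), fun x => ?_⟩
  have := hx₀ x
  rwa [inv_mul_eq_div, div_le_iff₀ (hpos x)] at this

theorem exists_cutoff {V : Type} [NormedAddCommGroup V] [NormedSpace ℝ V] [FiniteDimensional ℝ V]
    (R : ℝ) : ∃ χ : V → ℝ, ContDiff ℝ ∞ χ ∧ HasCompactSupport χ ∧ ∀ x, ‖x‖ ≤ R → χ x = 1 := by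
  have hb : HasContDiffBump V := inferInstance
  let b : ContDiffBump (0 : V) := ⟨|R| + 1, |R| + 2, by positivity, by linarith⟩
  refine ⟨b, b.contDiff, b.hasCompactSupport, fun x hx => b.one_of_mem_closedBall ?_⟩
  rw [mem_closedBall_zero_iff]
  exact hx.trans ((le_abs_self R).trans (by simp [b]))

/-- Integrability of all derivatives makes the Fourier transform rapidly decreasing, and Fourier
inversion gives the superposition. The space `E d × E d` carries the sup norm, so the Fourier
analysis takes place on an inner product space `V` and is carried over by `L`. -/
theorem exists_rapid_density_aux {V : Type} [NormedAddCommGroup V] [InnerProductSpace ℝ V]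
    [FiniteDimensional ℝ V] [MeasurableSpace V] [BorelSpace V] (L : V ≃L[ℝ] E d × E d)
    (hLm : MeasurePreserving L) (hLm' : MeasurePreserving L.symm)
    (hi : ∀ κ z, (inner ℝ (L.symm κ) (L.symm z) : ℝ) = inner ℝ κ.1 z.1 + inner ℝ κ.2 z.2)
    (hn : ∀ κ, ‖κ‖ ≤ ‖L.symm κ‖)
    {P : E d × E d → ℂ} (hP : ContDiff ℝ ∞ P)
    (hint : ∀ n, Integrable (fun z => ‖iteratedFDeriv ℝ n P z‖)) :
    ∃ Q : E d × E d → ℂ, Rapid volume Q ∧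
      ∀ z, P z = ∫ κ, Q κ * wave (inner ℝ κ.1 z.1 + inner ℝ κ.2 z.2) := by
  have hP' : ContDiff ℝ ∞ (P ∘ L) := hP.comp L.contDiff
  have hint' : ∀ n, Integrable (fun v => ‖iteratedFDeriv ℝ n (P ∘ L) v‖) := fun n => by
    have h1 := hLm.integrable_comp_of_integrable (hint n)
    refine (h1.mul_const (‖(L : V →L[ℝ] E d × E d)‖ ^ n)).mono'
      (hP'.continuous_iteratedFDeriv (mod_cast le_top)).norm.aestronglyMeasurable
      (Filter.Eventually.of_forall fun x => ?_)
    rw [norm_norm]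
    change ‖iteratedFDeriv ℝ n (P ∘ (L : V →L[ℝ] E d × E d)) x‖ ≤ _
    rw [ContinuousLinearMap.iteratedFDeriv_comp_right _ hP x (mod_cast le_top)]
    refine (ContinuousMultilinearMap.norm_compContinuousLinearMap_le _ _).trans ?_
    rw [Finset.prod_const, Finset.card_univ, Fintype.card_fin]
    rfl
  have hbound : ∀ n : ℕ, ∃ C, ∀ w, ‖w‖ ^ n * ‖𝓕 (P ∘ L) w‖ ≤ C := fun n => by
    have := fun w => Real.pow_mul_norm_iteratedFDeriv_fourier_le (K := 0) (N := ⊤) (k := 0) (n := n)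
      (f := P ∘ L) hP' (fun k n hk _ => by
        obtain rfl : k = 0 := by simpa using hk
        simpa using hint' n) le_rfl le_top w
    simp only [norm_iteratedFDeriv_zero] at this
    exact ⟨_, this⟩
  have hP1 : Integrable (P ∘ L) := by
    refine (integrable_norm_iff hP'.continuous.aestronglyMeasurable).1 ?_
    simpa using hint' 0
  have hFc : Continuous (𝓕 (P ∘ L)) :=
    VectorFourier.fourierIntegral_continuous Real.continuous_fourierChar
      (by exact continuous_inner) hP1
  have hQ' : Rapid volume (𝓕 (P ∘ L)) := rapid_of_pow_bound hFc.aestronglyMeasurable hbound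
  refine ⟨fun κ => 𝓕 (P ∘ L) (L.symm κ), ?_, fun z => ?_⟩
  · refine rapid_of_pow_bound (hFc.comp L.symm.continuous).aestronglyMeasurable fun n => ?_
    obtain ⟨C, hC⟩ := hbound n
    refine ⟨C, fun y => le_trans ?_ (hC (L.symm y))⟩
    gcongr
    exact hn y
  · have h1 := hP1.fourierInv_fourier_eq hQ'.integrable (v := L.symm z) hP'.continuous.continuousAt
    rw [Real.fourierInv_eq] at h1
    have h2 : P z = (P ∘ L) (L.symm z) := by simp
    rw [h2, ← h1, ← hLm'.integral_comp L.symm.toHomeomorph.measurableEmbedding]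
    refine integral_congr_ae (Filter.Eventually.of_forall fun κ => ?_)
    simp only [Circle.smul_def, ← wave_eq_fourierChar, smul_eq_mul, hi]
    rw [mul_comm]

/-- A function all of whose derivatives are integrable is a superposition of waves with a rapidly
decreasing density. -/
theorem exists_rapid_density {P : E d × E d → ℂ} (hP : ContDiff ℝ ∞ P)
    (hint : ∀ n, Integrable (fun z => ‖iteratedFDeriv ℝ n P z‖)) :
    ∃ Q : E d × E d → ℂ, Rapid volume Q ∧
      ∀ z, P z = ∫ κ, Q κ * wave (inner ℝ κ.1 z.1 + inner ℝ κ.2 z.2) := by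
  refine exists_rapid_density_aux (WithLp.prodContinuousLinearEquiv 2 ℝ (E d) (E d))
    (WithLp.volume_preserving_ofLp (E d) (E d)) (WithLp.volume_preserving_toLp (E d) (E d))
    (fun κ z => ?_) (fun κ => ?_) hP hint
  · rw [WithLp.prod_inner_apply]; rfl
  · rw [WithLp.prod_norm_eq_of_L2, Prod.norm_def]
    refine max_le ?_ ?_ <;> refine Real.le_sqrt_of_sq_le ?_
    · exact le_add_of_nonneg_right (sq_nonneg _)
    · exact le_add_of_nonneg_left (sq_nonneg _)

/-- A symbol is, up to a power of the weight `(1 + ‖m‖²)`, a superposition of waves over every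
bounded set of frequencies. -/
theorem IsSymbol.exists_density {p : E d × E d → ℂ} (hp : IsSymbol p) (R : ℝ) :
    ∃ (N : ℕ) (Q : E d × E d → ℂ), Rapid volume Q ∧ ∀ z : E d × E d, ‖z.2‖ ≤ R →
      p z = ((1 + ‖z.1‖ ^ 2 : ℝ) : ℂ) ^ N *
        ∫ κ, Q κ * wave (inner ℝ κ.1 z.1 + inner ℝ κ.2 z.2) := by
  obtain ⟨hps, N₀, hN₀⟩ := hp
  obtain ⟨χ, hχ, hχc, hχ1⟩ := exists_cutoff (V := E d) R
  -- With this exponent, `invSq ^ N` makes the growth of degree `N₀` integrable in each of the two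
  -- variables. One `N` serves the derivatives of all orders because `N₀` does not depend on the
  -- order.
  set N := N₀ + d + 1 with hN
  have hi : ContDiff ℝ ∞ fun z : E d × E d => invSq z.1 ^ N :=
    (contDiff_invSq.comp contDiff_fst).pow N
  have hc : ContDiff ℝ ∞ fun z : E d × E d => χ z.2 := hχ.comp contDiff_snd
  have hP : ContDiff ℝ ∞ fun z : E d × E d => invSq z.1 ^ N • χ z.2 • p z :=
    hi.smul (hc.smul hps)
  have hint : ∀ n, Integrable
      (fun z => ‖iteratedFDeriv ℝ n (fun z : E d × E d => invSq z.1 ^ N • χ z.2 • p z) z‖) := by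
    intro n
    have h1 : DerivBounded n (fun z : E d × E d => (1 + ‖z‖) ^ N₀) p := fun j _ => by
      obtain ⟨C, hC⟩ := hN₀ j
      exact ⟨C, by simpa using (norm_nonneg _).trans (hC 0), hC⟩
    have h2 := (derivBounded_of_hasCompactSupport hχ hχc (contDiff_invSq.continuous.pow N)
      (fun x => pow_pos (invSq_pos x) N) n).comp_clm hχ (ContinuousLinearMap.snd ℝ (E d) (E d))
    have h3 := (derivBounded_invSq_pow n N).comp_clm (contDiff_invSq.pow N)
      (ContinuousLinearMap.fst ℝ (E d) (E d))
    obtain ⟨C, hC, h⟩ := (h3.smul hi (hc.smul hps) (h2.smul hc hps h1)) n le_rfl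
    refine (((integrable_invSq_pow N₀).mul_prod (integrable_invSq_pow N₀)).const_mul C).mono'
      (hP.continuous_iteratedFDeriv (mod_cast le_top)).norm.aestronglyMeasurable
      (Filter.Eventually.of_forall fun z => ?_)
    rw [norm_norm]
    refine (h z).trans ?_
    have e1 := (pow_pos (invSq_pos z.1) N).le
    have e2 := (pow_pos (invSq_pos z.2) N).le
    calc C * (invSq z.1 ^ N * (invSq z.2 ^ N * (1 + ‖z‖) ^ N₀))
        ≤ C * (invSq z.1 ^ N * (invSq z.2 ^ N * ((1 + ‖z.1‖) * (1 + ‖z.2‖)) ^ N₀)) := by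
          gcongr
          exact one_add_norm_prod_le z.1 z.2
      _ = C * ((1 + ‖z.1‖) ^ N₀ * invSq z.1 ^ N * ((1 + ‖z.2‖) ^ N₀ * invSq z.2 ^ N)) := by
          rw [mul_pow]; ring
  obtain ⟨Q, hQ, hQP⟩ := exists_rapid_density hP hint
  refine ⟨N, Q, hQ, fun z hz => ?_⟩
  rw [← hQP, hχ1 _ hz, one_smul, Complex.real_smul]
  have : (1 + ‖z.1‖ ^ 2 : ℝ) * invSq z.1 = 1 := mul_inv_cancel₀ (by positivity)
  rw [← mul_assoc, ← Complex.ofReal_pow, ← Complex.ofReal_mul, ← mul_pow, this]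
  simp

end Structure

/-! ### Superpositions of kernels -/

section Superposition

variable {d : ℕ} {Z : Type} [NormedAddCommGroup Z] [NormedSpace ℝ Z]

/-- The superposition, with density `Q`, of the functions `bessel^[N] H` of a parameter `z`. -/
def superpose (Q : E d × E d → ℂ) (N : ℕ) (H : E d × (Z × E d) → ℂ) (z : Z) : ℂ :=
  ∫ κ, Q κ * besselFst^[N] H (κ.1, (z, κ.2))

variable {Q : E d × E d → ℂ} {N : ℕ} {H : E d × (Z × E d) → ℂ}

theorem temperate_superpose (hQ : Rapid volume Q) (hH : HasTemperateGrowth H) :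
    HasTemperateGrowth (superpose Q N H) := by
  have h : HasTemperateGrowth (fun w : Z × (E d × E d) => besselFst^[N] H (w.2.1, (w.1, w.2.2))) :=
    (temperate_besselFst_iterate N hH).comp
      (f := fun w : Z × (E d × E d) => (w.2.1, (w.1, w.2.2))) (by fun_prop)
  exact hQ.temperate_integral h

/-- By Fubini, and because `bessel` acts on `k` only and so comes out of the integral over `z`.
Afterwards the integral over `z` can be evaluated for each wave before `bessel` is applied. -/
theorem integral_mul_superpose [MeasurableSpace Z] [OpensMeasurableSpace Z]
    [SecondCountableTopology Z] {μ : Measure Z} [SFinite μ] {q : Z → ℂ} (hq : Rapid μ q)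
    (hQ : Rapid volume Q) (hH : HasTemperateGrowth H) :
    ∫ z, q z * superpose Q N H z ∂μ =
      ∫ κ, Q κ * bessel^[N] (fun k => ∫ z, q z * H (k, (z, κ.2)) ∂μ) κ.1 := by
  have hF := temperate_besselFst_iterate N hH
  have h : HasTemperateGrowth
      (fun w : (Z × (E d × E d)) × ℝ => besselFst^[N] H (w.1.2.1, (w.1.1, w.1.2.2))) :=
    hF.comp (f := fun w : (Z × (E d × E d)) × ℝ => (w.1.2.1, (w.1.1, w.1.2.2))) (by fun_prop)
  have hint : Integrable (fun w : Z × (E d × E d) =>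
      q w.1 * Q w.2 * besselFst^[N] H (w.2.1, (w.1, w.2.2))) (μ.prod volume) := by
    have h' : HasTemperateGrowth
        (fun w : ℝ × (Z × (E d × E d)) => besselFst^[N] H (w.2.2.1, (w.2.1, w.2.2.2))) :=
      hF.comp (f := fun w : ℝ × (Z × (E d × E d)) => (w.2.2.1, (w.2.1, w.2.2.2))) (by fun_prop)
    exact (hq.prod hQ).integrable_smul h' 0
  have e1 : ∀ z, q z * superpose Q N H z =
      ∫ κ, q z * Q κ * besselFst^[N] H (κ.1, (z, κ.2)) := fun z => by
    rw [superpose, ← integral_const_mul]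
    exact integral_congr_ae (Filter.Eventually.of_forall fun κ => (mul_assoc _ _ _).symm)
  simp only [e1]
  rw [integral_integral_swap hint]
  refine integral_congr_ae (Filter.Eventually.of_forall fun κ => ?_)
  have hs : HasTemperateGrowth (fun w : E d × Z => H (w.1, (w.2, κ.2))) :=
    hH.comp (f := fun w : E d × Z => (w.1, (w.2, κ.2))) (by fun_prop)
  have e2 := bessel_iterate_integral hq N hs
  simp only
  rw [e2, ← integral_const_mul]
  refine integral_congr_ae (Filter.Eventually.of_forall fun z => ?_)
  have e3 := congrFun (bessel_iterate_slice N hs z) κ.1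
  have e4 := congrFun (bessel_iterate_slice N hH (z, κ.2)) κ.1
  simp only at e3 e4 ⊢
  rw [← e3, e4]
  ring

/-- The plane waves on phase space. -/
def planeWave : E d × ((E d × E d) × E d) → ℂ :=
  fun w => wave (inner ℝ w.1 w.2.1.1 + inner ℝ w.2.2 w.2.1.2)

theorem temperate_planeWave : HasTemperateGrowth (planeWave (d := d)) := by
  unfold planeWave; fun_prop

/-- On a wave in `k` of frequency `y`, each `bessel` is multiplication by `1 + ‖y‖²`; this recovers
the weight of `IsSymbol.exists_density`. -/
theorem superpose_eq_of_wave (hH : HasTemperateGrowth H) {z : Z} {a : ℂ} {y η : E d}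
    (h : ∀ k l, H (k, (z, l)) = a * wave (inner ℝ k y + inner ℝ l η)) :
    superpose Q N H z = a * (((1 + ‖y‖ ^ 2 : ℝ) : ℂ) ^ N *
      ∫ κ, Q κ * wave (inner ℝ κ.1 y + inner ℝ κ.2 η)) := by
  rw [superpose, ← mul_assoc, ← integral_const_mul]
  refine integral_congr_ae (Filter.Eventually.of_forall fun κ => ?_)
  have e := congrFun (bessel_iterate_slice N hH (z, κ.2)) κ.1
  simp only at e ⊢
  rw [← e]
  have e' : (fun k => H (k, (z, κ.2))) =
      fun k => (a * wave (inner ℝ κ.2 η)) * wave (inner ℝ k y) := by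
    ext k; rw [h, wave_add]; ring
  rw [e', bessel_iterate_wave, wave_add]
  ring

end Superposition

/-! ### Wigner transforms and the kernel of the Weyl quantization -/

section Weyl

variable {d : ℕ}

theorem cexp_eq_wave {ħ : ℝ} (t : ℝ) :
    Complex.exp ((Complex.I / ħ) * (t : ℝ)) = wave (t / (2 * π * ħ)) := by
  rw [wave]
  congr 1
  have hpi : (π : ℂ) ≠ 0 := by exact_mod_cast Real.pi_ne_zero
  push_cast
  field_simp

theorem cexp_neg_eq_wave {ħ : ℝ} (t : ℝ) :
    Complex.exp (-(Complex.I / ħ) * (t : ℝ)) = wave (-(t / (2 * π * ħ))) := by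
  have := cexp_eq_wave (ħ := ħ) (-t)
  rw [neg_div] at this
  rw [← this]
  congr 1
  push_cast; ring

theorem fourierH_eq (ħ : ℝ) (ψ : E d → ℂ) (ξ : E d) :
    fourierH ħ ψ ξ = 𝓕 ψ ((2 * π * ħ)⁻¹ • ξ) := by
  rw [fourierH, Real.fourier_eq]
  refine integral_congr_ae (Filter.Eventually.of_forall fun x => ?_)
  simp only [Circle.smul_def, ← wave_eq_fourierChar, smul_eq_mul, cexp_neg_eq_wave, inner_smul_right]
  rw [div_eq_inv_mul]

/-- The cross-correlation `(2πħ)^{-d} a(ξ - πħk) conj (b(ξ + πħk))` of two functions of frequency. -/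
def corr (ħ : ℝ) (a b : E d → ℂ) (k ξ : E d) : ℂ :=
  ((2 * π * ħ : ℝ) ^ d : ℂ)⁻¹ *
    (a (ξ - (π * ħ) • k) * (starRingEnd ℂ) (b (ξ + (π * ħ) • k)))

theorem schwartz_inversion (v : 𝓢(E d, ℂ)) (y : E d) :
    ∫ η, wave (inner ℝ η y) * 𝓕 (v : E d → ℂ) η = v y := by
  have h : (𝓕⁻ (𝓕 v : 𝓢(E d, ℂ)) : 𝓢(E d, ℂ)) y = v y := by
    rw [FourierTransform.fourierInv_fourier_eq]
  simp only [SchwartzMap.fourierInv_coe, SchwartzMap.fourier_coe, Real.fourierInv_eq] at h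
  rw [← h]
  refine integral_congr_ae (Filter.Eventually.of_forall fun x => ?_)
  simp only [Circle.smul_def, ← wave_eq_fourierChar, smul_eq_mul]

theorem integrable_fourier_schwartz (v : 𝓢(E d, ℂ)) : Integrable (𝓕 (v : E d → ℂ)) := by
  have := (𝓕 v).integrable (μ := volume)
  rwa [SchwartzMap.fourier_coe] at this

theorem continuous_fourier_schwartz (v : 𝓢(E d, ℂ)) : Continuous (𝓕 (v : E d → ℂ)) := by
  have := (𝓕 v).continuous
  rwa [SchwartzMap.fourier_coe] at this

/-- With `ζ = η₀ - k`, the right side is `∫ û c`, which equals `∫ u ĉ` by the multiplication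
formula. Fourier inversion for `v` computes `ĉ(y)` as a wave times `conj v(2m - y)`, and `y = m - w`
gives the left side. -/
theorem wigner_fourier_aux (u v : 𝓢(E d, ℂ)) (m η₀ : E d) :
    ∫ w, wave (2 * inner ℝ w η₀) * (u (m - w) * (starRingEnd ℂ) (v (m + w))) =
      ∫ k, wave (-(2 * inner ℝ k m)) *
        (𝓕 (u : E d → ℂ) (η₀ - k) * (starRingEnd ℂ) (𝓕 (v : E d → ℂ) (η₀ + k))) := by
  set c : E d → ℂ := fun ζ => wave (-(2 * inner ℝ (η₀ - ζ) m)) *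
    (starRingEnd ℂ) (𝓕 (v : E d → ℂ) (η₀ + (η₀ - ζ))) with hc
  have hv := integrable_fourier_schwartz v
  have hcc : Continuous c := by
    have h1 := hasTemperateGrowth_wave.1.continuous
    have h2 := continuous_fourier_schwartz v
    exact (h1.comp (by fun_prop)).mul (Complex.continuous_conj.comp (h2.comp (by fun_prop)))
  have hci : Integrable c := by
    have h1 : Integrable fun ζ => ‖𝓕 (v : E d → ℂ) (η₀ + (η₀ - ζ))‖ := by
      have := (hv.comp_sub_left (η₀ + η₀)).norm
      simpa only [add_sub_assoc] using this
    refine h1.mono' hcc.aestronglyMeasurable (Filter.Eventually.of_forall fun ζ => ?_)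
    simp [hc, norm_wave]
  have hFc : ∀ y, 𝓕 c y = wave (2 * inner ℝ (m - y) η₀) * (starRingEnd ℂ) (v (m + (m - y))) := by
    intro y
    rw [Real.fourier_eq, ← integral_sub_left_eq_self _ volume (η₀ + η₀)]
    have e : ∀ η, (Real.fourierChar (-inner ℝ (η₀ + η₀ - η) y)) • c (η₀ + η₀ - η) =
        wave (2 * inner ℝ (m - y) η₀) *
          (starRingEnd ℂ) (wave (inner ℝ η (m + (m - y))) * 𝓕 (v : E d → ℂ) η) := by
      intro η
      have e1 : η₀ - (η₀ + η₀ - η) = η - η₀ := by abel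
      have e2 : η₀ + (η - η₀) = η := by abel
      simp only [hc, e1, e2, Circle.smul_def, ← wave_eq_fourierChar, smul_eq_mul, map_mul,
        conj_wave]
      rw [← mul_assoc, ← mul_assoc, ← wave_add, ← wave_add]
      congr 2
      simp only [inner_sub_left, inner_add_left, inner_sub_right, inner_add_right]
      rw [real_inner_comm m η₀, real_inner_comm y η₀]
      ring
    simp only [e]
    rw [integral_const_mul, integral_conj, schwartz_inversion]
  have h1 : ∫ k, wave (-(2 * inner ℝ k m)) *
      (𝓕 (u : E d → ℂ) (η₀ - k) * (starRingEnd ℂ) (𝓕 (v : E d → ℂ) (η₀ + k))) =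
      ∫ ζ, 𝓕 (u : E d → ℂ) ζ • c ζ := by
    rw [← integral_sub_left_eq_self _ volume η₀]
    refine integral_congr_ae (Filter.Eventually.of_forall fun ζ => ?_)
    simp only [hc, sub_sub_cancel, smul_eq_mul]
    ring
  have h2 : ∫ ζ, 𝓕 (u : E d → ℂ) ζ • c ζ = ∫ y, u y • 𝓕 c y := by
    have := VectorFourier.integral_fourierIntegral_smul_eq_flip (L := innerₗ (E d))
      (μ := volume) (ν := volume) Real.continuous_fourierChar continuous_inner
      (u.integrable (μ := volume)) hci
    rw [flip_innerₗ] at this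
    exact this
  rw [h1, h2, ← integral_sub_left_eq_self _ volume m]
  refine integral_congr_ae (Filter.Eventually.of_forall fun y => ?_)
  simp only [hFc, sub_sub_cancel, smul_eq_mul]
  ring

/-- The preceding identity with `w` and `k` both halved; the two Jacobians agree and cancel. -/
theorem wigner_fourier {ħ : ℝ} (hħ : 0 < ħ) (u v : 𝓢(E d, ℂ)) (m ξ : E d) :
    ((2 * π * ħ : ℝ) ^ d : ℂ)⁻¹ * ∫ w, wave (inner ℝ w ξ / (2 * π * ħ)) *
        (u (m - (2⁻¹ : ℝ) • w) * (starRingEnd ℂ) (v (m + (2⁻¹ : ℝ) • w))) =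
      𝓕 (fun k => corr ħ (fourierH ħ u) (fourierH ħ v) k ξ) m := by
  have h2 : (2 : ℝ) ≠ 0 := two_ne_zero
  have hh : (2 * π * ħ : ℝ) ≠ 0 := by positivity
  have key := wigner_fourier_aux u v m ((2 * π * ħ)⁻¹ • ξ)
  have l1 := Measure.integral_comp_smul volume (fun w : E d => wave (2 * inner ℝ w ((2 * π * ħ)⁻¹ • ξ)) *
    (u (m - w) * (starRingEnd ℂ) (v (m + w)))) (2⁻¹ : ℝ)
  have l2 := Measure.integral_comp_smul volume (fun k : E d => wave (-(2 * inner ℝ k m)) *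
    (𝓕 (u : E d → ℂ) ((2 * π * ħ)⁻¹ • ξ - k) *
      (starRingEnd ℂ) (𝓕 (v : E d → ℂ) ((2 * π * ħ)⁻¹ • ξ + k)))) (2⁻¹ : ℝ)
  rw [key, ← l2] at l1
  have e1 : ∀ w : E d, wave (inner ℝ w ξ / (2 * π * ħ)) *
        (u (m - (2⁻¹ : ℝ) • w) * (starRingEnd ℂ) (v (m + (2⁻¹ : ℝ) • w))) =
      wave (2 * inner ℝ ((2⁻¹ : ℝ) • w) ((2 * π * ħ)⁻¹ • ξ)) *
        (u (m - (2⁻¹ : ℝ) • w) * (starRingEnd ℂ) (v (m + (2⁻¹ : ℝ) • w))) := fun w => by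
    rw [real_inner_smul_left, real_inner_smul_right]
    congr 2
    field_simp
  simp only [e1]
  rw [l1, Real.fourier_eq, ← integral_const_mul]
  refine integral_congr_ae (Filter.Eventually.of_forall fun k => ?_)
  have e2 : (2 * π * ħ)⁻¹ • (ξ - (π * ħ) • k) = (2 * π * ħ)⁻¹ • ξ - (2⁻¹ : ℝ) • k := by
    rw [smul_sub, smul_smul]; congr 2; field_simp
  have e3 : (2 * π * ħ)⁻¹ • (ξ + (π * ħ) • k) = (2 * π * ħ)⁻¹ • ξ + (2⁻¹ : ℝ) • k := by
    rw [smul_add, smul_smul]; congr 2; field_simp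
  simp only [corr, fourierH_eq, e2, e3, Circle.smul_def, ← wave_eq_fourierChar, smul_eq_mul,
    real_inner_smul_left]
  rw [show -(2 * (2⁻¹ * inner ℝ k m)) = -(inner ℝ k m : ℝ) by ring]
  ring

/-- Symbols with derivatives of polynomial growth, where the growth in frequency is of bounded
degree. -/
def PolyBounded (p : E d × E d → ℂ) : Prop :=
  ContDiff ℝ ∞ p ∧ ∃ N : ℕ, ∀ n, ∃ M : ℕ,
    DerivBounded n (fun z => (1 + ‖z.1‖) ^ M * (1 + ‖z.2‖) ^ N) p

theorem DerivBounded.slice {X Y V : Type} [NormedAddCommGroup X] [NormedSpace ℝ X]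
    [NormedAddCommGroup Y] [NormedSpace ℝ Y] [NormedAddCommGroup V] [NormedSpace ℝ V]
    {n : ℕ} {w : X × Y → ℝ} {f : X × Y → V} (hf : ContDiff ℝ ∞ f)
    (h : DerivBounded n w f) : ∀ j ≤ n, ∃ C, 0 ≤ C ∧ ∀ x y,
      ‖iteratedFDeriv ℝ j (fun y' => f (x, y')) y‖ ≤ C * w (x, y) := by
  intro j hj
  obtain ⟨C, hC, h⟩ := h j hj
  refine ⟨C, hC, fun x y => ?_⟩
  have e : (fun y' => f (x, y')) =
      (fun z => f (z + (x, 0))) ∘ (ContinuousLinearMap.inr ℝ X Y) := by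
    ext y'; simp
  have hsm : ContDiff ℝ ∞ (fun z => f (z + (x, 0))) := hf.comp (by fun_prop)
  rw [e, ContinuousLinearMap.iteratedFDeriv_comp_right _ hsm _ (mod_cast le_top)]
  refine (ContinuousMultilinearMap.norm_compContinuousLinearMap_le _ _).trans ?_
  rw [iteratedFDeriv_comp_add_right]
  have h1 : ∏ _i : Fin j, ‖ContinuousLinearMap.inr ℝ X Y‖ ≤ 1 :=
    Finset.prod_le_one (fun _ _ => norm_nonneg _) fun _ _ =>
      ContinuousLinearMap.opNorm_le_bound _ zero_le_one fun x => by simp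
  calc _ ≤ ‖iteratedFDeriv ℝ j f (x, y)‖ * 1 := by
        gcongr
        simp
    _ ≤ _ := by simpa using h (x, y)

theorem derivBounded_schwartz (u : 𝓢(E d, ℂ)) (n K : ℕ) :
    DerivBounded n (fun y => invSq y ^ K) u := by
  intro j _
  obtain ⟨C₀, hC₀⟩ := u.decay 0 j
  obtain ⟨C, hC⟩ := u.decay (2 * K) j
  refine ⟨2 ^ (2 * K) * (C₀ + C), by have := hC₀.1; have := hC.1; positivity, fun y => ?_⟩
  have h := one_add_pow_mul_le (norm_nonneg y) (norm_nonneg _) (by simpa using hC₀.2 y) (hC.2 y)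
  have hy := norm_nonneg y
  have h1 : (1 + ‖y‖ ^ 2) ^ K ≤ (1 + ‖y‖) ^ (2 * K) := by
    rw [pow_mul]
    gcongr
    nlinarith
  have h2 : (1 + ‖y‖ ^ 2) ^ K * ‖iteratedFDeriv ℝ j u y‖ ≤ 2 ^ (2 * K) * (C₀ + C) :=
    le_trans (by gcongr) h
  change _ ≤ _ * ((1 + ‖y‖ ^ 2)⁻¹) ^ K
  rw [inv_pow, ← div_eq_mul_inv, le_div_iff₀ (by positivity), mul_comm]
  exact h2

/-- The kernel integral of the Weyl quantization. -/
def weylInner (ħ : ℝ) (p : E d × E d → ℂ) (u : E d → ℂ) (x ξ : E d) : ℂ :=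
  ∫ y, wave (inner ℝ (x - y) ξ / (2 * π * ħ)) * p ((2⁻¹ : ℝ) • (x + y), ξ) * u y

theorem weylInner_eq_fourier (ħ : ℝ) (p : E d × E d → ℂ) (u : E d → ℂ) (x ξ : E d) :
    weylInner ħ p u x ξ = wave (inner ℝ x ξ / (2 * π * ħ)) *
      𝓕 (fun y => p ((2⁻¹ : ℝ) • (x + y), ξ) * u y) ((2 * π * ħ)⁻¹ • ξ) := by
  rw [weylInner, Real.fourier_eq, ← integral_const_mul]
  refine integral_congr_ae (Filter.Eventually.of_forall fun y => ?_)
  simp only [Circle.smul_def, ← wave_eq_fourierChar, smul_eq_mul, real_inner_smul_right]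
  rw [← mul_assoc, ← mul_assoc, ← wave_add, inner_sub_left, sub_div, sub_eq_add_neg,
    div_eq_inv_mul (inner ℝ y ξ)]

/-- The kernel integral is a unimodular factor times a Fourier transform in `y` at `ξ/(2πħ)`.
Integrations by parts up to order `N + d + 1` beat the growth of degree `N` in `ξ` and leave an
integrable power; for this the degree `N` in `PolyBounded` must not depend on the number of
derivatives. The constant may depend on `ħ`, since the bound only serves to justify Fubini. -/
theorem exists_norm_weylInner_le {ħ : ℝ} (hħ : 0 < ħ) {p : E d × E d → ℂ} (hp : PolyBounded p)
    (u : 𝓢(E d, ℂ)) : ∃ (C : ℝ) (M : ℕ), ∀ x ξ,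
      ‖weylInner ħ p u x ξ‖ ≤ C * (1 + ‖x‖) ^ M * ((1 + ‖ξ‖) ^ (d + 1))⁻¹ := by
  obtain ⟨hps, N, hN⟩ := hp
  set n := N + (d + 1) with hn
  obtain ⟨M, hM⟩ := hN n
  let L : (E d × E d) × E d →L[ℝ] E d × E d :=
    (((2⁻¹ : ℝ) • ((ContinuousLinearMap.fst ℝ (E d) (E d)).comp
      (ContinuousLinearMap.fst ℝ (E d × E d) (E d)) +
        ContinuousLinearMap.snd ℝ (E d × E d) (E d)))).prod
      ((ContinuousLinearMap.snd ℝ (E d) (E d)).comp (ContinuousLinearMap.fst ℝ (E d × E d) (E d)))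
  have hL : ∀ x ξ y, L ((x, ξ), y) = ((2⁻¹ : ℝ) • (x + y), ξ) := fun x ξ y => rfl
  have h1 := hM.comp_clm hps L
  have h2 := (derivBounded_schwartz u n (M + d + 1)).comp_clm (u.smooth ⊤)
    (ContinuousLinearMap.snd ℝ (E d × E d) (E d))
  have hs1 : ContDiff ℝ ∞ fun z => p (L z) := hps.comp L.contDiff
  have hs2 : ContDiff ℝ ∞ fun z : (E d × E d) × E d =>
      u (ContinuousLinearMap.snd ℝ (E d × E d) (E d) z) := (u.smooth ⊤).comp contDiff_snd
  have h3 := (h1.mul hs1 hs2 h2).slice (hs1.mul hs2)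
  simp only [ContinuousLinearMap.coe_snd'] at h3
  choose! C hC0 hC using h3
  set I₀ := ∫ y : E d, (1 + ‖y‖) ^ M * invSq y ^ (M + d + 1) with hI₀
  have hsl : ∀ x ξ, ContDiff ℝ ∞ fun y => p (L ((x, ξ), y)) * u y := fun x ξ =>
    (hs1.mul hs2).comp (contDiff_const.prodMk contDiff_id)
  have hb : ∀ j ≤ n, ∀ x ξ y, ‖iteratedFDeriv ℝ j (fun y => p (L ((x, ξ), y)) * u y) y‖ ≤
      (C j * ((1 + ‖x‖) ^ M * (1 + ‖ξ‖) ^ N)) * ((1 + ‖y‖) ^ M * invSq y ^ (M + d + 1)) := by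
    intro j hj x ξ y
    refine (hC j hj (x, ξ) y).trans ?_
    simp only [hL]
    have h0 := (invSq_pos y).le
    have h4 : 1 + ‖(2⁻¹ : ℝ) • (x + y)‖ ≤ (1 + ‖x‖) * (1 + ‖y‖) := by
      rw [norm_smul]
      have := norm_add_le x y
      have hx := norm_nonneg x
      have hy := norm_nonneg y
      norm_num
      nlinarith [mul_nonneg hx hy]
    calc _ ≤ C j * (((1 + ‖x‖) * (1 + ‖y‖)) ^ M * (1 + ‖ξ‖) ^ N * invSq y ^ (M + d + 1)) := by
          have := hC0 j hj
          gcongr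
      _ = _ := by rw [mul_pow]; ring
  have hint : ∀ j ≤ n, ∀ x ξ,
      Integrable fun y => ‖iteratedFDeriv ℝ j (fun y => p (L ((x, ξ), y)) * u y) y‖ := by
    intro j hj x ξ
    refine ((integrable_invSq_pow M).const_mul
      (C j * ((1 + ‖x‖) ^ M * (1 + ‖ξ‖) ^ N))).mono'
      ((hsl x ξ).continuous_iteratedFDeriv (mod_cast le_top)).norm.aestronglyMeasurable
      (Filter.Eventually.of_forall fun y => ?_)
    rw [norm_norm]
    exact hb j hj x ξ y
  have hF : ∀ m ≤ n, ∃ D, ∀ x ξ, ‖ξ‖ ^ m * ‖weylInner ħ p u x ξ‖ ≤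
      D * ((1 + ‖x‖) ^ M * (1 + ‖ξ‖) ^ N) := by
    intro m hm
    refine ⟨(2 * π * ħ) ^ m * (2 ^ m * ∑ j ∈ Finset.range (m + 1), C j * I₀), fun x ξ => ?_⟩
    have h5 := Real.pow_mul_norm_iteratedFDeriv_fourier_le (K := 0) (N := (n : ℕ∞)) (k := 0)
      (n := m) (f := fun y => p (L ((x, ξ), y)) * u y) ((hsl x ξ).of_le (mod_cast le_top))
      (fun k j hk hj => by
        obtain rfl : k = 0 := by simpa using hk
        simpa using hint j (by exact_mod_cast hj) x ξ) le_rfl (by exact_mod_cast hm)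
      ((2 * π * ħ)⁻¹ • ξ)
    rw [norm_iteratedFDeriv_zero, norm_smul, mul_pow] at h5
    rw [weylInner_eq_fourier, norm_mul, norm_wave, one_mul]
    have hh : (0 : ℝ) < 2 * π * ħ := by positivity
    rw [norm_inv, Real.norm_of_nonneg hh.le, inv_pow, mul_assoc,
      inv_mul_le_iff₀ (by positivity)] at h5
    refine h5.trans (le_of_eq_of_le (b := (2 * π * ħ) ^ m * (2 ^ m * ∑ j ∈ Finset.range (m + 1),
      ∫ y, ‖iteratedFDeriv ℝ j (fun y => p (L ((x, ξ), y)) * u y) y‖)) ?_ ?_)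
    · rw [zero_add, Finset.range_one, Finset.singleton_product, Finset.sum_map]
      simp
    · rw [mul_assoc ((2 * π * ħ) ^ m), mul_assoc ((2 : ℝ) ^ m), Finset.sum_mul]
      gcongr with j hj
      have hj' : j ≤ n := by have := Finset.mem_range.1 hj; omega
      calc _ ≤ ∫ y, (C j * ((1 + ‖x‖) ^ M * (1 + ‖ξ‖) ^ N)) *
            ((1 + ‖y‖) ^ M * invSq y ^ (M + d + 1)) :=
            integral_mono (hint j hj' x ξ) ((integrable_invSq_pow M).const_mul _) (hb j hj' x ξ)
        _ = _ := by rw [integral_const_mul, hI₀]; ring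
  obtain ⟨D₀, hD₀⟩ := hF 0 (Nat.zero_le _)
  obtain ⟨D, hD⟩ := hF n le_rfl
  refine ⟨2 ^ n * (D₀ + D), M, fun x ξ => ?_⟩
  have h6 := one_add_pow_mul_le (norm_nonneg ξ) (norm_nonneg _) (by simpa using hD₀ x ξ) (hD x ξ)
  have hξ : (0 : ℝ) < 1 + ‖ξ‖ := by positivity
  rw [← div_eq_mul_inv, le_div_iff₀ (by positivity)]
  refine le_of_mul_le_mul_left ?_ (pow_pos hξ N)
  calc _ = (1 + ‖ξ‖) ^ n * ‖weylInner ħ p u x ξ‖ := by rw [hn, pow_add]; ring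
    _ ≤ _ := h6
    _ = _ := by ring

end Weyl

/-! ### Matrix elements of Weyl quantizations -/

section WeylPairing

variable {d : ℕ}

theorem PolyBounded.exists_norm_le {p : E d × E d → ℂ} (hp : PolyBounded p) :
    ∃ (C : ℝ) (M N : ℕ), 0 ≤ C ∧ ∀ z, ‖p z‖ ≤ C * ((1 + ‖z.1‖) ^ M * (1 + ‖z.2‖) ^ N) := by
  obtain ⟨-, N, h⟩ := hp
  obtain ⟨M, h⟩ := h 0
  obtain ⟨C, hC, h⟩ := h 0 le_rfl
  exact ⟨C, M, N, hC, fun z => by simpa using h z⟩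

theorem IsSymbol.polyBounded {p : E d × E d → ℂ} (hp : IsSymbol p) : PolyBounded p := by
  obtain ⟨hps, N, h⟩ := hp
  refine ⟨hps, N, fun n => ⟨N, fun j _ => ?_⟩⟩
  obtain ⟨C, hC⟩ := h j
  have h0 : 0 ≤ C := by simpa using (norm_nonneg _).trans (hC 0)
  refine ⟨C, h0, fun z => (hC z).trans ?_⟩
  simp only [← mul_pow]
  gcongr
  exact one_add_norm_prod_le z.1 z.2

/-- A composition of swaps with two fibrewise isometries: `m ↦ m + w/2` with `w` fixed, then `w ↦ x
- w` with `x` fixed. -/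
theorem measurePreserving_midpoint : MeasurePreserving
    (fun z : E d × E d => (z.1 + (2⁻¹ : ℝ) • z.2, z.1 - (2⁻¹ : ℝ) • z.2)) := by
  have h1 : MeasurePreserving (fun z : E d × E d => (z.1, z.1 - z.2)) :=
    MeasurePreserving.skew_product (g := fun x w : E d => x - w) (MeasurePreserving.id volume)
      (by fun_prop) (Filter.Eventually.of_forall fun x => (Measure.measurePreserving_sub_left volume x).map_eq)
  have h2 : MeasurePreserving (fun z : E d × E d => (z.1, z.2 + (2⁻¹ : ℝ) • z.1)) :=
    MeasurePreserving.skew_product (g := fun w m : E d => m + (2⁻¹ : ℝ) • w)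
      (MeasurePreserving.id volume)
      (by fun_prop) (Filter.Eventually.of_forall fun w =>
        (measurePreserving_add_right volume ((2⁻¹ : ℝ) • w)).map_eq)
  have hs : MeasurePreserving (Prod.swap : E d × E d → E d × E d) := Measure.measurePreserving_swap
  have h := h1.comp (hs.comp (h2.comp hs))
  convert h using 1
  ext z : 1
  simp only [Function.comp, Prod.swap]
  refine Prod.ext rfl ?_
  simp only
  have : z.2 = (2⁻¹ : ℝ) • z.2 + (2⁻¹ : ℝ) • z.2 := by rw [← add_smul]; norm_num
  rw [add_sub_assoc, sub_eq_add_neg]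
  congr 1
  nth_rw 3 [this]
  abel

theorem rapid_conj_schwartz (v : 𝓢(E d, ℂ)) :
    Rapid volume (fun x => (starRingEnd ℂ) (v x)) :=
  ⟨(Complex.continuous_conj.comp v.continuous).aestronglyMeasurable, fun n => by
    simpa using (rapid_schwartz (μ := volume) v).int n⟩

variable {ħ : ℝ} {p : E d × E d → ℂ}

theorem integrable_weyl_kernel (hp : PolyBounded p) (u v : 𝓢(E d, ℂ)) (ξ : E d) :
    Integrable (fun z : E d × E d => wave (inner ℝ (z.1 - z.2) ξ / (2 * π * ħ)) *
      p ((2⁻¹ : ℝ) • (z.1 + z.2), ξ) * u z.2 * (starRingEnd ℂ) (v z.1)) := by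
  obtain ⟨C, M, N, hC, h⟩ := hp.exists_norm_le
  have hq := (rapid_conj_schwartz v).prod (rapid_schwartz (μ := volume) u)
  have hF : Continuous fun z : E d × E d => wave (inner ℝ (z.1 - z.2) ξ / (2 * π * ħ)) *
      p ((2⁻¹ : ℝ) • (z.1 + z.2), ξ) :=
    (hasTemperateGrowth_wave.1.continuous.comp (by fun_prop)).mul
      (hp.1.continuous.comp (by fun_prop))
  refine (hq.integrable_of_bound hF (n := M) (C := C * (1 + ‖ξ‖) ^ N) fun z => ?_).congr
    (Filter.Eventually.of_forall fun z => ?_)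
  · rw [norm_mul, norm_wave, one_mul]
    refine (h _).trans ?_
    have h1 : ‖(2⁻¹ : ℝ) • (z.1 + z.2)‖ ≤ ‖z‖ := by
      rw [norm_smul]
      have := norm_add_le z.1 z.2
      have := norm_fst_le z
      have := norm_snd_le z
      norm_num
      linarith
    calc _ ≤ C * ((1 + ‖z‖) ^ M * (1 + ‖ξ‖) ^ N) := by gcongr
      _ = _ := by ring
  · simp only [smul_eq_mul]; ring

/-- In the coordinates `x = m + w/2`, `y = m - w/2` the symbol depends on `m` and `ξ` only, and the
integral over `w` is a Wigner transform, computed by `wigner_fourier`. -/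
theorem integral_weylInner (hħ : 0 < ħ) (hp : PolyBounded p) (u v : 𝓢(E d, ℂ)) (ξ : E d) :
    ((2 * π * ħ : ℝ) ^ d : ℂ)⁻¹ * ∫ x, weylInner ħ p u x ξ * (starRingEnd ℂ) (v x) =
      ∫ m, p (m, ξ) * 𝓕 (fun k => corr ħ (fourierH ħ u) (fourierH ħ v) k ξ) m := by
  have hA := integrable_weyl_kernel (ħ := ħ) hp u v ξ
  set A : E d × E d → ℂ := fun z => wave (inner ℝ (z.1 - z.2) ξ / (2 * π * ħ)) *
      p ((2⁻¹ : ℝ) • (z.1 + z.2), ξ) * u z.2 * (starRingEnd ℂ) (v z.1) with hAdef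
  have hT := measurePreserving_midpoint (d := d)
  have e1 : ∫ x, weylInner ħ p u x ξ * (starRingEnd ℂ) (v x) = ∫ z, A z := by
    rw [Measure.volume_eq_prod, integral_prod _ hA]
    refine integral_congr_ae (Filter.Eventually.of_forall fun x => ?_)
    simp only [weylInner, hAdef]
    rw [integral_mul_const]
  have e2 : ∫ z, A z = ∫ m, ∫ w, A (m + (2⁻¹ : ℝ) • w, m - (2⁻¹ : ℝ) • w) := by
    have h := hT.integrable_comp_of_integrable hA
    refine Eq.trans ?_ (integral_prod _ h)
    conv_lhs => rw [← hT.map_eq]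
    rw [integral_map hT.measurable.aemeasurable (by rw [hT.map_eq]; exact hA.aestronglyMeasurable)]
    rfl
  rw [e1, e2, ← integral_const_mul]
  refine integral_congr_ae (Filter.Eventually.of_forall fun m => ?_)
  simp only
  rw [← wigner_fourier hħ u v m ξ, mul_left_comm]
  congr 1
  rw [← integral_const_mul]
  refine integral_congr_ae (Filter.Eventually.of_forall fun w => ?_)
  simp only [hAdef]
  have h1 : m + (2⁻¹ : ℝ) • w - (m - (2⁻¹ : ℝ) • w) = w := by
    rw [add_sub_sub_cancel, ← add_smul]; norm_num
  have h2 : (2⁻¹ : ℝ) • (m + (2⁻¹ : ℝ) • w + (m - (2⁻¹ : ℝ) • w)) = m := by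
    rw [add_add_sub_cancel, smul_add, ← add_smul]; norm_num
  rw [h1, h2]
  ring

theorem integrable_weylInner (hħ : 0 < ħ) (hp : PolyBounded p) (u v : 𝓢(E d, ℂ)) :
    Integrable (fun z : E d × E d => weylInner ħ p u z.1 z.2 * (starRingEnd ℂ) (v z.1)) := by
  obtain ⟨C, M, h⟩ := exists_norm_weylInner_le hħ hp u
  have h1 : Integrable fun ξ : E d => ((1 + ‖ξ‖) ^ (d + 1))⁻¹ := by
    have := integrable_one_add_norm (E := E d) (μ := volume) (r := (d + 1 : ℕ)) (by simp)
    refine this.congr (Filter.Eventually.of_forall fun ξ => ?_)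
    simp only
    rw [Real.rpow_neg (by positivity), Real.rpow_natCast]
  have h2 := ((((rapid_schwartz (μ := volume) v).int M)).mul_prod h1).const_mul C
  refine h2.mono' ?_ (Filter.Eventually.of_forall fun z => ?_)
  · have hc : Continuous fun w : (E d × E d) × E d =>
        wave (inner ℝ (w.1.1 - w.2) w.1.2 / (2 * π * ħ)) *
          p ((2⁻¹ : ℝ) • (w.1.1 + w.2), w.1.2) * u w.2 :=
      ((hasTemperateGrowth_wave.1.continuous.comp (by fun_prop)).mul
        (hp.1.continuous.comp (by fun_prop))).mul (u.continuous.comp continuous_snd)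
    have hm := hc.stronglyMeasurable.integral_prod_right' (ν := volume)
    exact (hm.aestronglyMeasurable (μ := volume)).mul
      ((Complex.continuous_conj.comp (v.continuous.comp continuous_fst)).aestronglyMeasurable)
  · rw [norm_mul, RCLike.norm_conj]
    calc _ ≤ (C * (1 + ‖z.1‖) ^ M * ((1 + ‖z.2‖) ^ (d + 1))⁻¹) * ‖v z.1‖ := by
          gcongr; exact h _ _
      _ = _ := by ring

/-- The matrix elements of a Weyl quantization in terms of Fourier transforms. -/
theorem pairing_weylOp (hħ : 0 < ħ) (hp : PolyBounded p) (u v : 𝓢(E d, ℂ)) :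
    pairing (weylOp ħ p u) v =
      ∫ ξ, ∫ m, p (m, ξ) * 𝓕 (fun k => corr ħ (fourierH ħ u) (fourierH ħ v) k ξ) m := by
  have h := integrable_weylInner hħ hp u v
  have e : pairing (weylOp ħ p u) v = ((2 * π * ħ : ℝ) ^ d : ℂ)⁻¹ *
      ∫ x, ∫ ξ, weylInner ħ p u x ξ * (starRingEnd ℂ) (v x) := by
    rw [pairing, ← integral_const_mul]
    refine integral_congr_ae (Filter.Eventually.of_forall fun x => ?_)
    simp only [weylOp, cexp_eq_wave]
    rw [integral_mul_const, mul_assoc]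
    rfl
  rw [e, integral_integral_swap h, ← integral_const_mul]
  simp only [integral_weylInner hħ hp u v]

end WeylPairing

/-! ### Fourier transforms of slices of compactly supported functions -/

section FourierSlice

variable {d : ℕ}

theorem HasCompactSupport.slice {X Y V : Type} [TopologicalSpace X] [TopologicalSpace Y]
    [T2Space Y] [Zero V] {r : X × Y → V} (hc : HasCompactSupport r) (x : X) :
    HasCompactSupport (fun y => r (x, y)) := by
  refine HasCompactSupport.intro (hc.image continuous_snd) fun y hy => ?_
  by_contra h
  exact hy ⟨(x, y), subset_tsupport _ h, rfl⟩

variable {r : E d × E d → ℂ}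

theorem exists_pow_mul_norm_fourier_slice_le (hr : ContDiff ℝ ∞ r) (hc : HasCompactSupport r)
    (n : ℕ) : ∃ C, ∀ m ξ, ‖m‖ ^ n * ‖𝓕 (fun k => r (ξ, k)) m‖ ≤ C * invSq ξ ^ n := by
  have h1 := (derivBounded_of_hasCompactSupport hr hc
    (w := fun z : E d × E d => invSq z.1 ^ n * invSq z.2 ^ (d + 1))
    (((contDiff_invSq (d := d)).continuous.comp continuous_fst).pow n |>.mul
      (((contDiff_invSq (d := d)).continuous.comp continuous_snd).pow (d + 1)))
    (fun z => mul_pos (pow_pos (invSq_pos _) _) (pow_pos (invSq_pos _) _)) n).slice hr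
  choose! C hC0 hC using h1
  have hI : Integrable fun k : E d => invSq k ^ (d + 1) := by
    simpa using integrable_invSq_pow (d := d) 0
  have hsl : ∀ ξ, ContDiff ℝ ∞ fun k => r (ξ, k) := fun ξ =>
    hr.comp (contDiff_const.prodMk contDiff_id)
  have hint : ∀ j ≤ n, ∀ ξ, Integrable fun k => ‖iteratedFDeriv ℝ j (fun k => r (ξ, k)) k‖ := by
    intro j hj ξ
    refine (hI.const_mul (C j * invSq ξ ^ n)).mono'
      ((hsl ξ).continuous_iteratedFDeriv (mod_cast le_top)).norm.aestronglyMeasurable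
      (Filter.Eventually.of_forall fun k => ?_)
    rw [norm_norm, mul_assoc]
    exact hC j hj ξ k
  refine ⟨2 ^ n * ∑ j ∈ Finset.range (n + 1), C j * ∫ k : E d, invSq k ^ (d + 1), fun m ξ => ?_⟩
  have h5 := Real.pow_mul_norm_iteratedFDeriv_fourier_le (K := 0) (N := (n : ℕ∞)) (k := 0)
    (n := n) (f := fun k => r (ξ, k)) ((hsl ξ).of_le (mod_cast le_top))
    (fun k j hk hj => by
      obtain rfl : k = 0 := by simpa using hk
      simpa using hint j (by exact_mod_cast hj) ξ) le_rfl le_rfl m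
  rw [norm_iteratedFDeriv_zero] at h5
  refine h5.trans (le_of_eq_of_le (b := 2 ^ n * ∑ j ∈ Finset.range (n + 1),
      ∫ k, ‖iteratedFDeriv ℝ j (fun k => r (ξ, k)) k‖) ?_ ?_)
  · rw [zero_add, Finset.range_one, Finset.singleton_product, Finset.sum_map]
    simp
  · rw [mul_assoc, Finset.sum_mul]
    gcongr with j hj
    have hj' : j ≤ n := by have := Finset.mem_range.1 hj; omega
    calc _ ≤ ∫ k, (C j * invSq ξ ^ n) * invSq k ^ (d + 1) :=
          integral_mono (hint j hj' ξ) (hI.const_mul _) fun k => by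
            simpa only [mul_assoc] using hC j hj' ξ k
      _ = _ := by rw [integral_const_mul]; ring

theorem rapid_fourier_slice (hr : ContDiff ℝ ∞ r) (hc : HasCompactSupport r) :
    Rapid volume (fun z : E d × E d => 𝓕 (fun k => r (z.2, k)) z.1) := by
  refine rapid_of_bound ?_ fun n => ?_
  · have h : Continuous fun w : (E d × E d) × E d =>
        (Real.fourierChar (-(inner ℝ w.2 w.1.1)) : ℂ) • r (w.1.2, w.2) := by
      simp only [← wave_eq_fourierChar]
      exact (hasTemperateGrowth_wave.1.continuous.comp (by fun_prop)).smul
        (hr.continuous.comp (by fun_prop))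
    have := (h.stronglyMeasurable.integral_prod_right' (ν := volume)).aestronglyMeasurable
      (μ := volume)
    refine this.congr (Filter.Eventually.of_forall fun z => ?_)
    simp only [Real.fourier_eq, Circle.smul_def]
  · obtain ⟨C₀, h0⟩ := exists_pow_mul_norm_fourier_slice_le hr hc 0
    obtain ⟨C, h⟩ := exists_pow_mul_norm_fourier_slice_le hr hc n
    -- The decay in `ξ` comes from the support: the slice at `ξ` vanishes outside a bounded set of
    -- `ξ`. The decay in `m` comes from smoothness in `k`.
    obtain ⟨C₁, h1⟩ : ∃ C₁ : ℝ, ∀ ξ m, ‖𝓕 (fun k => r (ξ, k)) m‖ ≠ 0 → (1 + ‖ξ‖) ^ n ≤ C₁ := by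
      obtain ⟨R, hR⟩ := hc.exists_bound_of_continuousOn (f := fun z : E d × E d => (1 + ‖z.1‖) ^ n)
        (by fun_prop)
      refine ⟨R, fun ξ m hne => ?_⟩
      by_contra hlt
      apply hne
      have : (fun k => r (ξ, k)) = 0 := by
        ext k
        by_contra hk
        have := hR (ξ, k) (subset_tsupport _ hk)
        rw [Real.norm_of_nonneg (by positivity)] at this
        exact hlt this
      rw [this, norm_eq_zero, Real.fourier_eq]
      simp
    refine ⟨|C₁| * (2 ^ n * (|C₀| + |C|)), fun z => ?_⟩
    by_cases hz : ‖𝓕 (fun k => r (z.2, k)) z.1‖ = 0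
    · rw [hz, mul_zero]; positivity
    · have h2 : ∀ j, invSq z.2 ^ j ≤ 1 := fun j => pow_le_one₀ (invSq_pos _).le (invSq_le_one _)
      have h2' : ∀ j, 0 ≤ invSq z.2 ^ j := fun j => pow_nonneg (invSq_pos _).le _
      have h3 := one_add_pow_mul_le (n := n) (norm_nonneg z.1)
        (norm_nonneg (𝓕 (fun k => r (z.2, k)) z.1)) (C₀ := |C₀|) (C := |C|)
        (by have := h0 z.1 z.2
            rw [pow_zero, one_mul, pow_zero, mul_one] at this
            exact this.trans (le_abs_self _))
        ((h z.1 z.2).trans (by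
          calc C * invSq z.2 ^ n ≤ |C| * invSq z.2 ^ n := by
                gcongr
                · exact h2' n
                · exact le_abs_self C
            _ ≤ |C| * 1 := by gcongr; exact h2 n
            _ = |C| := mul_one _))
      calc _ ≤ ((1 + ‖z.1‖) * (1 + ‖z.2‖)) ^ n * ‖𝓕 (fun k => r (z.2, k)) z.1‖ := by
            gcongr; exact one_add_norm_prod_le z.1 z.2
        _ = (1 + ‖z.2‖) ^ n * ((1 + ‖z.1‖) ^ n * ‖𝓕 (fun k => r (z.2, k)) z.1‖) := by
            rw [mul_pow]; ring
        _ ≤ _ := by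
            gcongr
            exact (h1 _ _ hz).trans (le_abs_self _)

/-- Integration over `m = z.1` is Fourier inversion of the slice at `s ξ`. Applied to `r = corr`, it
evaluates the matrix elements of every symbol that is a wave in `x`, whose covector may depend on
`ξ`. -/
theorem integral_fourier_slice_mul (hr : ContDiff ℝ ∞ r) (hc : HasCompactSupport r)
    {a : E d → ℂ} {s : E d → E d} (ha : Continuous a) (hs : Continuous s) {C : ℝ}
    (hb : ∀ ξ, ‖a ξ‖ ≤ C) :
    ∫ z : E d × E d, 𝓕 (fun k => r (z.2, k)) z.1 * (a z.2 * wave (inner ℝ (s z.2) z.1)) =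
      ∫ ξ, a ξ * r (ξ, s ξ) := by
  have hF : Continuous fun z : E d × E d => a z.2 * wave (inner ℝ (s z.2) z.1) :=
    (ha.comp continuous_snd).mul (hasTemperateGrowth_wave.1.continuous.comp
      ((hs.comp continuous_snd).inner continuous_fst))
  have hint := (rapid_fourier_slice hr hc).integrable_of_bound hF (n := 0) (C := C) fun z => by
    simpa [norm_wave] using hb z.2
  refine (integral_prod_symm _ hint).trans ?_
  refine integral_congr_ae (Filter.Eventually.of_forall fun ξ => ?_)
  have hcs := (HasCompactSupport.slice hc ξ)
  have hsl : ContDiff ℝ ∞ fun k => r (ξ, k) := hr.comp (contDiff_const.prodMk contDiff_id)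
  have h := schwartz_inversion (hcs.toSchwartzMap hsl) (s ξ)
  simp only [smul_eq_mul]
  have e : ⇑(hcs.toSchwartzMap hsl) = fun k => r (ξ, k) := rfl
  rw [e] at h
  beta_reduce at h
  rw [← h, ← integral_const_mul]
  refine integral_congr_ae (Filter.Eventually.of_forall fun m => ?_)
  simp only [real_inner_comm (s ξ) m]
  ring

theorem contDiff_corr {ħ : ℝ} {a b : E d → ℂ} (ha : ContDiff ℝ ∞ a) (hb : ContDiff ℝ ∞ b) :
    ContDiff ℝ ∞ fun z : E d × E d => corr ħ a b z.2 z.1 := by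
  refine contDiff_const.mul ((ha.comp ?_).mul (Complex.conjCLE.contDiff.comp (hb.comp ?_))) <;>
  fun_prop

/-- For `ħ > 0` the map `(ξ, k) ↦ (ξ - πħk, ξ + πħk)` is a linear isomorphism; the support lies in
the preimage of a compact product. -/
theorem hasCompactSupport_corr {ħ : ℝ} (hħ : 0 < ħ) {a b : E d → ℂ} (ha : HasCompactSupport a)
    (hb : HasCompactSupport b) :
    HasCompactSupport fun z : E d × E d => corr ħ a b z.2 z.1 := by
  have hK : IsCompact ((fun w : E d × E d => ((2⁻¹ : ℝ) • (w.1 + w.2),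
      (2 * π * ħ)⁻¹ • (w.2 - w.1))) '' (tsupport a ×ˢ tsupport b)) :=
    (ha.isCompact.prod hb.isCompact).image (by fun_prop)
  refine HasCompactSupport.intro hK fun z hz => ?_
  by_contra h
  apply hz
  have h1 : a (z.1 - (π * ħ) • z.2) ≠ 0 := fun h0 => h (by simp [corr, h0])
  have h2 : b (z.1 + (π * ħ) • z.2) ≠ 0 := fun h0 => h (by simp [corr, h0])
  refine ⟨(z.1 - (π * ħ) • z.2, z.1 + (π * ħ) • z.2),
    ⟨subset_tsupport _ h1, subset_tsupport _ h2⟩, Prod.ext ?_ ?_⟩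
  · simp only [sub_add_add_cancel, ← two_smul ℝ z.1, smul_smul]
    norm_num
  · simp only [add_sub_sub_cancel, ← two_smul ℝ ((π * ħ) • z.2), smul_smul]
    have : (2 * π * ħ)⁻¹ * (2 * (π * ħ)) = 1 := by field_simp
    rw [this, one_smul]

end FourierSlice

/-! ### Weyl quantization of a superposition -/

section PairingSuperposition

variable {d : ℕ} {ħ : ℝ} {p : E d × E d → ℂ} {Q : E d × E d → ℂ} {N : ℕ}
  {H : E d × ((E d × E d) × E d) → ℂ}

/-- Matrix elements of the Weyl quantization of a superposition. -/
theorem pairing_weylOp_superpose (hħ : 0 < ħ) (hp : PolyBounded p) (hQ : Rapid volume Q)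
    (hH : HasTemperateGrowth H) (u v : 𝓢(E d, ℂ)) (hu : ContDiff ℝ ∞ (fourierH ħ u))
    (hv : ContDiff ℝ ∞ (fourierH ħ v)) (hu' : HasCompactSupport (fourierH ħ u))
    (hv' : HasCompactSupport (fourierH ħ v))
    (hpH : ∀ m ξ, (∃ k, corr ħ (fourierH ħ u) (fourierH ħ v) k ξ ≠ 0) →
      p (m, ξ) = superpose Q N H (m, ξ)) :
    pairing (weylOp ħ p u) v = ∫ κ, Q κ * bessel^[N] (fun k => ∫ z : E d × E d,
      𝓕 (fun k => corr ħ (fourierH ħ u) (fourierH ħ v) k z.2) z.1 * H (k, (z, κ.2))) κ.1 := by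
  have hG := rapid_fourier_slice (contDiff_corr (ħ := ħ) hu hv)
    (hasCompactSupport_corr hħ hu' hv')
  rw [pairing_weylOp hħ hp, ← integral_mul_superpose hG hQ hH]
  have hint := hG.integrable_smul (X := ℝ) (F := fun w : ℝ × (E d × E d) => superpose Q N H w.2)
    ((temperate_superpose hQ hH).comp (f := fun w : ℝ × (E d × E d) => w.2) (by fun_prop)) 0
  refine Eq.trans ?_ (integral_prod_symm _ hint).symm
  refine integral_congr_ae (Filter.Eventually.of_forall fun ξ => ?_)
  refine integral_congr_ae (Filter.Eventually.of_forall fun m => ?_)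
  simp only [smul_eq_mul]
  -- Frequencies where the correlation vanishes identically contribute nothing, so `p` has to agree
  -- with the superposition only at middle points of the two supports.
  by_cases h : ∃ k, corr ħ (fourierH ħ u) (fourierH ħ v) k ξ ≠ 0
  · rw [hpH m ξ h, mul_comm]
  · push Not at h
    have : 𝓕 (fun k => corr ħ (fourierH ħ u) (fourierH ħ v) k ξ) m = 0 := by
      simp only [h, Real.fourier_eq]; simp
    rw [this, mul_zero, zero_mul]

end PairingSuperposition

/-! ### Cutoffs, extensions and smooth inverses -/

section Extension

open Set Topology

variable {X V : Type} [NormedAddCommGroup X] [NormedSpace ℝ X] [FiniteDimensional ℝ X]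
  [NormedAddCommGroup V] [NormedSpace ℝ V]

theorem exists_bump {K U : Set X} (hK : IsCompact K) (hU : IsOpen U) (hKU : K ⊆ U) :
    ∃ χ : X → ℝ, ContDiff ℝ ∞ χ ∧ HasCompactSupport χ ∧ tsupport χ ⊆ U ∧
      ∃ O, IsOpen O ∧ K ⊆ O ∧ O ⊆ U ∧ ∀ x ∈ O, χ x = 1 := by
  have := FiniteDimensional.proper_real X
  obtain ⟨K', hK', h1, h2⟩ := exists_compact_between hK hU hKU
  obtain ⟨f, hf1, hf0, -⟩ := exists_contMDiffMap_one_nhds_of_subset_interior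
    (modelWithCornersSelf ℝ X) (n := ⊤) hK.isClosed h1
  have hts : tsupport f ⊆ K' := closure_minimal
    (fun x hx => by by_contra h; exact hx (hf0 x h)) hK'.isClosed
  obtain ⟨O, hO, hKO, hO1⟩ := mem_nhdsSet_iff_exists.1 hf1
  refine ⟨f, f.contMDiff.contDiff, hK'.of_isClosed_subset (isClosed_tsupport _) hts,
    hts.trans h2, O ∩ U, hO.inter hU, subset_inter hKO hKU, inter_subset_right,
    fun x hx => hO1 hx.1⟩

theorem contDiff_smul_of_tsupport_subset {χ : X → ℝ} {f : X → V} {U : Set X}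
    (hχ : ContDiff ℝ ∞ χ) (hU : IsOpen U) (hs : tsupport χ ⊆ U) (hf : ContDiffOn ℝ ∞ f U) :
    ContDiff ℝ ∞ (fun x => χ x • f x) := by
  refine contDiff_iff_contDiffAt.2 fun x => ?_
  by_cases hx : x ∈ U
  · exact hχ.contDiffAt.smul (hf.contDiffAt (hU.mem_nhds hx))
  · refine (contDiffAt_const (c := (0 : V))).congr_of_eventuallyEq ?_
    filter_upwards [(isClosed_tsupport χ).isOpen_compl.mem_nhds fun h => hx (hs h)] with y hy
    rw [image_eq_zero_of_notMem_tsupport hy, zero_smul]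

/-- The phase data are smooth only over regular frequencies, while the calculus above needs global
functions. Agreement on an open set around `K` keeps all derivatives there. -/
theorem exists_contDiff_extension {f : X → V} {K U : Set X} (hK : IsCompact K) (hU : IsOpen U)
    (hKU : K ⊆ U) (hf : ContDiffOn ℝ ∞ f U) :
    ∃ F : X → V, ContDiff ℝ ∞ F ∧ HasCompactSupport F ∧
      ∃ O, IsOpen O ∧ K ⊆ O ∧ O ⊆ U ∧ ∀ x ∈ O, F x = f x := by
  obtain ⟨χ, h1, h2, h3, O, hO, hKO, hOU, hO1⟩ := exists_bump hK hU hKU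
  exact ⟨fun x => χ x • f x, contDiff_smul_of_tsupport_subset h1 hU h3 hf, h2.smul_right,
    O, hO, hKO, hOU, fun x hx => by simp only [hO1 x hx, one_smul]⟩

/-- A smooth map that is injective on a compact set, with invertible differential there, has a
smooth inverse near this set. -/
theorem exists_smooth_inverse [CompleteSpace X] {Ψ : X → X} (hΨ : ContDiff ℝ ∞ Ψ) {C : Set X}
    (hC : IsCompact C) (hinj : InjOn Ψ C) (hdet : ∀ x ∈ C, (fderiv ℝ Ψ x).det ≠ 0) :
    ∃ W, IsOpen W ∧ C ⊆ W ∧ (∀ W' ⊆ W, IsOpen W' → IsOpen (Ψ '' W')) ∧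
      ∃ Φ : X → X, ContDiffOn ℝ ∞ Φ (Ψ '' W) ∧ ∀ x ∈ W, Φ (Ψ x) = x := by
  have hd : ∀ x, (fderiv ℝ Ψ x).det ≠ 0 → ∃ e : X ≃L[ℝ] X, HasFDerivAt Ψ (e : X →L[ℝ] X) x :=
    fun x hx => ⟨(fderiv ℝ Ψ x).toContinuousLinearEquivOfDetNeZero hx, by
      rw [ContinuousLinearMap.coe_toContinuousLinearEquivOfDetNeZero]
      exact (hΨ.differentiable (by simp)).differentiableAt.hasFDerivAt⟩
  -- Injectivity on a compact set together with local injectivity at its points gives injectivity on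
  -- a neighbourhood.
  obtain ⟨W₁, hW₁, hCW₁, hinj₁⟩ := hinj.exists_isOpen_superset hC
    (fun x _ => hΨ.continuous.continuousAt) fun x hx => by
      obtain ⟨e, he⟩ := hd x (hdet x hx)
      refine ⟨_, (hΨ.contDiffAt.toOpenPartialHomeomorph Ψ he (by simp)).open_source.mem_nhds
        (hΨ.contDiffAt.mem_toOpenPartialHomeomorph_source he (by simp)), ?_⟩
      exact (hΨ.contDiffAt.toOpenPartialHomeomorph Ψ he (by simp)).injOn
  have hdc : Continuous fun x => (fderiv ℝ Ψ x).det :=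
    ContinuousLinearMap.continuous_det.comp (hΨ.continuous_fderiv (by simp))
  set W := W₁ ∩ {x | (fderiv ℝ Ψ x).det ≠ 0} with hW
  have hWo : IsOpen W := hW₁.inter (isOpen_ne.preimage hdc)
  have hinjW : InjOn Ψ W := hinj₁.mono inter_subset_left
  have hopen : ∀ W' ⊆ W, IsOpen W' → IsOpen (Ψ '' W') := by
    rintro W' hW' ho
    rw [isOpen_iff_mem_nhds]
    rintro _ ⟨x, hx, rfl⟩
    obtain ⟨e, he⟩ := hd x (hW' hx).2
    have h1 := (hΨ.contDiffAt.hasStrictFDerivAt' he (by simp)).map_nhds_eq_of_equiv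
    rw [← h1]
    exact Filter.image_mem_map (ho.mem_nhds hx)
  refine ⟨W, hWo, subset_inter hCW₁ hdet, hopen, ?_⟩
  rcases isEmpty_or_nonempty X with hX | hX
  · exact ⟨id, contDiffOn_id, fun x => (hX.false x).elim⟩
  refine ⟨invFunOn Ψ W, ?_, fun x hx => hinjW.leftInvOn_invFunOn hx⟩
  rintro _ ⟨x, hx, rfl⟩
  obtain ⟨e, he⟩ := hd x hx.2
  have hl := (hΨ.contDiffAt (x := x)).to_localInverse he (by simp)
  have hli := (hΨ.contDiffAt (x := x)).localInverse_apply_image he (by simp)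
  -- By injectivity on `W`, the set-theoretic inverse coincides near `Ψ x` with the inverse of the
  -- inverse function theorem, and so is smooth.
  refine (hl.congr_of_eventuallyEq ?_).contDiffWithinAt
  have h2 : ∀ᶠ y in 𝓝 (Ψ x), (hΨ.contDiffAt (x := x)).localInverse he (by simp) y ∈ W := by
    refine hl.continuousAt.eventually_mem ?_
    rw [hli]; exact hWo.mem_nhds hx
  have h3 := (hΨ.contDiffAt.hasStrictFDerivAt' (x := x) he (by simp)).eventually_right_inverse
  filter_upwards [h2, h3] with y hy hy'
  have : invFunOn Ψ W (Ψ ((hΨ.contDiffAt (x := x)).localInverse he (by simp) y)) = _ :=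
    hinjW.leftInvOn_invFunOn hy
  rw [← this]
  congr 1
  exact hy'.symm

theorem contDiff_det {d : ℕ} : ContDiff ℝ ∞ fun T : E d →L[ℝ] E d => T.det := by
  have h : (fun T : E d →L[ℝ] E d => T.det) = fun T => Matrix.det (Matrix.of fun i j =>
      T (EuclideanSpace.single j (1 : ℝ)) i) := by
    ext T
    rw [ContinuousLinearMap.det, ← LinearMap.det_toMatrix
      (EuclideanSpace.basisFun (Fin d) ℝ).toBasis]
    rfl
  rw [h]
  simp only [Matrix.det_apply]
  refine ContDiff.sum fun σ _ => ContDiff.const_smul _ (contDiff_prod fun i _ => ?_)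
  simp only [Matrix.of_apply]
  have h1 : ContDiff ℝ ∞ fun T : E d →L[ℝ] E d => T (EuclideanSpace.single i (1 : ℝ)) :=
    contDiff_id.clm_apply contDiff_const
  exact (EuclideanSpace.proj (𝕜 := ℝ) (σ i) : E d →L[ℝ] ℝ).contDiff.comp h1

theorem hasTemperateGrowth_of_hasCompactSupport {f : X → V} (hf : ContDiff ℝ ∞ f)
    (hc : HasCompactSupport f) : HasTemperateGrowth f := by
  refine ⟨hf, fun n => ?_⟩
  obtain ⟨C, -, h⟩ := derivBounded_of_hasCompactSupport hf hc (w := fun _ => 1) continuous_const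
    (fun _ => one_pos) n n le_rfl
  exact ⟨0, C, by simpa using h⟩

end Extension

/-! ### The chord equation -/

section Chord

open Set Topology

theorem det_ne_zero_of_injective {X : Type} [NormedAddCommGroup X] [NormedSpace ℝ X]
    [FiniteDimensional ℝ X] {T : X →L[ℝ] X} (h : ∀ v, T v = 0 → v = 0) : T.det ≠ 0 := by
  intro h0
  have := LinearMap.bot_lt_ker_of_det_eq_zero (f := (T : X →ₗ[ℝ] X)) h0
  obtain ⟨v, hv, hv0⟩ := (Submodule.ne_bot_iff _).1 this.ne'
  exact hv0 (h v hv)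

theorem injective_of_det_ne_zero {X : Type} [NormedAddCommGroup X] [NormedSpace ℝ X]
    [FiniteDimensional ℝ X] {T : X →L[ℝ] X} (h : T.det ≠ 0) (v : X) (hv : T v = 0) : v = 0 := by
  have h1 := congrArg (fun A : X →L[ℝ] X => A v) (T.coe_toContinuousLinearEquivOfDetNeZero h)
  simp only [ContinuousLinearEquiv.coe_coe, hv] at h1
  exact (map_eq_zero_iff _ (T.toContinuousLinearEquivOfDetNeZero h).injective).1 h1

variable {d : ℕ}

theorem hasFDerivAt_chord {g : E d → E d} (hg : ContDiff ℝ ∞ g) (θ τ : E d) :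
    HasFDerivAt (fun z : E d × E d => g (z.1 + (2⁻¹ : ℝ) • z.2) - g (z.1 - (2⁻¹ : ℝ) • z.2))
      ((fderiv ℝ g (θ + (2⁻¹ : ℝ) • τ)).comp (ContinuousLinearMap.fst ℝ (E d) (E d) +
          (2⁻¹ : ℝ) • ContinuousLinearMap.snd ℝ (E d) (E d)) -
        (fderiv ℝ g (θ - (2⁻¹ : ℝ) • τ)).comp (ContinuousLinearMap.fst ℝ (E d) (E d) -
          (2⁻¹ : ℝ) • ContinuousLinearMap.snd ℝ (E d) (E d))) (θ, τ) := by
  have hd := fun x => ((hg.differentiable (by simp)) x).hasFDerivAt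
  have h1 : HasFDerivAt (fun z : E d × E d => z.1 + (2⁻¹ : ℝ) • z.2)
      (ContinuousLinearMap.fst ℝ (E d) (E d) + (2⁻¹ : ℝ) • ContinuousLinearMap.snd ℝ (E d) (E d))
      (θ, τ) :=
    (ContinuousLinearMap.fst ℝ (E d) (E d) +
      (2⁻¹ : ℝ) • ContinuousLinearMap.snd ℝ (E d) (E d)).hasFDerivAt
  have h2 : HasFDerivAt (fun z : E d × E d => z.1 - (2⁻¹ : ℝ) • z.2)
      (ContinuousLinearMap.fst ℝ (E d) (E d) - (2⁻¹ : ℝ) • ContinuousLinearMap.snd ℝ (E d) (E d))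
      (θ, τ) :=
    (ContinuousLinearMap.fst ℝ (E d) (E d) -
      (2⁻¹ : ℝ) • ContinuousLinearMap.snd ℝ (E d) (E d)).hasFDerivAt
  exact ((hd _).comp _ h1).sub ((hd _).comp _ h2)

/-- The map from middle points and directions of chords to middle points and directions of the
images of chords. -/
def chordMap (g : E d → E d) (z : E d × E d) : E d × E d :=
  (z.1, g (z.1 + (2⁻¹ : ℝ) • z.2) - g (z.1 - (2⁻¹ : ℝ) • z.2))

theorem contDiff_chordMap {g : E d → E d} (hg : ContDiff ℝ ∞ g) : ContDiff ℝ ∞ (chordMap g) :=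
  contDiff_fst.prodMk ((hg.comp (by fun_prop)).sub (hg.comp (by fun_prop)))

theorem chordMap_zero (g : E d → E d) (θ : E d) : chordMap g (θ, 0) = (θ, 0) := by
  simp [chordMap]

/-- At the zero section the differential is `(a, b) ↦ (a, dg(θ) b)`: the contributions of `a` to the
second component cancel, and the two halves of `b` add up. -/
theorem det_fderiv_chordMap_ne_zero {g : E d → E d} (hg : ContDiff ℝ ∞ g) {θ : E d}
    (hθ : (fderiv ℝ g θ).det ≠ 0) : (fderiv ℝ (chordMap g) (θ, 0)).det ≠ 0 := by
  have h1 : HasFDerivAt (chordMap g) _ (θ, (0 : E d)) :=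
    (hasFDerivAt_fst (𝕜 := ℝ) (p := (θ, (0 : E d)))).prodMk (hasFDerivAt_chord hg θ 0)
  rw [h1.fderiv]
  refine det_ne_zero_of_injective ?_
  rintro ⟨a, b⟩ hab
  simp only [smul_zero, add_zero, sub_zero, ContinuousLinearMap.prod_apply, Prod.mk_eq_zero,
    ContinuousLinearMap.coe_fst', sub_apply, add_apply, ContinuousLinearMap.comp_apply, smul_apply,
    ContinuousLinearMap.coe_snd'] at hab
  obtain ⟨rfl, hb⟩ := hab
  have e : (fderiv ℝ g θ) ((2⁻¹ : ℝ) • b) = (2⁻¹ : ℝ) • (fderiv ℝ g θ b) := map_smul _ _ _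
  rw [zero_add, zero_sub, map_neg, sub_neg_eq_add, e, ← add_smul] at hb
  norm_num at hb
  rw [injective_of_det_ne_zero hθ b hb]
  rfl

/-- The reflection of the second variable. -/
def reflect (z : E d × E d) : E d × E d := (z.1, -z.2)

theorem contDiff_reflect : ContDiff ℝ ∞ (reflect (d := d)) :=
  contDiff_fst.prodMk contDiff_snd.neg

theorem reflect_reflect (z : E d × E d) : reflect (reflect z) = z := by simp [reflect]

/-- Exchanging the ends of a chord reverses its direction and that of its image. All the evenness in
`ħ` comes from this symmetry. -/
theorem chordMap_reflect (g : E d → E d) (z : E d × E d) :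
    chordMap g (reflect z) = reflect (chordMap g z) := by
  simp only [chordMap, reflect, smul_neg, sub_neg_eq_add, neg_sub, ← sub_eq_add_neg]

theorem hasCompactSupport_comp_reflect {V : Type} [Zero V] {f : E d × E d → V}
    (hf : HasCompactSupport f) : HasCompactSupport fun z => f (reflect z) := by
  let e : E d × E d ≃ₜ E d × E d := ⟨⟨reflect, reflect, reflect_reflect, reflect_reflect⟩,
    contDiff_reflect.continuous, contDiff_reflect.continuous⟩
  exact hf.comp_homeomorph e

/-- The chord `w(θ, κ)` with middle point `θ` whose image by `g` has the direction `κ`: it is the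
solution of `g(θ + w/2) - g(θ - w/2) = κ`. -/
theorem exists_chord {g : E d → E d} (hg : ContDiff ℝ ∞ g) {K : Set (E d)} (hK : IsCompact K)
    (hdet : ∀ θ ∈ K, (fderiv ℝ g θ).det ≠ 0) :
    ∃ w : E d × E d → E d, ContDiff ℝ ∞ w ∧ HasCompactSupport w ∧
      (∀ θ κ, w (θ, -κ) = -w (θ, κ)) ∧
      (∃ N, IsOpen N ∧ K ×ˢ {0} ⊆ N ∧ ∀ z ∈ N, chordMap g (z.1, w z) = z) ∧
      (∃ N, IsOpen N ∧ K ×ˢ {0} ⊆ N ∧ ∀ z ∈ N, w (chordMap g z) = z.2) := by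
  have hC : IsCompact (K ×ˢ ({0} : Set (E d))) := hK.prod isCompact_singleton
  have hfix : ∀ z ∈ K ×ˢ ({0} : Set (E d)), reflect z = z ∧ chordMap g z = z := by
    rintro ⟨θ, τ⟩ ⟨hθ, rfl : τ = 0⟩
    exact ⟨by simp [reflect], chordMap_zero g θ⟩
  have hinj : InjOn (chordMap g) (K ×ˢ ({0} : Set (E d))) := fun z hz z' hz' h => by
    rwa [(hfix z hz).2, (hfix z' hz').2] at h
  have hder : ∀ z ∈ K ×ˢ ({0} : Set (E d)), (fderiv ℝ (chordMap g) z).det ≠ 0 := by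
    rintro ⟨θ, τ⟩ ⟨hθ, rfl : τ = 0⟩
    exact det_fderiv_chordMap_ne_zero hg (hdet θ hθ)
  obtain ⟨W, hW, hCW, hWopen, Φ, hΦ, hΦΨ⟩ :=
    exists_smooth_inverse (contDiff_chordMap hg) hC hinj hder
  have hρc := (contDiff_reflect (d := d)).continuous
  have hW'o : IsOpen (W ∩ reflect ⁻¹' W) := hW.inter (hW.preimage hρc)
  have hCW' : K ×ˢ ({0} : Set (E d)) ⊆ W ∩ reflect ⁻¹' W := fun z hz =>
    ⟨hCW hz, by rw [mem_preimage, (hfix z hz).1]; exact hCW hz⟩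
  have hCO : K ×ˢ ({0} : Set (E d)) ⊆ chordMap g '' (W ∩ reflect ⁻¹' W) :=
    fun z hz => ⟨z, hCW' hz, (hfix z hz).2⟩
  obtain ⟨f, hf, hfc, O, hO, hCOO, hOW, hfO⟩ := exists_contDiff_extension hC
    (hWopen _ inter_subset_left hW'o) hCO
    (contDiff_snd.comp_contDiffOn (hΦ.mono (image_mono inter_subset_left)))
  have hNo : IsOpen (O ∩ reflect ⁻¹' O) := hO.inter (hO.preimage hρc)
  have hCN : K ×ˢ ({0} : Set (E d)) ⊆ O ∩ reflect ⁻¹' O := fun z hz =>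
    ⟨hCOO hz, by rw [mem_preimage, (hfix z hz).1]; exact hCOO hz⟩
  -- The extension `f` of the local solution need not be odd, and its odd part is used as `w`. On
  -- neighbourhoods symmetric under `reflect` this changes nothing, because `chordMap g` commutes
  -- with `reflect`.
  have key : ∀ z ∈ W ∩ reflect ⁻¹' W, chordMap g z ∈ O ∩ reflect ⁻¹' O →
      (2⁻¹ : ℝ) • (f (chordMap g z) - f (reflect (chordMap g z))) = z.2 := by
    intro z hz hzN
    have h1 : f (chordMap g z) = z.2 := by
      rw [hfO _ hzN.1, Function.comp_apply, hΦΨ z hz.1]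
    have h2 : f (reflect (chordMap g z)) = -z.2 := by
      rw [hfO _ hzN.2, Function.comp_apply, ← chordMap_reflect, hΦΨ _ hz.2]
      rfl
    rw [h1, h2, sub_neg_eq_add, ← two_smul ℝ z.2, smul_smul]
    norm_num
  refine ⟨fun z => (2⁻¹ : ℝ) • (f z - f (reflect z)),
    (hf.sub (hf.comp contDiff_reflect)).const_smul _,
    (hfc.sub (hasCompactSupport_comp_reflect hfc)).comp_left (smul_zero _),
    fun θ κ => ?_, ⟨_, hNo, hCN, fun z hz => ?_⟩,
    ⟨(W ∩ reflect ⁻¹' W) ∩ chordMap g ⁻¹' (O ∩ reflect ⁻¹' O), hW'o.inter (hNo.preimage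
      (contDiff_chordMap hg).continuous), fun z hz => ⟨hCW' hz, ?_⟩, fun z hz => key z hz.1 hz.2⟩⟩
  · simp only [reflect, neg_neg, ← smul_neg, neg_sub]
  · obtain ⟨y, hy, rfl⟩ := hOW hz.1
    beta_reduce
    rw [key y hy hz]
    rfl
  · rw [mem_preimage, (hfix z hz).2]
    exact hCN hz

end Chord

/-! ### Phase data, middle points and amplitude -/

section Geometry

open Set Topology

variable {d : ℕ}

/-- Smooth data on all of `ℝ^d` that describe the phase of `U_𝒢` near a compact set `K` of
frequencies: `g` is the map of frequencies, `S` the phase, `J` the inverse of the Jacobian and `w`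
the solution of the chord equation. -/
structure PhaseData (g : E d → E d) (S J : E d → ℝ) (w : E d × E d → E d) (K V : Set (E d)) :
    Prop where
  isCompact : IsCompact K
  isOpen : IsOpen V
  subset : K ⊆ V
  g_smooth : ContDiff ℝ ∞ g
  g_supp : HasCompactSupport g
  S_smooth : ContDiff ℝ ∞ S
  S_supp : HasCompactSupport S
  J_smooth : ContDiff ℝ ∞ J
  J_supp : HasCompactSupport J
  w_smooth : ContDiff ℝ ∞ w
  w_supp : HasCompactSupport w
  w_odd : ∀ θ κ, w (θ, -κ) = -w (θ, κ)
  det_ne : ∀ θ ∈ V, (fderiv ℝ g θ).det ≠ 0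
  J_eq : ∀ θ ∈ V, J θ = |(fderiv ℝ g θ).det|⁻¹
  chord_right : ∃ N, IsOpen N ∧ K ×ˢ {0} ⊆ N ∧ ∀ z ∈ N, chordMap g (z.1, w z) = z
  chord_left : ∃ N, IsOpen N ∧ K ×ˢ {0} ⊆ N ∧ ∀ z ∈ N, w (chordMap g z) = z.2

/-- The middle point of the image of the chord with middle point `θ` and image direction `κ`. -/
def midMap (g : E d → E d) (w : E d × E d → E d) (z : E d × E d) : E d :=
  (2⁻¹ : ℝ) • (g (z.1 + (2⁻¹ : ℝ) • w z) + g (z.1 - (2⁻¹ : ℝ) • w z))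

/-- The difference of the phases at the end points of the chord. -/
def phaseDiff (S : E d → ℝ) (w : E d × E d → E d) (z : E d × E d) : ℝ :=
  S (z.1 + (2⁻¹ : ℝ) • w z) - S (z.1 - (2⁻¹ : ℝ) • w z)

/-- The partial differential of `midMap` in the first variable. -/
def midDeriv (g : E d → E d) (w : E d × E d → E d) (z : E d × E d) : E d →L[ℝ] E d :=
  (fderiv ℝ (midMap g w) z).comp (ContinuousLinearMap.inl ℝ (E d) (E d))

/-- The amplitude, cut off by `χ` in the direction of the chord. -/
def amplitude (g : E d → E d) (J : E d → ℝ) (w : E d × E d → E d) (χ : E d → ℝ)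
    (z : E d × E d) : ℝ :=
  χ z.2 * ((fderiv ℝ g z.1).det * J z.1 * (midDeriv g w z).det) *
    (J (z.1 + (2⁻¹ : ℝ) • w z) * J (z.1 - (2⁻¹ : ℝ) • w z))

theorem exists_pos_le_norm {X V : Type} [TopologicalSpace X] [NormedAddCommGroup V] {C : Set X}
    (hC : IsCompact C) {f : X → V} (hf : Continuous f) (h : ∀ x ∈ C, f x ≠ 0) :
    ∃ δ > 0, ∀ x ∈ C, δ ≤ ‖f x‖ := by
  rcases C.eq_empty_or_nonempty with rfl | hne
  · exact ⟨1, one_pos, by simp⟩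
  · obtain ⟨x, hx, hmin⟩ := hC.exists_isMinOn hne hf.norm.continuousOn
    exact ⟨‖f x‖, norm_pos_iff.2 (h x hx), fun y hy => hmin hy⟩

namespace PhaseData

variable {g : E d → E d} {S J : E d → ℝ} {w : E d × E d → E d} {K V : Set (E d)} {χ : E d → ℝ}

theorem w_zero (h : PhaseData g S J w K V) (θ : E d) : w (θ, 0) = 0 := by
  have := h.w_odd θ 0
  rw [neg_zero] at this
  have h2 : (2 : ℝ) • w (θ, 0) = 0 := by
    rw [two_smul]
    nth_rw 1 [this]
    exact neg_add_cancel _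
  exact (smul_eq_zero.1 h2).resolve_left two_ne_zero

theorem midMap_smooth (h : PhaseData g S J w K V) : ContDiff ℝ ∞ (midMap g w) := by
  have h1 := h.g_smooth
  have h2 := h.w_smooth
  unfold midMap
  fun_prop

theorem midMap_zero (h : PhaseData g S J w K V) (θ : E d) : midMap g w (θ, 0) = g θ := by
  simp only [midMap, h.w_zero, smul_zero, add_zero, sub_zero, ← two_smul ℝ (g θ), smul_smul]
  norm_num

theorem midMap_neg (h : PhaseData g S J w K V) (θ κ : E d) :
    midMap g w (θ, -κ) = midMap g w (θ, κ) := by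
  simp only [midMap, h.w_odd, smul_neg, sub_neg_eq_add, ← sub_eq_add_neg]
  rw [add_comm]

theorem phaseDiff_neg (h : PhaseData g S J w K V) (θ κ : E d) :
    phaseDiff S w (θ, -κ) = -phaseDiff S w (θ, κ) := by
  simp only [phaseDiff, h.w_odd, smul_neg, sub_neg_eq_add, ← sub_eq_add_neg]
  ring

theorem hasFDerivAt_midMap (h : PhaseData g S J w K V) (θ κ : E d) :
    HasFDerivAt (fun θ => midMap g w (θ, κ)) (midDeriv g w (θ, κ)) θ := by
  have h1 : HasFDerivAt (midMap g w) (fderiv ℝ (midMap g w) (θ, κ)) (θ, κ) :=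
    (h.midMap_smooth.differentiable (by simp)).differentiableAt.hasFDerivAt
  have h2 : HasFDerivAt (fun θ : E d => (θ, κ)) (ContinuousLinearMap.inl ℝ (E d) (E d)) θ :=
    (hasFDerivAt_id θ).prodMk (hasFDerivAt_const κ θ)
  exact h1.comp θ h2

theorem midDeriv_neg (h : PhaseData g S J w K V) (θ κ : E d) :
    midDeriv g w (θ, -κ) = midDeriv g w (θ, κ) := by
  have h1 := h.hasFDerivAt_midMap θ (-κ)
  simp only [h.midMap_neg] at h1
  exact h1.unique (h.hasFDerivAt_midMap θ κ)

theorem midDeriv_zero (h : PhaseData g S J w K V) (θ : E d) :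
    midDeriv g w (θ, 0) = fderiv ℝ g θ := by
  have h1 := h.hasFDerivAt_midMap θ 0
  simp only [h.midMap_zero] at h1
  exact h1.fderiv.symm

theorem midDeriv_smooth (h : PhaseData g S J w K V) : ContDiff ℝ ∞ (midDeriv g w) :=
  (h.midMap_smooth.fderiv_right (by simp)).clm_comp contDiff_const

theorem amplitude_neg (h : PhaseData g S J w K V) (hχ : ∀ κ, χ (-κ) = χ κ) (θ κ : E d) :
    amplitude g J w χ (θ, -κ) = amplitude g J w χ (θ, κ) := by
  simp only [amplitude, h.midDeriv_neg, hχ, h.w_odd, smul_neg, sub_neg_eq_add, ← sub_eq_add_neg]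
  ring

theorem fderiv_g_smooth (h : PhaseData g S J w K V) :
    ContDiff ℝ ∞ fun z : E d × E d => (fderiv ℝ g z.1).det :=
  contDiff_det.comp ((h.g_smooth.fderiv_right (by simp)).comp contDiff_fst)

theorem sign_smooth (h : PhaseData g S J w K V) :
    ContDiff ℝ ∞ fun z : E d × E d =>
      (fderiv ℝ g z.1).det * J z.1 * (midDeriv g w z).det :=
  (h.fderiv_g_smooth.mul (h.J_smooth.comp contDiff_fst)).mul (contDiff_det.comp h.midDeriv_smooth)

theorem amplitude_smooth (h : PhaseData g S J w K V) (hχ : ContDiff ℝ ∞ χ) :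
    ContDiff ℝ ∞ (amplitude g J w χ) := by
  have h1 := h.J_smooth
  have h2 := h.w_smooth
  have h3 := h.sign_smooth
  unfold amplitude
  fun_prop

theorem amplitude_ne_zero {z : E d × E d} (hz : amplitude g J w χ z ≠ 0) :
    z.1 ∈ tsupport J ∧ z.2 ∈ tsupport χ := by
  constructor
  · by_contra hJ
    exact hz (by simp [amplitude, image_eq_zero_of_notMem_tsupport hJ])
  · by_contra hJ
    exact hz (by simp [amplitude, image_eq_zero_of_notMem_tsupport hJ])

theorem amplitude_supp (h : PhaseData g S J w K V) (hχ : HasCompactSupport χ) :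
    HasCompactSupport (amplitude g J w χ) :=
  HasCompactSupport.intro (h.J_supp.isCompact.prod hχ.isCompact) fun z hz => by
    by_contra h0
    exact hz ⟨(amplitude_ne_zero h0).1, (amplitude_ne_zero h0).2⟩

theorem abs_det_mul_J (h : PhaseData g S J w K V) {θ : E d} (hθ : θ ∈ V) :
    |(fderiv ℝ g θ).det| * J θ = 1 := by
  rw [h.J_eq θ hθ, mul_inv_cancel₀ (abs_ne_zero.2 (h.det_ne θ hθ))]

/-- The degenerate chord brings one factor `J` for each end, and the Jacobian of the middle point
map, which is `|det dg|` there, cancels one of them. -/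
theorem amplitude_zero (h : PhaseData g S J w K V) (hχ : χ 0 = 1) {θ : E d} (hθ : θ ∈ V) :
    amplitude g J w χ (θ, 0) = J θ := by
  have h1 := h.abs_det_mul_J hθ
  simp only [amplitude, hχ, h.midDeriv_zero, h.w_zero, smul_zero, add_zero, sub_zero, one_mul]
  have : (fderiv ℝ g θ).det * J θ * (fderiv ℝ g θ).det * (J θ * J θ) =
      (|(fderiv ℝ g θ).det| * J θ) ^ 2 * J θ := by
    rw [mul_pow, sq_abs]; ring
  rw [this, h1]; ring

/-- On `V` the factor `det dg * J` is the sign of `det dg`. By continuity `det midDeriv` has the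
same sign near the zero section over `K`, so the product is the absolute value that the change of
variables needs; unlike an absolute value, it is smooth everywhere. -/
theorem amplitude_eq (h : PhaseData g S J w K V) (hχ : ∀ κ, ‖κ‖ ≤ 1 → χ κ = 1) :
    ∃ N, IsOpen N ∧ K ×ˢ {0} ⊆ N ∧ ∀ z ∈ N, amplitude g J w χ z =
      |(midDeriv g w z).det| * (J (z.1 + (2⁻¹ : ℝ) • w z) * J (z.1 - (2⁻¹ : ℝ) • w z)) := by
  refine ⟨(V ×ˢ Metric.ball 0 1) ∩ {z | 0 < (fderiv ℝ g z.1).det * J z.1 * (midDeriv g w z).det},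
    (h.isOpen.prod Metric.isOpen_ball).inter (isOpen_lt continuous_const h.sign_smooth.continuous),
    ?_, ?_⟩
  · rintro ⟨θ, κ⟩ ⟨hθ, rfl : κ = 0⟩
    have hV := h.subset hθ
    refine ⟨⟨hV, by simp⟩, ?_⟩
    have h1 := h.det_ne θ hV
    simp only [mem_ofPred_eq, h.midDeriv_zero, h.J_eq θ hV]
    have : 0 < (fderiv ℝ g θ).det ^ 2 := by positivity
    have h2 : 0 < |(fderiv ℝ g θ).det|⁻¹ := inv_pos.2 (abs_pos.2 h1)
    nlinarith [mul_pos this h2]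
  · rintro z ⟨⟨hV, hz⟩, hpos⟩
    have h1 : |(fderiv ℝ g z.1).det * J z.1| = 1 := by
      rw [abs_mul, h.J_eq z.1 hV, abs_inv, abs_abs,
        mul_inv_cancel₀ (abs_ne_zero.2 (h.det_ne _ hV))]
    rw [mem_ofPred_eq] at hpos
    rw [amplitude, hχ z.2 (by simpa using (mem_ball_zero_iff.1 hz).le), one_mul, ← abs_of_pos hpos,
      abs_mul, h1, one_mul]

/-- The image chord is determined by its middle point and direction; at `ξ = midMap g w z`, the
points `ξ ∓ κ/2` are therefore the images of the ends of the chord. -/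
theorem inner_chord (h : PhaseData g S J w K V) :
    ∃ N, IsOpen N ∧ K ×ˢ {0} ⊆ N ∧ ∀ z ∈ N,
      midMap g w z - (2⁻¹ : ℝ) • z.2 = g (z.1 - (2⁻¹ : ℝ) • w z) ∧
      midMap g w z + (2⁻¹ : ℝ) • z.2 = g (z.1 + (2⁻¹ : ℝ) • w z) := by
  obtain ⟨N, hN, hKN, h1⟩ := h.chord_right
  refine ⟨N, hN, hKN, fun z hz => ?_⟩
  have h2 := congrArg Prod.snd (h1 z hz)
  simp only [chordMap] at h2
  rw [← h2, midMap]
  constructor <;> module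

end PhaseData

end Geometry

/-! ### From image frequencies to middle points of chords -/

section ChangeOfVariables

open Set Topology

variable {d : ℕ} {g : E d → E d} {S J : E d → ℝ} {w : E d × E d → E d} {K V : Set (E d)}
  {χ : E d → ℝ} {L : Set (E d)}

theorem half_add_half (a : E d) : (2⁻¹ : ℝ) • a + (2⁻¹ : ℝ) • a = a := by module

namespace PhaseData

/-- For a short image direction, chords with end points in a compact subset of `K` are near the
zero section. -/
theorem exists_chord_mem (h : PhaseData g S J w K V) (hL : IsCompact L) (hLK : L ⊆ K)
    {N : Set (E d × E d)} (hN : IsOpen N) (hKN : K ×ˢ {0} ⊆ N) :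
    ∃ δ > 0, ∀ θ κ, ‖κ‖ < δ → θ - (2⁻¹ : ℝ) • w (θ, κ) ∈ L → θ + (2⁻¹ : ℝ) • w (θ, κ) ∈ L →
      (θ, κ) ∈ N := by
  have hw := h.w_smooth.continuous
  set T : Set (E d × E d) := {z | (z.1 - (2⁻¹ : ℝ) • w z ∈ L ∧ z.1 + (2⁻¹ : ℝ) • w z ∈ L)} with hT
  have hTc : IsClosed T := (hL.isClosed.preimage (by fun_prop)).inter
    (hL.isClosed.preimage (by fun_prop))
  have hM : IsCompact ((fun p : E d × E d => (2⁻¹ : ℝ) • p.1 + (2⁻¹ : ℝ) • p.2) '' (L ×ˢ L)) :=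
    (hL.prod hL).image (by fun_prop)
  have hTM : ∀ z ∈ T, z.1 ∈ (fun p : E d × E d => (2⁻¹ : ℝ) • p.1 + (2⁻¹ : ℝ) • p.2) '' (L ×ˢ L) :=
    fun z hz => ⟨(_, _), ⟨hz.1, hz.2⟩, by module⟩
  -- The bad pairs with `‖κ‖ ≤ 1` form a compact set. It avoids `κ = 0`, where the chord degenerates
  -- to a point of `L ⊆ K`; so `‖κ‖` is bounded below on it.
  have hC : IsCompact ((T ∩ univ ×ˢ Metric.closedBall 0 1) \ N) := by
    refine (hM.prod (isCompact_closedBall (0 : E d) 1)).of_isClosed_subset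
      ((hTc.inter (isClosed_univ.prod Metric.isClosed_closedBall)).sdiff hN) ?_
    rintro z ⟨⟨h1, -, h2⟩, -⟩
    exact ⟨hTM z h1, h2⟩
  obtain ⟨δ, hδ, hmin⟩ := exists_pos_le_norm hC continuous_snd fun z hz h0 => by
    obtain ⟨θ, κ⟩ := z
    obtain rfl : κ = 0 := h0
    have : θ ∈ L := by
      have := hz.1.1.1
      simpa [h.w_zero] using this
    exact hz.2 (hKN ⟨hLK this, rfl⟩)
  refine ⟨min δ 1, lt_min hδ one_pos, fun θ κ hκ h1 h2 => ?_⟩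
  by_contra hN'
  have := hmin (θ, κ) ⟨⟨⟨h1, h2⟩, mem_univ _,
    mem_closedBall_zero_iff.2 (hκ.le.trans (min_le_right _ _))⟩, hN'⟩
  exact absurd (hκ.trans_le (min_le_left _ _)) (not_lt.2 this)

/-- Points of `L` with close images form a chord near the zero section. -/
theorem exists_pair_mem (hL : IsCompact L) (hLK : L ⊆ K) (hg : Continuous g) (hinj : InjOn g L)
    {N : Set (E d × E d)} (hN : IsOpen N) (hKN : K ×ˢ {0} ⊆ N) :
    ∃ δ > 0, ∀ a ∈ L, ∀ b ∈ L, ‖g b - g a‖ < δ →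
      ((2⁻¹ : ℝ) • (a + b), b - a) ∈ N := by
  have hf : Continuous fun p : E d × E d => ((2⁻¹ : ℝ) • (p.1 + p.2), p.2 - p.1) := by fun_prop
  have hC : IsCompact ((L ×ˢ L) \ (fun p : E d × E d => ((2⁻¹ : ℝ) • (p.1 + p.2), p.2 - p.1)) ⁻¹' N) :=
    (hL.prod hL).diff (hN.preimage hf)
  -- Here injectivity of `g` on `L` enters: a pair with equal images is diagonal, and diagonal pairs
  -- give points of the zero section, which lie in `N`.
  obtain ⟨δ, hδ, hmin⟩ := exists_pos_le_norm hC (f := fun p : E d × E d => g p.2 - g p.1)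
    (by fun_prop) fun p hp h0 => by
      have := hinj hp.1.2 hp.1.1 (sub_eq_zero.1 h0)
      apply hp.2
      rw [mem_preimage, this, sub_self, ← two_smul ℝ p.1, smul_smul]
      norm_num
      exact hKN ⟨hLK hp.1.1, rfl⟩
  refine ⟨δ, hδ, fun a ha b hb hab => ?_⟩
  by_contra hN'
  exact absurd hab (not_lt.2 (hmin (a, b) ⟨⟨ha, hb⟩, hN'⟩))

/-- The change of variables from frequencies to middle points of chords. -/
theorem integral_chord (h : PhaseData g S J w K V) (hχ : ∀ κ, ‖κ‖ ≤ 1 → χ κ = 1)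
    (hL : IsCompact L) (hLK : L ⊆ K) (hinj : InjOn g L) :
    ∃ δ > 0, ∀ (r : ℝ) (a b A B f : E d → ℂ) (κ : E d),
      (∀ η ∉ g '' L, a η = 0) → (∀ η ∉ g '' L, b η = 0) → (∀ θ ∉ L, A θ = 0) →
      (∀ θ ∉ L, B θ = 0) → (∀ θ ∈ L, a (g θ) = J θ * wave (r * S θ) * A θ) →
      (∀ θ ∈ L, b (g θ) = J θ * wave (r * S θ) * B θ) → ‖κ‖ < δ →
      ∫ ξ, f ξ * (a (ξ - (2⁻¹ : ℝ) • κ) * (starRingEnd ℂ) (b (ξ + (2⁻¹ : ℝ) • κ))) =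
        ∫ θ, (amplitude g J w χ (θ, κ) * wave (-(r * phaseDiff S w (θ, κ)))) *
          f (midMap g w (θ, κ)) *
          (A (θ - (2⁻¹ : ℝ) • w (θ, κ)) * (starRingEnd ℂ) (B (θ + (2⁻¹ : ℝ) • w (θ, κ)))) := by
  obtain ⟨N₁, hN₁, hKN₁, h₁⟩ := h.inner_chord
  obtain ⟨N₂, hN₂, hKN₂, h₂⟩ := h.amplitude_eq hχ
  obtain ⟨N₃, hN₃, hKN₃, h₃⟩ := h.chord_left
  obtain ⟨δ₁, hδ₁, hδ₁'⟩ := h.exists_chord_mem hL hLK (hN₁.inter hN₂) (subset_inter hKN₁ hKN₂)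
  obtain ⟨δ₂, hδ₂, hδ₂'⟩ := exists_pair_mem hL hLK h.g_smooth.continuous hinj hN₃ hKN₃
  refine ⟨min δ₁ δ₂, lt_min hδ₁ hδ₂, fun r a b A B f κ ha hb hA hB hab hbb hκ => ?_⟩
  have hκ₁ := hκ.trans_le (min_le_left _ _)
  have hκ₂ := hκ.trans_le (min_le_right _ _)
  set Θ : Set (E d) := {θ | θ - (2⁻¹ : ℝ) • w (θ, κ) ∈ L ∧ θ + (2⁻¹ : ℝ) • w (θ, κ) ∈ L} with hΘ
  have hw := h.w_smooth.continuous
  have hΘc : IsClosed Θ := (hL.isClosed.preimage (by fun_prop)).inter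
    (hL.isClosed.preimage (by fun_prop))
  have hends : ∀ θ ∈ Θ,
      midMap g w (θ, κ) - (2⁻¹ : ℝ) • κ = g (θ - (2⁻¹ : ℝ) • w (θ, κ)) ∧
      midMap g w (θ, κ) + (2⁻¹ : ℝ) • κ = g (θ + (2⁻¹ : ℝ) • w (θ, κ)) := fun θ hθ =>
    h₁ (θ, κ) (hδ₁' θ κ hκ₁ hθ.1 hθ.2).1
  -- The middle point of the image, with `κ` fixed, determines both ends of the image chord, hence
  -- both ends of the chord by injectivity of `g` on `L`, hence its middle point.
  have hinjΘ : InjOn (fun θ => midMap g w (θ, κ)) Θ := by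
    intro θ hθ θ' hθ' he
    simp only at he
    have e1 := (hends θ hθ).1
    have e2 := (hends θ hθ).2
    rw [he, (hends θ' hθ').1] at e1
    rw [he, (hends θ' hθ').2] at e2
    have e3 := congrArg₂ (fun x y => (2⁻¹ : ℝ) • (x + y))
      (hinj hθ'.1 hθ.1 e1) (hinj hθ'.2 hθ.2 e2)
    simp only [sub_add_add_cancel, ← two_smul ℝ θ, ← two_smul ℝ θ', smul_smul] at e3
    norm_num at e3
    exact e3.symm
  have himg : ∀ ξ, ξ - (2⁻¹ : ℝ) • κ ∈ g '' L → ξ + (2⁻¹ : ℝ) • κ ∈ g '' L →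
      ξ ∈ (fun θ => midMap g w (θ, κ)) '' Θ := by
    rintro ξ ⟨x, hx, hgx⟩ ⟨y, hy, hgy⟩
    have e1 : g y - g x = κ := by rw [hgx, hgy]; module
    have e2 := h₃ _ (hδ₂' x hx y hy (by rwa [e1]))
    have e4 : (2⁻¹ : ℝ) • (x + y) + (2⁻¹ : ℝ) • (y - x) = y := by module
    have e5 : (2⁻¹ : ℝ) • (x + y) - (2⁻¹ : ℝ) • (y - x) = x := by module
    simp only [chordMap, e4, e5, e1] at e2
    refine ⟨(2⁻¹ : ℝ) • (x + y), ?_, ?_⟩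
    · rw [hΘ, mem_ofPred_eq, e2, e4, e5]; exact ⟨hx, hy⟩
    · simp only [midMap, e2, e4, e5, hgx, hgy]; module
  have hzero : ∀ ξ, ξ ∉ (fun θ => midMap g w (θ, κ)) '' Θ →
      f ξ * (a (ξ - (2⁻¹ : ℝ) • κ) * (starRingEnd ℂ) (b (ξ + (2⁻¹ : ℝ) • κ))) = 0 := by
    intro ξ hξ
    by_cases h1 : ξ - (2⁻¹ : ℝ) • κ ∈ g '' L
    · have h2 : ξ + (2⁻¹ : ℝ) • κ ∉ g '' L := fun h2 => hξ (himg ξ h1 h2)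
      rw [hb _ h2, map_zero, mul_zero, mul_zero]
    · rw [ha _ h1, zero_mul, mul_zero]
  have hzero' : ∀ θ, θ ∉ Θ →
      (amplitude g J w χ (θ, κ) * wave (-(r * phaseDiff S w (θ, κ)))) * f (midMap g w (θ, κ)) *
        (A (θ - (2⁻¹ : ℝ) • w (θ, κ)) *
          (starRingEnd ℂ) (B (θ + (2⁻¹ : ℝ) • w (θ, κ)))) = 0 := by
    intro θ hθ
    by_cases h1 : θ - (2⁻¹ : ℝ) • w (θ, κ) ∈ L
    · have h2 : θ + (2⁻¹ : ℝ) • w (θ, κ) ∉ L := fun h2 => hθ ⟨h1, h2⟩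
      rw [hB _ h2, map_zero, mul_zero, mul_zero]
    · rw [hA _ h1, zero_mul, mul_zero]
  -- The vanishing of `a`, `b`, `A`, `B` reduces both integrals to `Θ` and its image, where the
  -- middle point map is an injective substitution.
  rw [← setIntegral_eq_integral_of_forall_compl_eq_zero hzero,
    ← setIntegral_eq_integral_of_forall_compl_eq_zero hzero',
    integral_image_eq_integral_abs_det_fderiv_smul volume hΘc.measurableSet
      (fun θ _ => (h.hasFDerivAt_midMap θ κ).hasFDerivWithinAt) hinjΘ]
  refine setIntegral_congr_fun hΘc.measurableSet fun θ hθ => ?_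
  have hc := h₂ (θ, κ) (hδ₁' θ κ hκ₁ hθ.1 hθ.2).2
  simp only [hc, (hends θ hθ).1, (hends θ hθ).2, hab _ hθ.1, hbb _ hθ.2, map_mul, conj_wave,
    Complex.conj_ofReal, phaseDiff, Complex.real_smul]
  have hwv : wave (-(r * (S (θ + (2⁻¹ : ℝ) • w (θ, κ)) - S (θ - (2⁻¹ : ℝ) • w (θ, κ))))) =
      wave (r * S (θ - (2⁻¹ : ℝ) • w (θ, κ))) * wave (-(r * S (θ + (2⁻¹ : ℝ) • w (θ, κ)))) := by
    rw [← wave_add]; congr 1; ring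
  rw [hwv]
  push_cast
  ring

/-- A smooth inverse of `g` near the image of `L`. -/
theorem exists_inverse (h : PhaseData g S J w K V) (hL : IsCompact L) (hLK : L ⊆ K)
    (hinj : InjOn g L) :
    ∃ (Γ : E d → E d) (b : E d → ℝ), ContDiff ℝ ∞ Γ ∧ HasCompactSupport Γ ∧ ContDiff ℝ ∞ b ∧
      HasCompactSupport b ∧ (∀ η, b η ≠ 0 → g (Γ η) = η) ∧
      ∀ θ ∈ L, Γ (g θ) = θ ∧ b (g θ) = J θ := by
  obtain ⟨W, hW, hLW, hWo, Φ, hΦ, hΦg⟩ := exists_smooth_inverse h.g_smooth hL hinj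
    fun x hx => h.det_ne x (h.subset (hLK hx))
  have hLc : IsCompact (g '' L) := hL.image h.g_smooth.continuous
  obtain ⟨Γ, hΓ, hΓc, O, hO, hLO, hOW, hΓO⟩ := exists_contDiff_extension hLc
    (hWo W subset_rfl hW) (image_mono hLW) hΦ
  obtain ⟨ζ, hζ, hζc, hζO, O', hO', hLO', hOO', hζ1⟩ := exists_bump hLc hO hLO
  -- The cutoff `ζ` makes `b` vanish wherever the extension `Γ` has ceased to be an inverse of `g`.
  refine ⟨Γ, fun η => ζ η * J (Γ η), hΓ, hΓc, hζ.mul (h.J_smooth.comp hΓ), hζc.mul_right,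
    fun η hη => ?_, fun θ hθ => ?_⟩
  · have h1 : η ∈ O := hζO (subset_tsupport _ (left_ne_zero_of_mul hη))
    obtain ⟨y, hy, rfl⟩ := hOW h1
    rw [hΓO _ h1, hΦg y hy]
  · have h1 : Γ (g θ) = θ := by rw [hΓO _ (hLO (mem_image_of_mem g hθ)), hΦg _ (hLW hθ)]
    exact ⟨h1, by simp only [hζ1 _ (hLO' (mem_image_of_mem g hθ)), h1, one_mul]⟩

end PhaseData

end ChangeOfVariables

/-! ### The propagator on the Fourier side -/

section Transport

open Set Topology

variable {d : ℕ} {g : E d → E d} {S J b : E d → ℝ} {w : E d × E d → E d} {K V : Set (E d)}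
  {L : Set (E d)} {Γ : E d → E d} {ħ : ℝ}

theorem contDiff_fourierH (ħ : ℝ) (ψ : 𝓢(E d, ℂ)) : ContDiff ℝ ∞ (fourierH ħ ψ) := by
  have h : fourierH ħ ψ = fun ξ => (𝓕 ψ : 𝓢(E d, ℂ)) ((2 * π * ħ)⁻¹ • ξ) := by
    ext ξ
    rw [fourierH_eq, SchwartzMap.fourier_coe]
  rw [h]
  exact ((𝓕 ψ : 𝓢(E d, ℂ)).smooth ⊤).comp (contDiff_const_smul _)

theorem exists_schwartz_fourierH_eq (hħ : 0 < ħ) {a : E d → ℂ} (ha : ContDiff ℝ ∞ a)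
    (hc : HasCompactSupport a) : ∃ u : 𝓢(E d, ℂ), fourierH ħ u = a ∧ ∀ x, u x =
      ((2 * π * ħ : ℝ) ^ d : ℂ)⁻¹ * ∫ η, wave ((2 * π * ħ)⁻¹ * inner ℝ x η) * a η := by
  have hh : (0 : ℝ) < 2 * π * ħ := by positivity
  have h1 : ContDiff ℝ ∞ fun η => a ((2 * π * ħ) • η) := ha.comp (contDiff_const_smul _)
  have h2 : HasCompactSupport fun η => a ((2 * π * ħ) • η) :=
    hc.comp_homeomorph (Homeomorph.smulOfNeZero _ hh.ne')
  refine ⟨𝓕⁻ (h2.toSchwartzMap h1), ?_, fun x => ?_⟩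
  · ext ξ
    rw [fourierH_eq, ← SchwartzMap.fourier_coe, FourierTransform.fourier_fourierInv_eq]
    change a ((2 * π * ħ) • (2 * π * ħ)⁻¹ • ξ) = a ξ
    rw [smul_smul, mul_inv_cancel₀ hh.ne', one_smul]
  · rw [SchwartzMap.fourierInv_coe, Real.fourierInv_eq]
    have e := Measure.integral_comp_smul volume
      (fun η : E d => wave ((2 * π * ħ)⁻¹ * inner ℝ x η) * a η) (2 * π * ħ)
    rw [finrank_euclideanSpace_fin, abs_of_pos (by positivity), Complex.real_smul] at e
    push_cast at e ⊢
    rw [← e]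
    refine integral_congr_ae (Filter.Eventually.of_forall fun η => ?_)
    simp only [Circle.smul_def, ← wave_eq_fourierChar, smul_eq_mul, real_inner_smul_right,
      real_inner_comm x η]
    rw [inv_mul_cancel_left₀ hh.ne']
    rfl

/-- The semiclassical Fourier transform of `U_𝒢 ψ`, in terms of that of `ψ`. -/
def transport (ħ : ℝ) (S b : E d → ℝ) (Γ : E d → E d) (A : E d → ℂ) (η : E d) : ℂ :=
  b η * wave ((2 * π * ħ)⁻¹ * S (Γ η)) * A (Γ η)

theorem contDiff_transport (hS : ContDiff ℝ ∞ S) (hb : ContDiff ℝ ∞ b) (hΓ : ContDiff ℝ ∞ Γ)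
    {A : E d → ℂ} (hA : ContDiff ℝ ∞ A) : ContDiff ℝ ∞ (transport ħ S b Γ A) :=
  ((Complex.ofRealCLM.contDiff.comp hb).mul (hasTemperateGrowth_wave.1.comp
    (contDiff_const.mul (hS.comp hΓ)))).mul (hA.comp hΓ)

theorem hasCompactSupport_transport (hb : HasCompactSupport b) (A : E d → ℂ) :
    HasCompactSupport (transport ħ S b Γ A) :=
  HasCompactSupport.intro hb.isCompact fun η hη => by
    simp [transport, image_eq_zero_of_notMem_tsupport hη]

theorem transport_eq_zero (hΓ : ∀ η, b η ≠ 0 → g (Γ η) = η) {A : E d → ℂ}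
    (hA : ∀ θ ∉ L, A θ = 0) : ∀ η ∉ g '' L, transport ħ S b Γ A η = 0 := by
  intro η hη
  by_cases hb : b η = 0
  · simp [transport, hb]
  · have : Γ η ∉ L := fun h => hη ⟨Γ η, h, hΓ η hb⟩
    simp [transport, hA _ this]

theorem transport_apply (hL : ∀ θ ∈ L, Γ (g θ) = θ ∧ b (g θ) = J θ) (A : E d → ℂ) :
    ∀ θ ∈ L, transport ħ S b Γ A (g θ) = J θ * wave ((2 * π * ħ)⁻¹ * S θ) * A θ := by
  intro θ hθ
  rw [transport, (hL θ hθ).1, (hL θ hθ).2]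

/-- Substituting `η = g(ξ)`, the Jacobian `|det dg|` cancels the factor `J` of `transport`. Thus
`U_𝒢 ψ` is the inverse semiclassical Fourier transform of a smooth compactly supported function when
`ψ` is Schwartz. -/
theorem PhaseData.opU_eq (h : PhaseData g S J w K V) (hL : IsCompact L) (hLK : L ⊆ K)
    (hinj : InjOn g L) (hΓ : ∀ η, b η ≠ 0 → g (Γ η) = η)
    (hΓL : ∀ θ ∈ L, Γ (g θ) = θ ∧ b (g θ) = J θ) {𝒢 : A d → A d}
    (h𝒢 : ∀ x, ∀ ξ ∈ L, inner ℝ (𝒢 (cons 0 x)) (sigma ξ) = inner ℝ x (g ξ) + S ξ)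
    {ψ : E d → ℂ} (hψ : ∀ θ ∉ L, fourierH ħ ψ θ = 0) (x : E d) :
    opU ħ 𝒢 ψ x = ((2 * π * ħ : ℝ) ^ d : ℂ)⁻¹ *
      ∫ η, wave ((2 * π * ħ)⁻¹ * inner ℝ x η) * transport ħ S b Γ (fourierH ħ ψ) η := by
  have h1 : ∀ η, η ∉ g '' L →
      wave ((2 * π * ħ)⁻¹ * inner ℝ x η) * transport ħ S b Γ (fourierH ħ ψ) η = 0 := fun η hη => by
    rw [transport_eq_zero hΓ hψ η hη, mul_zero]
  have h2 : ∀ ξ, ξ ∉ L → Complex.exp ((Complex.I / ħ) *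
      (inner ℝ (𝒢 (cons 0 x)) (sigma ξ) : ℝ)) * fourierH ħ ψ ξ = 0 := fun ξ hξ => by
    rw [hψ ξ hξ, mul_zero]
  rw [opU, opV, ← setIntegral_eq_integral_of_forall_compl_eq_zero h1,
    ← setIntegral_eq_integral_of_forall_compl_eq_zero h2,
    integral_image_eq_integral_abs_det_fderiv_smul volume hL.measurableSet (fun θ _ =>
      ((h.g_smooth.differentiable (by simp)) θ).hasFDerivAt.hasFDerivWithinAt) hinj]
  congr 1
  refine setIntegral_congr_fun hL.measurableSet fun ξ hξ => ?_
  have e := h.abs_det_mul_J (h.subset (hLK hξ))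
  simp only [transport_apply hΓL (fourierH ħ ψ) ξ hξ, cexp_eq_wave, h𝒢 x ξ hξ, Complex.real_smul]
  rw [div_eq_inv_mul, mul_add, wave_add]
  have e' : ((|(fderiv ℝ g ξ).det| : ℝ) : ℂ) * (J ξ : ℂ) = 1 := by rw [← Complex.ofReal_mul, e]; simp
  linear_combination (-(wave ((2 * π * ħ)⁻¹ * inner ℝ x (g ξ)) * wave ((2 * π * ħ)⁻¹ * S ξ) *
    fourierH ħ ψ ξ)) * e'

end Transport

/-! ### Families of symbols and evenness in `ħ` -/

section Families

open Set Topology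

variable {d : ℕ} {X : Type} [NormedAddCommGroup X] [NormedSpace ℝ X]

/-- Hadamard's lemma divides by `s` once; the quotient at `s = 0` is the first derivative of an even
function, which vanishes, so a second division is possible. -/
theorem exists_temperate_sq_factor {T : X × ℝ → ℂ} (hT : HasTemperateGrowth T)
    (heven : ∀ z s, T (z, -s) = T (z, s)) : ∃ F : X × ℝ → ℂ, HasTemperateGrowth F ∧
      ∀ z s, T (z, s) - T (z, 0) = (s ^ 2 : ℝ) • F (z, s) := by
  have hf : HasTemperateGrowth fun z : X × ℝ => T z - T (z.1, 0) :=
    hT.sub (hT.comp (f := fun z : X × ℝ => (z.1, (0 : ℝ))) (by fun_prop))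
  obtain ⟨F₁, hF₁, h₁, h₁'⟩ := exists_temperate_factor hf fun x => sub_self _
  have hf₁ : HasTemperateGrowth fun z : X × ℝ => F₁ z 1 := by fun_prop
  obtain ⟨F₂, hF₂, h₂, -⟩ := exists_temperate_factor hf₁ fun x => by
    have e : (fun v : ℝ => T (x, -v) - T (x, 0)) = fun v => T (x, v) - T (x, 0) := by
      ext v; rw [heven]
    have e2 := deriv_comp_neg (fun v : ℝ => T (x, v) - T (x, 0)) 0
    rw [e, neg_zero] at e2
    rw [h₁', fderiv_apply_one_eq_deriv]
    exact self_eq_neg.1 e2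
  refine ⟨fun z => F₂ z 1, by fun_prop, fun z s => ?_⟩
  have hs : ∀ (B : ℝ →L[ℝ] ℂ), B s = s • B 1 := fun B => by
    rw [← map_smul, smul_eq_mul, mul_one]
  rw [h₁ z s, hs, h₂ z s, hs, smul_smul, sq]

theorem iteratedFDeriv_eq_of_eqOn {Y V : Type} [NormedAddCommGroup Y] [NormedSpace ℝ Y]
    [NormedAddCommGroup V] [NormedSpace ℝ V] {f g : Y → V} {U : Set Y} (hU : IsOpen U)
    (h : EqOn f g U) {z : Y} (hz : z ∈ U) (k : ℕ) :
    iteratedFDeriv ℝ k f z = iteratedFDeriv ℝ k g z :=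
  (Filter.EventuallyEq.iteratedFDeriv ℝ (h.eventuallyEq_of_mem (hU.mem_nhds hz)) k).eq_of_nhds

theorem one_add_norm_le_of_bounded {R : ℝ} {ħ : ℝ} (h0 : 0 < ħ) (h1 : ħ ≤ 1) {z : E d × E d}
    (hz : ‖z.2‖ ≤ R) :
    1 + ‖(z, 2 * π * ħ)‖ ≤ (1 + ‖z.1‖) * ((1 + R) * (1 + 2 * π)) := by
  refine (one_add_norm_prod_le z (2 * π * ħ)).trans ?_
  have e1 := one_add_norm_prod_le z.1 z.2
  have hpi := Real.pi_pos
  have hR := (norm_nonneg _).trans hz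
  rw [Real.norm_of_nonneg (by positivity), ← mul_assoc]
  have e2 : 2 * π * ħ ≤ 2 * π := by nlinarith
  calc _ ≤ ((1 + ‖z.1‖) * (1 + ‖z.2‖)) * (1 + 2 * π * ħ) := by gcongr
    _ ≤ _ := by gcongr

theorem exists_slice_bound {T : (E d × E d) × ℝ → ℂ} (hT : HasTemperateGrowth T) (R : ℝ) (k : ℕ) :
    ∃ (C : ℝ) (M : ℕ), 0 ≤ C ∧ ∀ ħ : ℝ, 0 < ħ → ħ ≤ 1 → ∀ z : E d × E d, ‖z.2‖ ≤ R →
      ‖iteratedFDeriv ℝ k (fun z => T (z, 2 * π * ħ)) z‖ ≤ C * (1 + ‖z.1‖) ^ M := by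
  obtain ⟨n, C, hC, h⟩ := hT.slice_bound k
  refine ⟨C * ((1 + |R|) * (1 + 2 * π)) ^ n, n, by have := Real.pi_pos; positivity,
    fun ħ h0 h1 z hz => (h z _).trans ?_⟩
  rw [mul_assoc C, ← mul_pow]
  gcongr
  exact (one_add_norm_le_of_bounded h0 h1 (hz.trans (le_abs_self R))).trans_eq (mul_comm _ _)

/-- Temperate growth allows powers of `x`, `ξ` and `s`. The support in `ξ` bounds the second and `ħ
≤ 1` the third, and only powers of `x` remain. -/
theorem isSymbolFamily_of_temperate {T : (E d × E d) × ℝ → ℂ} (hT : HasTemperateGrowth T)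
    {B : Set (E d)} (hB : IsCompact B) (h0 : ∀ z s, z.2 ∉ B → T (z, s) = 0) :
    IsSymbolFamily fun ħ z => T (z, 2 * π * ħ) := by
  refine ⟨fun ħ _ _ => hT.1.comp (by fun_prop), fun k => ?_⟩
  obtain ⟨R, hR⟩ := hB.isBounded.exists_norm_le
  obtain ⟨C, M, hC, h⟩ := exists_slice_bound hT R k
  refine ⟨C, M, fun ħ hħ hħ' z => ?_⟩
  by_cases hz : z.2 ∈ B
  · exact h ħ hħ hħ' z (hR _ hz)
  · have e := iteratedFDeriv_eq_of_eqOn (f := fun z => T (z, 2 * π * ħ)) (g := fun _ => 0)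
      (hB.isClosed.isOpen_compl.preimage continuous_snd) (fun z hz => h0 z _ hz) (z := z) hz k
    rw [e, iteratedFDeriv_fun_zero]
    simp only [Pi.zero_apply, norm_zero]
    positivity

/-- The difference equals `(2πħ)² F` with `F` temperate. Since this holds for `ξ` in an open set
`U`, it can be differentiated at points over `K`. -/
theorem eqUpToSq_of_even {T : (E d × E d) × ℝ → ℂ} (hT : HasTemperateGrowth T)
    (heven : ∀ z s, T (z, -s) = T (z, s)) {t₀ : E d × E d → ℂ} {K U : Set (E d)}
    (hK : IsCompact K) (hU : IsOpen U) (hKU : K ⊆ U) (h0 : ∀ z, z.2 ∈ U → T (z, 0) = t₀ z) :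
    EqUpToSq (fun ħ z => T (z, 2 * π * ħ)) t₀ K := by
  obtain ⟨F, hF, hTF⟩ := exists_temperate_sq_factor hT heven
  intro k
  obtain ⟨R, hR⟩ := hK.isBounded.exists_norm_le
  obtain ⟨C, M, hC, h⟩ := exists_slice_bound hF R k
  refine ⟨(2 * π) ^ 2 * C, M, fun ħ hħ hħ' x ξ hξ => ?_⟩
  have e := iteratedFDeriv_eq_of_eqOn (f := fun z => T (z, 2 * π * ħ) - t₀ z)
    (g := fun z => ((2 * π * ħ) ^ 2 : ℝ) • F (z, 2 * π * ħ)) (hU.preimage continuous_snd)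
    (fun z hz => by simp only [← hTF, h0 z hz]) (z := (x, ξ)) (hKU hξ) k
  have hs : ContDiff ℝ k fun z => F (z, 2 * π * ħ) :=
    (hF.1.comp (by fun_prop : ContDiff ℝ ∞ fun z : E d × E d => (z, 2 * π * ħ))).of_le
      (mod_cast le_top)
  rw [e, iteratedFDeriv_const_smul_apply' hs.contDiffAt, norm_smul,
    Real.norm_of_nonneg (by positivity)]
  calc _ ≤ (2 * π * ħ) ^ 2 * (C * (1 + ‖x‖) ^ M) := by
        gcongr; exact h ħ hħ hħ' (x, ξ) (hR _ hξ)
    _ = _ := by ring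

theorem IsSymbolFamily.polyBounded {t : ℝ → E d × E d → ℂ} (ht : IsSymbolFamily t) {ħ : ℝ}
    (h0 : 0 < ħ) (h1 : ħ ≤ 1) : PolyBounded (t ħ) := by
  refine ⟨ht.1 ħ h0 h1, 0, fun n => ?_⟩
  choose C M h using ht.2
  refine ⟨∑ j ∈ Finset.range (n + 1), M j, fun j hj => ?_⟩
  refine ⟨C j, by simpa using (norm_nonneg _).trans (h j ħ h0 h1 0), fun z => ?_⟩
  refine (h j ħ h0 h1 z).trans ?_
  simp only [pow_zero, mul_one]
  have hC : 0 ≤ C j := by simpa using (norm_nonneg _).trans (h j ħ h0 h1 0)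
  gcongr
  · linarith [norm_nonneg z.1]
  · exact Finset.single_le_sum (f := M) (fun _ _ => Nat.zero_le _)
      (Finset.mem_range.2 (by omega))

end Families

/-! ### The kernel of the conjugated symbol -/

section Kernel

open Set Topology

variable {d : ℕ} {Z : Type} [NormedAddCommGroup Z] [NormedSpace ℝ Z] {Q : E d × E d → ℂ} {N : ℕ}
  {H : E d × (Z × E d) → ℂ}

/-- A superposition at `z` sees only the slice of `H` at `z`, because `bessel` differentiates in `k`
alone. -/
theorem superpose_congr {Z' : Type} [NormedAddCommGroup Z'] [NormedSpace ℝ Z']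
    {H' : E d × (Z' × E d) → ℂ} (hH : HasTemperateGrowth H) (hH' : HasTemperateGrowth H')
    {z : Z} {z' : Z'} (h : ∀ k l, H (k, (z, l)) = H' (k, (z', l))) :
    superpose Q N H z = superpose Q N H' z' := by
  rw [superpose, superpose]
  refine integral_congr_ae (Filter.Eventually.of_forall fun κ => ?_)
  have e := congrFun (bessel_iterate_slice N hH (z, κ.2)) κ.1
  have e' := congrFun (bessel_iterate_slice N hH' (z', κ.2)) κ.1
  simp only [h] at e e' ⊢
  rw [← e, ← e']

theorem superpose_eq_zero (hH : HasTemperateGrowth H) {z : Z}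
    (h : ∀ k l, H (k, (z, l)) = 0) : superpose Q N H z = 0 := by
  rw [superpose_eq_of_wave hH (a := 0) (y := 0) (η := 0) fun k l => by rw [h, zero_mul], zero_mul]

/-- The kernel whose superposition is the symbol of the conjugated operator. -/
def symbolKernel (c : E d × E d → ℝ) (m : E d × E d → E d) (B : E d × E d → E d →L[ℝ] E d)
    (D : E d × E d → E d →L[ℝ] ℝ) (v : E d × (((E d × E d) × ℝ) × E d)) : ℂ :=
  c (v.2.1.1.2, v.2.1.2 • v.1) * wave (inner ℝ v.2.2 (m (v.2.1.1.2, v.2.1.2 • v.1)) +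
    inner ℝ v.2.1.1.1 (B (v.2.1.1.2, v.2.1.2 • v.1) v.1) - D (v.2.1.1.2, v.2.1.2 • v.1) v.1)

theorem temperate_symbolKernel {c : E d × E d → ℝ} {m : E d × E d → E d}
    {B : E d × E d → E d →L[ℝ] E d} {D : E d × E d → E d →L[ℝ] ℝ} (hc : HasTemperateGrowth c)
    (hm : HasTemperateGrowth m) (hB : HasTemperateGrowth B) (hD : HasTemperateGrowth D) :
    HasTemperateGrowth (symbolKernel c m B D) := by
  have e : HasTemperateGrowth fun v : E d × (((E d × E d) × ℝ) × E d) =>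
      (v.2.1.1.2, v.2.1.2 • v.1) := by fun_prop
  have hc' := hc.comp e
  have hm' := hm.comp e
  have hB' := hB.comp e
  have hD' := hD.comp e
  simp only [Function.comp_def] at hc' hm' hB' hD'
  unfold symbolKernel
  fun_prop

end Kernel

/-! ### The symbol `t_ħ`: smoothness, evenness and value at `ħ = 0` -/

section Symbol

open Set Topology

variable {d : ℕ} {g : E d → E d} {S J χ : E d → ℝ} {w : E d × E d → E d} {K V : Set (E d)}
  {B : E d × E d → E d →L[ℝ] E d} {D : E d × E d → E d →L[ℝ] ℝ}
  {Q : E d × E d → ℂ} {N : ℕ}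

namespace PhaseData

theorem temperate_w (h : PhaseData g S J w K V) : HasTemperateGrowth w :=
  hasTemperateGrowth_of_hasCompactSupport h.w_smooth h.w_supp

theorem temperate_g (h : PhaseData g S J w K V) : HasTemperateGrowth g :=
  hasTemperateGrowth_of_hasCompactSupport h.g_smooth h.g_supp

theorem temperate_S (h : PhaseData g S J w K V) : HasTemperateGrowth S :=
  hasTemperateGrowth_of_hasCompactSupport h.S_smooth h.S_supp

theorem temperate_chord_ends (h : PhaseData g S J w K V) :
    HasTemperateGrowth (fun z : E d × E d => z.1 + (2⁻¹ : ℝ) • w z) ∧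
      HasTemperateGrowth (fun z : E d × E d => z.1 - (2⁻¹ : ℝ) • w z) := by
  have := h.temperate_w
  constructor <;> fun_prop

theorem temperate_midMap (h : PhaseData g S J w K V) : HasTemperateGrowth (midMap g w) := by
  have h1 := h.temperate_g.comp h.temperate_chord_ends.1
  have h2 := h.temperate_g.comp h.temperate_chord_ends.2
  simp only [Function.comp_def] at h1 h2
  exact (HasTemperateGrowth.const (2⁻¹ : ℝ)).smul (h1.add h2)

theorem temperate_phaseDiff (h : PhaseData g S J w K V) :
    HasTemperateGrowth (phaseDiff S w) :=
  (h.temperate_S.comp h.temperate_chord_ends.1).sub (h.temperate_S.comp h.temperate_chord_ends.2)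

theorem temperate_amplitude (h : PhaseData g S J w K V) (hχ : ContDiff ℝ ∞ χ)
    (hχc : HasCompactSupport χ) : HasTemperateGrowth (amplitude g J w χ) :=
  hasTemperateGrowth_of_hasCompactSupport (h.amplitude_smooth hχ) (h.amplitude_supp hχc)

/-- Division of the chord and of the difference of phases by the direction of the chord. -/
theorem exists_factors (h : PhaseData g S J w K V) :
    ∃ (B : E d × E d → E d →L[ℝ] E d) (D : E d × E d → E d →L[ℝ] ℝ),
      HasTemperateGrowth B ∧ HasTemperateGrowth D ∧ (∀ θ κ, w (θ, κ) = B (θ, κ) κ) ∧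
      (∀ θ κ, phaseDiff S w (θ, κ) = D (θ, κ) κ) ∧
      (∀ θ, HasFDerivAt (fun κ => w (θ, κ)) (B (θ, 0)) 0) ∧
      ∀ θ, D (θ, 0) = (fderiv ℝ S θ).comp (B (θ, 0)) := by
  obtain ⟨B, hB, hB1, hB2⟩ := exists_temperate_factor h.temperate_w h.w_zero
  obtain ⟨D, hD, hD1, hD2⟩ := exists_temperate_factor h.temperate_phaseDiff fun θ => by
    simp [phaseDiff, h.w_zero]
  have hBd : ∀ θ, HasFDerivAt (fun κ => w (θ, κ)) (B (θ, 0)) 0 := fun θ => by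
    rw [hB2]
    have : ContDiff ℝ ∞ fun κ => w (θ, κ) := h.w_smooth.comp (by fun_prop)
    exact (this.differentiable (by simp)).differentiableAt.hasFDerivAt
  refine ⟨B, D, hB, hD, hB1, hD1, hBd, fun θ => ?_⟩
  rw [hD2]
  have hSd : ∀ x, HasFDerivAt S (fderiv ℝ S x) x := fun x =>
    (h.S_smooth.differentiable (by simp)).differentiableAt.hasFDerivAt
  have h1 : HasFDerivAt (fun κ => θ + (2⁻¹ : ℝ) • w (θ, κ)) ((2⁻¹ : ℝ) • B (θ, 0)) 0 :=
    ((hBd θ).const_smul (2⁻¹ : ℝ)).const_add θ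
  have h2 : HasFDerivAt (fun κ => θ - (2⁻¹ : ℝ) • w (θ, κ)) (-((2⁻¹ : ℝ) • B (θ, 0))) 0 :=
    ((hBd θ).const_smul (2⁻¹ : ℝ)).const_sub θ
  have e1 : θ + (2⁻¹ : ℝ) • w (θ, 0) = θ := by rw [h.w_zero]; simp
  have e2 : θ - (2⁻¹ : ℝ) • w (θ, 0) = θ := by rw [h.w_zero]; simp
  have h3 : HasFDerivAt (fun κ => phaseDiff S w (θ, κ)) _ 0 :=
    (HasFDerivAt.comp 0 (hSd (θ + (2⁻¹ : ℝ) • w (θ, 0))) h1).sub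
      (HasFDerivAt.comp 0 (hSd (θ - (2⁻¹ : ℝ) • w (θ, 0))) h2)
  rw [h3.fderiv, e1, e2]
  ext κ
  simp only [sub_apply, ContinuousLinearMap.comp_apply, neg_apply, smul_apply, map_neg, map_smul,
    sub_neg_eq_add, smul_eq_mul]
  ring

/-- Near `K`, the differential of the chord in its direction is the inverse of that of `g`. -/
theorem exists_inverse_fderiv (h : PhaseData g S J w K V)
    (hB : ∀ θ, HasFDerivAt (fun κ => w (θ, κ)) (B (θ, 0)) 0) :
    ∃ U, IsOpen U ∧ K ⊆ U ∧ U ⊆ V ∧ ∀ θ ∈ U,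
      (fderiv ℝ g θ).comp (B (θ, 0)) = ContinuousLinearMap.id ℝ (E d) ∧
      (B (θ, 0)).comp (fderiv ℝ g θ) = ContinuousLinearMap.id ℝ (E d) := by
  obtain ⟨N, hN, hKN, h1⟩ := h.chord_right
  refine ⟨V ∩ (fun θ => (θ, (0 : E d))) ⁻¹' N, h.isOpen.inter (hN.preimage (by fun_prop)),
    fun θ hθ => ⟨h.subset hθ, hKN ⟨hθ, rfl⟩⟩, inter_subset_left, fun θ hθ => ?_⟩
  -- The chord equation holds for all `κ` near `0`; its derivative at `κ = 0` reads `dg(θ) ∘ B(θ, 0)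
  -- = id`.
  have e : (fun κ => g (θ + (2⁻¹ : ℝ) • w (θ, κ)) - g (θ - (2⁻¹ : ℝ) • w (θ, κ))) =ᶠ[𝓝 0] id := by
    have : ∀ᶠ κ in 𝓝 (0 : E d), (θ, κ) ∈ N :=
      (by fun_prop : Continuous fun κ : E d => (θ, κ)).continuousAt.eventually_mem
        (hN.mem_nhds hθ.2)
    filter_upwards [this] with κ hκ
    exact congrArg Prod.snd (h1 _ hκ)
  have hgd : ∀ x, HasFDerivAt g (fderiv ℝ g x) x := fun x =>
    (h.g_smooth.differentiable (by simp)).differentiableAt.hasFDerivAt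
  have h3 : HasFDerivAt (fun κ => θ + (2⁻¹ : ℝ) • w (θ, κ)) ((2⁻¹ : ℝ) • B (θ, 0)) 0 :=
    ((hB θ).const_smul (2⁻¹ : ℝ)).const_add θ
  have h2 : HasFDerivAt (fun κ => θ - (2⁻¹ : ℝ) • w (θ, κ)) (-((2⁻¹ : ℝ) • B (θ, 0))) 0 :=
    ((hB θ).const_smul (2⁻¹ : ℝ)).const_sub θ
  have e1 : θ + (2⁻¹ : ℝ) • w (θ, 0) = θ := by rw [h.w_zero]; simp
  have e2 : θ - (2⁻¹ : ℝ) • w (θ, 0) = θ := by rw [h.w_zero]; simp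
  have h4 := (HasFDerivAt.comp 0 (hgd (θ + (2⁻¹ : ℝ) • w (θ, 0))) h3).sub
    (HasFDerivAt.comp 0 (hgd (θ - (2⁻¹ : ℝ) • w (θ, 0))) h2)
  have h5 := ((hasFDerivAt_id (𝕜 := ℝ) (0 : E d)).congr_of_eventuallyEq e).unique h4
  rw [e1, e2] at h5
  have h6 : (fderiv ℝ g θ).comp (B (θ, 0)) = ContinuousLinearMap.id ℝ (E d) := by
    rw [h5]
    ext1 κ
    simp only [sub_apply, ContinuousLinearMap.comp_apply, neg_apply, smul_apply, map_neg, map_smul,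
      sub_neg_eq_add]
    exact (half_add_half _).symm
  refine ⟨h6, ?_⟩
  ext1 κ
  have h7 := injective_of_det_ne_zero (h.det_ne θ hθ.1) (B (θ, 0) (fderiv ℝ g θ κ) - κ) (by
    rw [map_sub, sub_eq_zero]
    exact congrArg (fun A : E d →L[ℝ] E d => A (fderiv ℝ g θ κ)) h6)
  exact sub_eq_zero.1 h7

/-- The symbol of the conjugated operator, as a function of phase space and of `2πħ`. -/
def _root_.TiltedHologram.symbolOf (g : E d → E d) (J : E d → ℝ) (w : E d × E d → E d)
    (χ : E d → ℝ) (B : E d × E d → E d →L[ℝ] E d) (D : E d × E d → E d →L[ℝ] ℝ)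
    (Q : E d × E d → ℂ) (N : ℕ) (z : (E d × E d) × ℝ) : ℂ :=
  superpose Q N (symbolKernel (amplitude g J w χ) (midMap g w) B D) z

theorem temperate_kernel (h : PhaseData g S J w K V) (hχ : ContDiff ℝ ∞ χ) (hχc : HasCompactSupport χ)
    (hB : HasTemperateGrowth B) (hD : HasTemperateGrowth D) :
    HasTemperateGrowth (symbolKernel (amplitude g J w χ) (midMap g w) B D) :=
  temperate_symbolKernel (h.temperate_amplitude hχ hχc) h.temperate_midMap hB hD

theorem temperate_symbolOf (h : PhaseData g S J w K V) (hχ : ContDiff ℝ ∞ χ) (hχc : HasCompactSupport χ)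
    (hB : HasTemperateGrowth B) (hD : HasTemperateGrowth D)
    (hQ : Rapid volume Q) : HasTemperateGrowth (symbolOf g J w χ B D Q N) :=
  temperate_superpose hQ (h.temperate_kernel hχ hχc hB hD)

theorem symbolOf_eq_zero (h : PhaseData g S J w K V) (hχ : ContDiff ℝ ∞ χ) (hχc : HasCompactSupport χ)
    (hB : HasTemperateGrowth B) (hD : HasTemperateGrowth D)
    (z : E d × E d) (s : ℝ) (hz : z.2 ∉ tsupport J) :
    symbolOf g J w χ B D Q N (z, s) = 0 := by
  refine superpose_eq_zero (h.temperate_kernel hχ hχc hB hD) fun k l => ?_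
  have : amplitude g J w χ (z.2, s • k) = 0 := by
    by_contra h0
    exact hz (amplitude_ne_zero h0).1
  simp [symbolKernel, this]

/-- This is why the subprincipal term vanishes. The middle point and the amplitude are even in `κ`;
the chord and the phase difference are odd, so that their quotients by `s` along `κ = s k`, which
are `B k` and `D k`, are even in `s`. -/
theorem symbolOf_neg (h : PhaseData g S J w K V) (hχ : ContDiff ℝ ∞ χ) (hχc : HasCompactSupport χ)
    (hB : HasTemperateGrowth B) (hD : HasTemperateGrowth D)
    (hχe : ∀ κ, χ (-κ) = χ κ) (hB1 : ∀ θ κ, w (θ, κ) = B (θ, κ) κ)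
    (hD1 : ∀ θ κ, phaseDiff S w (θ, κ) = D (θ, κ) κ) (z : E d × E d) (s : ℝ) :
    symbolOf g J w χ B D Q N (z, -s) = symbolOf g J w χ B D Q N (z, s) := by
  have hk := h.temperate_kernel hχ hχc hB hD
  refine superpose_congr hk hk fun k l => ?_
  rcases eq_or_ne s 0 with rfl | hs
  · rw [neg_zero]
  have e1 : B (z.2, -(s • k)) k = B (z.2, s • k) k := by
    have h1 := hB1 z.2 (-(s • k))
    rw [h.w_odd, hB1, map_neg, neg_inj, map_smul, map_smul] at h1
    exact (smul_right_injective _ hs h1).symm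
  have e2 : D (z.2, -(s • k)) k = D (z.2, s • k) k := by
    have h1 := hD1 z.2 (-(s • k))
    rw [h.phaseDiff_neg, hD1, map_neg, neg_inj, map_smul, map_smul] at h1
    exact (smul_right_injective _ hs h1).symm
  simp only [symbolKernel, neg_smul, e1, e2, h.midMap_neg, h.amplitude_neg hχe]

/-- At `s = 0` the exponent is `⟨l, g(θ)⟩ + ⟨x, dg⁻¹k⟩ - dS(dg⁻¹k)`. Moving `dg⁻¹` to the other side
of the scalar product shows the plane wave at the point `(y, g(θ))` given by the canonical
transformation. -/
theorem symbolOf_zero (h : PhaseData g S J w K V) (hχ : ContDiff ℝ ∞ χ) (hχc : HasCompactSupport χ)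
    (hB : HasTemperateGrowth B) (hD : HasTemperateGrowth D)
    (hχ0 : χ 0 = 1) {θ : E d} (hθ : θ ∈ V)
    (hDB : D (θ, 0) = (fderiv ℝ S θ).comp (B (θ, 0)))
    (h1 : (fderiv ℝ g θ).comp (B (θ, 0)) = ContinuousLinearMap.id ℝ (E d))
    (h2 : (B (θ, 0)).comp (fderiv ℝ g θ) = ContinuousLinearMap.id ℝ (E d)) (x : E d) :
    ∀ y, y = (ContinuousLinearMap.adjoint (fderiv ℝ g θ)).inverse (x - gradient S θ) →
      symbolOf g J w χ B D Q N ((x, θ), 0) = J θ * (((1 + ‖y‖ ^ 2 : ℝ) : ℂ) ^ N *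
        ∫ κ, Q κ * wave (inner ℝ κ.1 y + inner ℝ κ.2 (g θ))) := by
  rintro y rfl
  refine superpose_eq_of_wave (h.temperate_kernel hχ hχc hB hD) fun k l => ?_
  have hadj : (ContinuousLinearMap.adjoint (fderiv ℝ g θ)).inverse =
      ContinuousLinearMap.adjoint (B (θ, 0)) := by
    refine ContinuousLinearMap.inverse_eq ?_ ?_
    · rw [← ContinuousLinearMap.adjoint_comp, h2, ContinuousLinearMap.adjoint_id]
    · rw [← ContinuousLinearMap.adjoint_comp, h1, ContinuousLinearMap.adjoint_id]
  have hgrad : ∀ v, fderiv ℝ S θ v = inner ℝ (gradient S θ) v := fun v => by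
    rw [gradient, InnerProductSpace.toDual_symm_apply]
  simp only [symbolKernel, zero_smul, h.amplitude_zero hχ0 hθ, h.midMap_zero, hDB, hadj,
    ContinuousLinearMap.comp_apply, hgrad, ContinuousLinearMap.adjoint_inner_right, inner_sub_right]
  congr 2
  rw [real_inner_comm x, real_inner_comm (gradient S θ)]
  ring

end PhaseData

end Symbol

/-! ### Bounds uniform in the functions `ψ` and `φ` -/

section Bounds

variable {d : ℕ}

theorem integrable_weighted_sq (M : ℕ) (ψ : 𝓢(E d, ℂ)) :
    Integrable fun x => ((1 + ‖x‖) ^ M * ‖ψ x‖) ^ 2 := by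
  obtain ⟨C₀, h0⟩ := ψ.decay 0 0
  have hr := rapid_schwartz (μ := volume) ψ
  refine ((hr.int (2 * M)).const_mul C₀).mono' ?_ (Filter.Eventually.of_forall fun x => ?_)
  · have := ψ.continuous
    exact (by fun_prop : Continuous fun x => ((1 + ‖x‖) ^ M * ‖ψ x‖) ^ 2).aestronglyMeasurable
  · have h1 : ‖ψ x‖ ≤ C₀ := by simpa using h0.2 x
    rw [Real.norm_of_nonneg (by positivity)]
    calc ((1 + ‖x‖) ^ M * ‖ψ x‖) ^ 2 = ‖ψ x‖ * ((1 + ‖x‖) ^ (2 * M) * ‖ψ x‖) := by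
          rw [mul_pow, ← pow_mul, mul_comm M]; ring
      _ ≤ _ := by gcongr

theorem weightedNorm_mono {M M' : ℕ} (h : M ≤ M') (ψ : 𝓢(E d, ℂ)) :
    weightedNorm M ψ ≤ weightedNorm M' ψ := by
  refine Real.sqrt_le_sqrt (integral_mono (integrable_weighted_sq M ψ)
    (integrable_weighted_sq M' ψ) fun x => ?_)
  simp only
  gcongr
  linarith [norm_nonneg x]

theorem weightedNorm_nonneg (M : ℕ) (ψ : E d → ℂ) : 0 ≤ weightedNorm M ψ := Real.sqrt_nonneg _

/-- Cauchy–Schwarz, with `(1 + ‖x‖)^{-(d+1)}` as the square-integrable factor. -/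
theorem exists_moment_le (d n : ℕ) : ∃ C, 0 ≤ C ∧ ∀ ψ : 𝓢(E d, ℂ),
    ∫ x, (1 + ‖x‖) ^ n * ‖ψ x‖ ≤ C * weightedNorm (n + d + 1) ψ := by
  have hi : Integrable fun x : E d => (((1 + ‖x‖) ^ (d + 1))⁻¹) ^ 2 := by
    have h0 := integrable_one_add_norm (E := E d) (μ := volume) (r := (2 * (d + 1) : ℕ)) (by
      rw [finrank_euclideanSpace_fin]; exact_mod_cast (by omega))
    refine h0.congr (Filter.Eventually.of_forall fun x => ?_)
    simp only
    rw [Real.rpow_neg (by positivity), Real.rpow_natCast, inv_pow, ← pow_mul, mul_comm 2]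
  refine ⟨√(∫ x : E d, (((1 + ‖x‖) ^ (d + 1))⁻¹) ^ 2), Real.sqrt_nonneg _, fun ψ => ?_⟩
  have hc : Continuous fun x : E d => ((1 + ‖x‖) ^ (d + 1))⁻¹ :=
    Continuous.inv₀ (by fun_prop) fun x => by positivity
  have hψ := ψ.continuous
  have h := integral_mul_le_Lp_mul_Lq_of_nonneg (μ := volume) Real.HolderConjugate.two_two
    (f := fun x : E d => ((1 + ‖x‖) ^ (d + 1))⁻¹) (g := fun x => (1 + ‖x‖) ^ (n + d + 1) * ‖ψ x‖)
    (Filter.Eventually.of_forall fun x => by positivity)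
    (Filter.Eventually.of_forall fun x => by positivity)
    (by
      rw [ENNReal.ofReal_ofNat]
      exact (memLp_two_iff_integrable_sq hc.aestronglyMeasurable).2 hi)
    (by
      rw [ENNReal.ofReal_ofNat]
      exact (memLp_two_iff_integrable_sq (by fun_prop :
        Continuous fun x => (1 + ‖x‖) ^ (n + d + 1) * ‖ψ x‖).aestronglyMeasurable).2
          (integrable_weighted_sq _ ψ))
  simp only [Real.rpow_ofNat, ← Real.sqrt_eq_rpow] at h
  refine le_of_eq_of_le (integral_congr_ae (Filter.Eventually.of_forall fun x => ?_)) h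
  simp only
  rw [show n + d + 1 = n + (d + 1) by ring, pow_add]
  have : (1 + ‖x‖) ^ (d + 1) ≠ 0 := by positivity
  field_simp
  ring

/-- All derivatives fall on `F`; the density enters only through a moment, and `C` and `M` do not
depend on it. This makes the final estimate uniform in `ψ` and `φ`. -/
theorem exists_bessel_bound {P Y : Type} [NormedAddCommGroup P] [NormedSpace ℝ P]
    [NormedAddCommGroup Y] [NormedSpace ℝ Y] [MeasurableSpace Y] [OpensMeasurableSpace Y]
    [SecondCountableTopology Y] (μ : Measure Y) {F : E d × (P × Y) → ℂ}
    (hF : HasTemperateGrowth F) (N : ℕ) :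
    ∃ (C : ℝ) (M : ℕ), 0 ≤ C ∧ ∀ q : Y → ℂ, Rapid μ q →
      (Continuous fun z : E d × P => bessel^[N] (fun k => ∫ y, q y * F (k, (z.2, y)) ∂μ) z.1) ∧
      ∀ k p, ‖bessel^[N] (fun k => ∫ y, q y * F (k, (p, y)) ∂μ) k‖ ≤
        C * (∫ y, (1 + ‖y‖) ^ M * ‖q y‖ ∂μ) * (1 + ‖(k, p)‖) ^ M := by
  have hF' : HasTemperateGrowth fun w : (E d × P) × Y => besselFst^[N] F (w.1.1, (w.1.2, w.2)) :=
    (temperate_besselFst_iterate N hF).comp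
      (f := fun w : (E d × P) × Y => (w.1.1, (w.1.2, w.2))) (by fun_prop)
  obtain ⟨M, C, hC, h⟩ := hF'.bound
  have key : ∀ q : Y → ℂ, Rapid μ q → ∀ k p, bessel^[N] (fun k => ∫ y, q y * F (k, (p, y)) ∂μ) k =
      ∫ y, q y • besselFst^[N] F (k, (p, y)) ∂μ := by
    intro q hq k p
    have hs : HasTemperateGrowth (fun w : E d × Y => F (w.1, (p, w.2))) :=
      hF.comp (f := fun w : E d × Y => (w.1, (p, w.2))) (by fun_prop)
    have e2 := congrFun (bessel_iterate_integral hq N hs) k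
    simp only at e2
    rw [e2]
    refine integral_congr_ae (Filter.Eventually.of_forall fun y => ?_)
    have e3 := congrFun (bessel_iterate_slice N hs y) k
    have e4 := congrFun (bessel_iterate_slice N hF (p, y)) k
    simp only at e3 e4 ⊢
    rw [← e3, e4, smul_eq_mul]
  refine ⟨C, M, hC, fun q hq => ⟨?_, fun k p => ?_⟩⟩
  · simp only [key q hq]
    exact (hq.temperate_integral hF').1.continuous
  · rw [key q hq]
    exact hq.norm_integral_le h hC (k, p)

/-- The density `ρ(θ) ψ(x) conj (φ(x'))`. -/
def tripleDensity (ρ : E d → ℝ) (ψ φ : E d → ℂ) (y : E d × (E d × E d)) : ℂ :=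
  (ρ y.1 : ℂ) * (ψ y.2.1 * (starRingEnd ℂ) (φ y.2.2))

variable {ρ : E d → ℝ}

theorem rapid_cutoff (hρ : ContDiff ℝ ∞ ρ) (hρc : HasCompactSupport ρ) :
    Rapid volume fun θ => (ρ θ : ℂ) := by
  have h1 : ContDiff ℝ ∞ fun θ => (ρ θ : ℂ) := Complex.ofRealCLM.contDiff.comp hρ
  have h2 : HasCompactSupport fun θ => (ρ θ : ℂ) := hρc.comp_left Complex.ofReal_zero
  exact rapid_schwartz (μ := volume) (h2.toSchwartzMap h1)

theorem rapid_tripleDensity (hρ : ContDiff ℝ ∞ ρ) (hρc : HasCompactSupport ρ) (ψ φ : 𝓢(E d, ℂ)) :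
    Rapid volume (tripleDensity ρ ψ φ) :=
  (rapid_cutoff hρ hρc).prod ((rapid_schwartz (μ := volume) ψ).prod (rapid_conj_schwartz φ))

theorem exists_tripleDensity_le (hρ : ContDiff ℝ ∞ ρ) (hρc : HasCompactSupport ρ) (M : ℕ) :
    ∃ C, 0 ≤ C ∧ ∀ ψ φ : 𝓢(E d, ℂ), ∫ y, (1 + ‖y‖) ^ M * ‖tripleDensity ρ ψ φ y‖ ≤
      C * (weightedNorm (M + d + 1) ψ * weightedNorm (M + d + 1) φ) := by
  obtain ⟨C, hC, h⟩ := exists_moment_le d M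
  set I := ∫ θ, (1 + ‖θ‖) ^ M * ‖(ρ θ : ℂ)‖ with hI
  have hI0 : 0 ≤ I := integral_nonneg fun θ => by positivity
  refine ⟨I * (C * C), by positivity, fun ψ φ => ?_⟩
  have h1 := (rapid_cutoff hρ hρc).int M
  have h2 := (rapid_schwartz (μ := volume) ψ).int M
  have h3 := (rapid_schwartz (μ := volume) φ).int M
  have hprod := h1.mul_prod (h2.mul_prod h3)
  have hle : ∀ y : E d × (E d × E d), (1 + ‖y‖) ^ M * ‖tripleDensity ρ ψ φ y‖ ≤
      ((1 + ‖y.1‖) ^ M * ‖(ρ y.1 : ℂ)‖) *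
        (((1 + ‖y.2.1‖) ^ M * ‖ψ y.2.1‖) * ((1 + ‖y.2.2‖) ^ M * ‖φ y.2.2‖)) := fun y => by
    have e1 := one_add_norm_prod_le y.1 y.2
    have e2 := one_add_norm_prod_le y.2.1 y.2.2
    calc _ ≤ ((1 + ‖y.1‖) * ((1 + ‖y.2.1‖) * (1 + ‖y.2.2‖))) ^ M * ‖tripleDensity ρ ψ φ y‖ := by
          gcongr
          exact e1.trans (by gcongr)
      _ = _ := by
          rw [tripleDensity, norm_mul, norm_mul, RCLike.norm_conj, mul_pow, mul_pow]; ring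
  calc _ ≤ ∫ y : E d × (E d × E d), ((1 + ‖y.1‖) ^ M * ‖(ρ y.1 : ℂ)‖) *
        (((1 + ‖y.2.1‖) ^ M * ‖ψ y.2.1‖) * ((1 + ‖y.2.2‖) ^ M * ‖φ y.2.2‖)) :=
        integral_mono ((rapid_tripleDensity hρ hρc ψ φ).int M) hprod hle
    _ = I * ((∫ x, (1 + ‖x‖) ^ M * ‖ψ x‖) * ∫ x, (1 + ‖x‖) ^ M * ‖φ x‖) := by
        rw [Measure.volume_eq_prod, integral_prod_mul (μ := volume) (ν := volume)
          (fun θ => (1 + ‖θ‖) ^ M * ‖(ρ θ : ℂ)‖)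
          (fun z : E d × E d => ((1 + ‖z.1‖) ^ M * ‖ψ z.1‖) * ((1 + ‖z.2‖) ^ M * ‖φ z.2‖)),
          Measure.volume_eq_prod, integral_prod_mul (μ := volume) (ν := volume)
          (fun x => (1 + ‖x‖) ^ M * ‖ψ x‖) (fun x => (1 + ‖x‖) ^ M * ‖φ x‖)]
    _ ≤ I * ((C * weightedNorm (M + d + 1) ψ) * (C * weightedNorm (M + d + 1) φ)) := by
        have := weightedNorm_nonneg (M + d + 1) ψ
        have h4 : 0 ≤ ∫ x, (1 + ‖x‖) ^ M * ‖φ x‖ := integral_nonneg fun x => by positivity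
        gcongr
        · exact h ψ
        · exact h φ
    _ = _ := by ring

/-- Writing out both Fourier transforms removes `k` from the arguments of `ψ̂` and `φ̂`: it stays in
the amplitude and the phases only, where `bessel` can act without derivatives of `ψ` and `φ`. The
cutoff `ρ`, which is `1` where `a` does not vanish, provides the decay in `θ`. -/
theorem integral_fourierH_mul (hρ : ContDiff ℝ ∞ ρ) (hρc : HasCompactSupport ρ) {ħ : ℝ}
    (ψ φ : 𝓢(E d, ℂ)) {a : E d → ℂ} {α β : E d → E d} (ha : Continuous a) (hα : Continuous α)
    (hβ : Continuous β) (haρ : ∀ θ, a θ ≠ 0 → ρ θ = 1) {C : ℝ} (hC : ∀ θ, ‖a θ‖ ≤ C) :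
    ∫ θ, a θ * (fourierH ħ ψ (α θ) * (starRingEnd ℂ) (fourierH ħ φ (β θ))) =
      ∫ y, tripleDensity ρ ψ φ y * (a y.1 * wave ((2 * π * ħ)⁻¹ *
        (inner ℝ y.2.2 (β y.1) - inner ℝ y.2.1 (α y.1)))) := by
  have hF : Continuous fun y : E d × (E d × E d) => a y.1 * wave ((2 * π * ħ)⁻¹ *
      (inner ℝ y.2.2 (β y.1) - inner ℝ y.2.1 (α y.1))) :=
    (ha.comp continuous_fst).mul (hasTemperateGrowth_wave.1.continuous.comp (by fun_prop))
  have hint := (rapid_tripleDensity hρ hρc ψ φ).integrable_of_bound hF (n := 0) (C := C)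
    fun y => by simpa [norm_wave] using hC y.1
  refine Eq.trans ?_ (integral_prod _ hint).symm
  refine integral_congr_ae (Filter.Eventually.of_forall fun θ => ?_)
  have e : ∀ z : E d × E d, tripleDensity ρ ψ φ (θ, z) • (a θ * wave ((2 * π * ħ)⁻¹ *
      (inner ℝ z.2 (β θ) - inner ℝ z.1 (α θ)))) = (ρ θ * a θ) *
      ((wave (-((2 * π * ħ)⁻¹ * inner ℝ z.1 (α θ))) * ψ z.1) *
        (starRingEnd ℂ) (wave (-((2 * π * ħ)⁻¹ * inner ℝ z.2 (β θ))) * φ z.2)) := fun z => by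
    simp only [tripleDensity, map_mul, conj_wave, neg_neg, smul_eq_mul]
    rw [mul_sub, sub_eq_add_neg, wave_add]
    ring
  have hw : ∀ (u : E d → ℂ) (ζ : E d), fourierH ħ u ζ =
      ∫ x, wave (-((2 * π * ħ)⁻¹ * inner ℝ x ζ)) * u x := fun u ζ => by
    simp only [fourierH, cexp_neg_eq_wave]
    simp only [div_eq_inv_mul]
  simp only [e]
  rw [integral_const_mul, Measure.volume_eq_prod, integral_prod_mul (μ := volume) (ν := volume)
    (fun x => wave (-((2 * π * ħ)⁻¹ * inner ℝ x (α θ))) * ψ x)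
    (fun x => (starRingEnd ℂ) (wave (-((2 * π * ħ)⁻¹ * inner ℝ x (β θ))) * φ x)), integral_conj,
    ← hw, ← hw]
  by_cases h0 : a θ = 0
  · simp [h0]
  · rw [haρ θ h0]; simp

/-- Uniform bounds for integrals of products of Fourier transforms against a temperate
amplitude. -/
theorem exists_form_bound (hρ : ContDiff ℝ ∞ ρ) (hρc : HasCompactSupport ρ)
    {a : E d × ((E d × (ℝ × ℝ)) × E d) → ℂ} {α β : E d × ((E d × (ℝ × ℝ)) × E d) → E d}
    (ha : HasTemperateGrowth a) (hα : HasTemperateGrowth α) (hβ : HasTemperateGrowth β)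
    (haρ : ∀ v, a v ≠ 0 → ρ v.2.2 = 1) (hb : ∀ k p, ∃ C, ∀ θ, ‖a (k, (p, θ))‖ ≤ C) (N : ℕ) :
    ∃ (C : ℝ) (M : ℕ), 0 ≤ C ∧ ∀ (ħ s : ℝ) (ψ φ : 𝓢(E d, ℂ)) (Z : E d → E d → ℂ),
      (∀ k l, Z k l = ∫ θ, a (k, ((l, (s, (2 * π * ħ)⁻¹)), θ)) *
        (fourierH ħ ψ (α (k, ((l, (s, (2 * π * ħ)⁻¹)), θ))) *
          (starRingEnd ℂ) (fourierH ħ φ (β (k, ((l, (s, (2 * π * ħ)⁻¹)), θ)))))) →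
      (Continuous fun κ : E d × E d => bessel^[N] (fun k => Z k κ.2) κ.1) ∧
      ∀ k l, ‖bessel^[N] (fun k => Z k l) k‖ ≤ C * (1 + ‖(k, (l, (s, (2 * π * ħ)⁻¹)))‖) ^ M *
        (weightedNorm (M + d + 1) ψ * weightedNorm (M + d + 1) φ) := by
  -- The parameters are `(l, (s, r))`, with `r` standing for `(2πħ)⁻¹`. With `r` as a variable,
  -- phases of size `1/ħ` have temperate growth, and derivatives cost only powers of `ħ⁻¹`.
  set F : E d × ((E d × (ℝ × ℝ)) × (E d × (E d × E d))) → ℂ := fun v =>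
    a (v.1, (v.2.1, v.2.2.1)) * wave (v.2.1.2.2 *
      (inner ℝ v.2.2.2.2 (β (v.1, (v.2.1, v.2.2.1))) -
        inner ℝ v.2.2.2.1 (α (v.1, (v.2.1, v.2.2.1))))) with hFdef
  have hp : HasTemperateGrowth fun v : E d × ((E d × (ℝ × ℝ)) × (E d × (E d × E d))) =>
      (v.1, (v.2.1, v.2.2.1)) := by fun_prop
  have hF : HasTemperateGrowth F := by
    have h1 := ha.comp hp
    have h2 := hα.comp hp
    have h3 := hβ.comp hp
    simp only [Function.comp_def] at h1 h2 h3
    fun_prop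
  obtain ⟨C, M, hC, h⟩ := exists_bessel_bound volume hF N
  obtain ⟨C', hC', h'⟩ := exists_tripleDensity_le hρ hρc M
  refine ⟨C * C', M, by positivity, fun ħ s ψ φ Z hZ => ?_⟩
  obtain ⟨h1, h2⟩ := h _ (rapid_tripleDensity hρ hρc ψ φ)
  have e : ∀ k l, Z k l = ∫ y, tripleDensity ρ ψ φ y * F (k, ((l, (s, (2 * π * ħ)⁻¹)), y)) := by
    intro k l
    obtain ⟨Ca, hCa⟩ := hb k (l, (s, (2 * π * ħ)⁻¹))
    rw [hZ]
    exact integral_fourierH_mul hρ hρc ψ φ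
      (a := fun θ => a (k, ((l, (s, (2 * π * ħ)⁻¹)), θ)))
      (α := fun θ => α (k, ((l, (s, (2 * π * ħ)⁻¹)), θ)))
      (β := fun θ => β (k, ((l, (s, (2 * π * ħ)⁻¹)), θ)))
      (ha.1.continuous.comp (by fun_prop)) (hα.1.continuous.comp (by fun_prop))
      (hβ.1.continuous.comp (by fun_prop)) (fun θ => haρ _) hCa
  simp only [e]
  refine ⟨h1.comp (f := fun κ : E d × E d => (κ.1, (κ.2, (s, (2 * π * ħ)⁻¹)))) (by fun_prop),
    fun k l => (h2 _ _).trans ?_⟩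
  calc _ ≤ C * (C' * (weightedNorm (M + d + 1) ψ * weightedNorm (M + d + 1) φ)) *
        (1 + ‖(k, (l, (s, (2 * π * ħ)⁻¹)))‖) ^ M := by gcongr; exact h' ψ φ
    _ = _ := by ring

end Bounds

/-! ### Large covectors contribute `O(ħ^∞)` -/

section Remainder

variable {d : ℕ} {Q : E d × E d → ℂ} {N : ℕ}

theorem one_add_norm_param_le {ħ : ℝ} (h0 : 0 < ħ) (h1 : ħ ≤ 1) (k l : E d) :
    1 + ‖(k, (l, (2 * π * ħ, (2 * π * ħ)⁻¹)))‖ ≤ (1 + ‖(k, l)‖) * ((2 + 2 * π) * ħ⁻¹) := by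
  have hpi := Real.pi_gt_three
  have hi : 1 ≤ ħ⁻¹ := (one_le_inv₀ h0).2 h1
  have e1 : 2 * π * ħ ≤ 2 * π * ħ⁻¹ := by gcongr; linarith
  have e2 : (2 * π * ħ)⁻¹ ≤ ħ⁻¹ := by
    rw [mul_inv]
    have : (2 * π)⁻¹ ≤ 1 := inv_le_one_of_one_le₀ (by linarith)
    calc (2 * π)⁻¹ * ħ⁻¹ ≤ 1 * ħ⁻¹ := by gcongr
      _ = _ := one_mul _
  have e3 : ‖(k, (l, (2 * π * ħ, (2 * π * ħ)⁻¹)))‖ ≤ ‖(k, l)‖ + (2 * π * ħ + (2 * π * ħ)⁻¹) := by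
    have p1 : 0 ≤ 2 * π * ħ := by positivity
    have p2 : 0 ≤ (2 * π * ħ)⁻¹ := by positivity
    have n1 := norm_fst_le (k, l)
    have n2 := norm_snd_le (k, l)
    have n3 := norm_nonneg (k, l)
    simp only [Prod.norm_def (k, (l, _)), Prod.norm_def (l, (_, _)), Prod.norm_def (2 * π * ħ, _),
      Real.norm_of_nonneg p1, Real.norm_of_nonneg p2]
    simp only at n1 n2
    refine max_le (by linarith) (max_le (by linarith) (max_le ?_ ?_)) <;> linarith
  have hn := norm_nonneg (k, l)
  have h2 : 1 ≤ (2 + 2 * π) * ħ⁻¹ := by nlinarith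
  nlinarith [mul_nonneg hn (sub_nonneg.2 h2)]

/-- Where `‖2πħk‖ < δ` the forms coincide on an open set, hence so do their `bessel` iterates.
Elsewhere `1 ≤ (2π/δ) ħ (1 + ‖κ‖)`, and the power `n + M` of this inequality gains `ħ^{n+M}`: `ħ^M`
pays for the loss `ħ^{-M}` in the bounds, and a moment of `Q` of order `n + 2M` absorbs the growth
in `κ`. -/
theorem exists_remainder_bound (hQ : Rapid volume Q) {δ : ℝ} (hδ : 0 < δ) {C : ℝ} (hC : 0 ≤ C)
    (M n : ℕ) : ∃ C', ∀ ħ : ℝ, 0 < ħ → ħ ≤ 1 → ∀ (Z₁ Z₂ : E d → E d → ℂ) (W : ℝ), 0 ≤ W →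
      (Continuous fun κ : E d × E d => bessel^[N] (fun k => Z₁ k κ.2) κ.1) →
      (Continuous fun κ : E d × E d => bessel^[N] (fun k => Z₂ k κ.2) κ.1) →
      (∀ k l, ‖bessel^[N] (fun k => Z₁ k l) k‖ ≤
        C * (1 + ‖(k, (l, (2 * π * ħ, (2 * π * ħ)⁻¹)))‖) ^ M * W) →
      (∀ k l, ‖bessel^[N] (fun k => Z₂ k l) k‖ ≤
        C * (1 + ‖(k, (l, (2 * π * ħ, (2 * π * ħ)⁻¹)))‖) ^ M * W) →
      (∀ k l, ‖(2 * π * ħ) • k‖ < δ → Z₁ k l = Z₂ k l) →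
      ‖(∫ κ, Q κ * bessel^[N] (fun k => Z₁ k κ.2) κ.1) -
        ∫ κ, Q κ * bessel^[N] (fun k => Z₂ k κ.2) κ.1‖ ≤ C' * ħ ^ n * W := by
  set c₀ : ℝ := 2 + 2 * π with hc₀
  have hpi := Real.pi_pos
  set I := ∫ κ, (1 + ‖κ‖) ^ (n + 2 * M) * ‖Q κ‖ with hI
  refine ⟨2 * C * c₀ ^ M * (2 * π / δ) ^ (n + M) * I, fun ħ h0 h1 Z₁ Z₂ W hW hc₁ hc₂ hb₁ hb₂ he => ?_⟩
  have hbound : ∀ Z : E d → E d → ℂ, (∀ k l, ‖bessel^[N] (fun k => Z k l) k‖ ≤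
        C * (1 + ‖(k, (l, (2 * π * ħ, (2 * π * ħ)⁻¹)))‖) ^ M * W) → ∀ κ : E d × E d,
      ‖bessel^[N] (fun k => Z k κ.2) κ.1‖ ≤ (C * (c₀ * ħ⁻¹) ^ M * W) * (1 + ‖κ‖) ^ M := by
    intro Z hZ κ
    refine (hZ κ.1 κ.2).trans ?_
    calc _ ≤ C * ((1 + ‖κ‖) * (c₀ * ħ⁻¹)) ^ M * W := by
          gcongr
          exact one_add_norm_param_le h0 h1 κ.1 κ.2
      _ = _ := by rw [mul_pow]; ring
  have hi₁ := hQ.integrable_of_bound hc₁ (hbound Z₁ hb₁)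
  have hi₂ := hQ.integrable_of_bound hc₂ (hbound Z₂ hb₂)
  simp only [smul_eq_mul] at hi₁ hi₂
  rw [← integral_sub hi₁ hi₂]
  refine (norm_integral_le_of_norm_le ((hQ.int (n + 2 * M)).const_mul
    (2 * C * c₀ ^ M * (2 * π / δ) ^ (n + M) * ħ ^ n * W))
    (Filter.Eventually.of_forall fun κ => ?_)).trans_eq ?_
  · rw [← mul_sub, norm_mul]
    by_cases hκ : ‖(2 * π * ħ) • κ.1‖ < δ
    · have ho : IsOpen {k : E d | ‖(2 * π * ħ) • k‖ < δ} :=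
        isOpen_lt (by fun_prop) continuous_const
      have := bessel_iterate_congr N (f := fun k => Z₁ k κ.2) (g := fun k => Z₂ k κ.2) ho
        (fun k hk => he k κ.2 hk) hκ
      rw [this, sub_self, norm_zero, mul_zero]
      have hc : 0 ≤ c₀ := by rw [hc₀]; positivity
      positivity
    · have h2 : 1 ≤ (2 * π / δ) * ħ * (1 + ‖κ‖) := by
        rw [not_lt, norm_smul, Real.norm_of_nonneg (by positivity)] at hκ
        rw [div_mul_eq_mul_div, div_mul_eq_mul_div, le_div_iff₀ hδ, one_mul]
        refine hκ.trans ?_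
        gcongr
        exact (norm_fst_le κ).trans (by linarith)
      have h3 := one_le_pow₀ h2 (n := n + M)
      have hc : 0 ≤ c₀ := by rw [hc₀]; positivity
      have h4 : ‖bessel^[N] (fun k => Z₁ k κ.2) κ.1 - bessel^[N] (fun k => Z₂ k κ.2) κ.1‖ ≤
          2 * ((C * (c₀ * ħ⁻¹) ^ M * W) * (1 + ‖κ‖) ^ M) := by
        refine (norm_sub_le _ _).trans ?_
        have := hbound Z₁ hb₁ κ
        have := hbound Z₂ hb₂ κ
        linarith
      have hħ : ħ⁻¹ ^ M * ħ ^ (n + M) = ħ ^ n := by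
        rw [pow_add, inv_pow]
        field_simp
      calc _ ≤ ‖Q κ‖ * (2 * ((C * (c₀ * ħ⁻¹) ^ M * W) * (1 + ‖κ‖) ^ M) *
            ((2 * π / δ) * ħ * (1 + ‖κ‖)) ^ (n + M)) := by
            gcongr
            exact h4.trans (le_mul_of_one_le_right (by positivity) h3)
        _ = 2 * C * c₀ ^ M * (2 * π / δ) ^ (n + M) * (ħ⁻¹ ^ M * ħ ^ (n + M)) * W *
            ((1 + ‖κ‖) ^ (n + 2 * M) * ‖Q κ‖) := by
            rw [mul_pow c₀, mul_pow (2 * π / δ * ħ), mul_pow (2 * π / δ)]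
            rw [show n + 2 * M = (n + M) + M by ring, pow_add (1 + ‖κ‖) (n + M) M]
            ring
        _ = _ := by rw [hħ]
  · rw [integral_const_mul]; ring

end Remainder

/-! ### The two forms attached to a wave and their equality -/

section Forms

open Set

variable {d : ℕ} {g : E d → E d} {S J b χ : E d → ℝ} {w : E d × E d → E d} {K V L : Set (E d)}
  {B : E d × E d → E d →L[ℝ] E d} {D : E d × E d → E d →L[ℝ] ℝ} {Γ : E d → E d}
  {Q : E d × E d → ℂ} {N : ℕ} {ħ : ℝ}

/-- The form of the conjugated operator against the wave of covector `(k, l)`. -/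
def imageForm (ħ : ℝ) (a b : E d → ℂ) (k l : E d) : ℂ :=
  ∫ ξ, wave (inner ℝ l ξ) * corr ħ a b k ξ

/-- The form of the symbol kernel of covector `(k, l)`. -/
def chordForm (c : E d × E d → ℝ) (m : E d × E d → E d) (B : E d × E d → E d →L[ℝ] E d)
    (D : E d × E d → E d →L[ℝ] ℝ) (ħ : ℝ) (a b : E d → ℂ) (k l : E d) : ℂ :=
  ∫ θ, (c (θ, (2 * π * ħ) • k) * wave (inner ℝ l (m (θ, (2 * π * ħ) • k)) -
    D (θ, (2 * π * ħ) • k) k)) * corr ħ a b (B (θ, (2 * π * ħ) • k) k) θ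

theorem pairing_weylOp_eq_imageForm (hħ : 0 < ħ) {p : E d × E d → ℂ} (hp : PolyBounded p)
    (hQ : Rapid volume Q) (u v : 𝓢(E d, ℂ)) (hu : ContDiff ℝ ∞ (fourierH ħ u))
    (hv : ContDiff ℝ ∞ (fourierH ħ v)) (hu' : HasCompactSupport (fourierH ħ u))
    (hv' : HasCompactSupport (fourierH ħ v)) {R : ℝ}
    (huR : ∀ η, fourierH ħ u η ≠ 0 → ‖η‖ ≤ R) (hvR : ∀ η, fourierH ħ v η ≠ 0 → ‖η‖ ≤ R)
    (hpQ : ∀ z : E d × E d, ‖z.2‖ ≤ R → p z = superpose Q N planeWave z) :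
    pairing (weylOp ħ p u) v =
      ∫ κ, Q κ * bessel^[N] (fun k => imageForm ħ (fourierH ħ u) (fourierH ħ v) k κ.2) κ.1 := by
  rw [pairing_weylOp_superpose (N := N) hħ hp hQ temperate_planeWave u v hu hv hu' hv'
    fun m ξ hk => ?_]
  · refine integral_congr_ae (Filter.Eventually.of_forall fun κ => ?_)
    simp only
    refine congrArg _ (congrFun (congrArg _ (funext fun k => ?_)) _)
    rw [imageForm, ← integral_fourier_slice_mul (contDiff_corr hu hv)
      (hasCompactSupport_corr hħ hu' hv') (a := fun ξ => wave (inner ℝ κ.2 ξ)) (s := fun _ => k)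
      (hasTemperateGrowth_wave.1.continuous.comp (by fun_prop)) continuous_const (C := 1)
      (fun ξ => (norm_wave _).le)]
    refine integral_congr_ae (Filter.Eventually.of_forall fun z => ?_)
    simp only [planeWave]
    rw [← wave_add, add_comm]
  · obtain ⟨k, hk⟩ := hk
    apply hpQ
    have h1 : fourierH ħ u (ξ - (π * ħ) • k) ≠ 0 := fun h0 => hk (by simp [corr, h0])
    have h2 : fourierH ħ v (ξ + (π * ħ) • k) ≠ 0 := fun h0 => hk (by simp [corr, h0])
    -- Where the correlation does not vanish, `ξ` is the middle point of two points of the ball of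
    -- radius `R`, so it lies in the ball, where the superposition represents `p`.
    have e : ξ = (2⁻¹ : ℝ) • ((ξ - (π * ħ) • k) + (ξ + (π * ħ) • k)) := by module
    have := norm_add_le (ξ - (π * ħ) • k) (ξ + (π * ħ) • k)
    have h3 := huR _ h1
    have h4 := hvR _ h2
    simp only
    rw [e, norm_smul, Real.norm_of_nonneg (by norm_num)]
    linarith

namespace PhaseData

/-- As a function of `x`, the kernel is a wave of covector `B(θ, 2πħk) k`. By
`integral_fourier_slice_mul` its matrix element is a correlation with this covector, whose arguments
`θ ∓ πħ B k` are the ends of the chord. -/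
theorem pairing_weylOp_eq_chordForm (h : PhaseData g S J w K V) (hχ : ContDiff ℝ ∞ χ)
    (hχc : HasCompactSupport χ) (hB : HasTemperateGrowth B) (hD : HasTemperateGrowth D)
    (hħ : 0 < ħ) (hQ : Rapid volume Q)
    (hp : PolyBounded fun z => symbolOf g J w χ B D Q N (z, 2 * π * ħ)) (u v : 𝓢(E d, ℂ))
    (hu' : HasCompactSupport (fourierH ħ u)) (hv' : HasCompactSupport (fourierH ħ v)) :
    pairing (weylOp ħ (fun z => symbolOf g J w χ B D Q N (z, 2 * π * ħ)) u) v =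
      ∫ κ, Q κ * bessel^[N] (fun k => chordForm (amplitude g J w χ) (midMap g w) B D ħ
        (fourierH ħ u) (fourierH ħ v) k κ.2) κ.1 := by
  have hk := h.temperate_kernel hχ hχc hB hD
  have hH : HasTemperateGrowth fun v : E d × ((E d × E d) × E d) =>
      symbolKernel (amplitude g J w χ) (midMap g w) B D (v.1, ((v.2.1, 2 * π * ħ), v.2.2)) :=
    hk.comp (f := fun v : E d × ((E d × E d) × E d) => (v.1, ((v.2.1, 2 * π * ħ), v.2.2)))
      (by fun_prop)
  have hu := contDiff_fourierH ħ u
  have hv := contDiff_fourierH ħ v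
  rw [pairing_weylOp_superpose hħ hp hQ hH u v hu hv hu' hv' fun m ξ _ =>
    superpose_congr hk hH fun k l => rfl]
  refine integral_congr_ae (Filter.Eventually.of_forall fun κ => ?_)
  simp only
  refine congrArg _ (congrFun (congrArg _ (funext fun k => ?_)) _)
  obtain ⟨C, hC⟩ := (h.amplitude_smooth hχ).continuous.bounded_above_of_compact_support
    (h.amplitude_supp hχc)
  have hcc := (h.amplitude_smooth hχ).continuous
  have hmc := h.midMap_smooth.continuous
  have hBc := hB.1.continuous
  have hDc := hD.1.continuous
  rw [chordForm, ← integral_fourier_slice_mul (contDiff_corr hu hv)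
    (hasCompactSupport_corr hħ hu' hv') (a := fun θ =>
      ((amplitude g J w χ (θ, (2 * π * ħ) • k) : ℝ) : ℂ) *
        wave (inner ℝ κ.2 (midMap g w (θ, (2 * π * ħ) • k)) - D (θ, (2 * π * ħ) • k) k))
    (s := fun θ => B (θ, (2 * π * ħ) • k) k) (C := C) ?_ (by fun_prop) ?_]
  · refine integral_congr_ae (Filter.Eventually.of_forall fun z => ?_)
    simp only [symbolKernel]
    rw [mul_assoc (Complex.ofReal _), ← wave_add, real_inner_comm z.1]
    congr 3
    ring
  · refine Continuous.mul (by fun_prop) (hasTemperateGrowth_wave.1.continuous.comp ?_)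
    fun_prop
  · intro θ
    rw [norm_mul, norm_wave, mul_one, Complex.norm_real]
    exact hC _

/-- This is `integral_chord` with `κ = 2πħk` and `r = (2πħ)⁻¹`: then `w/2 = πħ B k`, and `r` times
the phase difference is `D k`. The identity is exact, without any stationary phase expansion. -/
theorem imageForm_eq_chordForm (h : PhaseData g S J w K V) (hχ : ∀ κ, ‖κ‖ ≤ 1 → χ κ = 1)
    (hB : ∀ θ κ, w (θ, κ) = B (θ, κ) κ) (hD : ∀ θ κ, phaseDiff S w (θ, κ) = D (θ, κ) κ)
    (hL : IsCompact L) (hLK : L ⊆ K) (hinj : InjOn g L) (hΓ : ∀ η, b η ≠ 0 → g (Γ η) = η)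
    (hΓL : ∀ θ ∈ L, Γ (g θ) = θ ∧ b (g θ) = J θ) :
    ∃ δ > 0, ∀ (ħ : ℝ) (a a' : E d → ℂ) (k l : E d), 0 < ħ → (∀ θ ∉ L, a θ = 0) →
      (∀ θ ∉ L, a' θ = 0) → ‖(2 * π * ħ) • k‖ < δ →
      imageForm ħ (transport ħ S b Γ a) (transport ħ S b Γ a') k l =
        chordForm (amplitude g J w χ) (midMap g w) B D ħ a a' k l := by
  obtain ⟨δ, hδ, hc⟩ := h.integral_chord hχ hL hLK hinj
  refine ⟨δ, hδ, fun ħ a a' k l hħ ha ha' hk => ?_⟩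
  have hs : 2 * π * ħ ≠ 0 := by positivity
  have e := hc ((2 * π * ħ)⁻¹) _ _ a a'
    (fun ξ => ((2 * π * ħ : ℝ) ^ d : ℂ)⁻¹ * wave (inner ℝ l ξ)) ((2 * π * ħ) • k)
    (transport_eq_zero hΓ ha) (transport_eq_zero hΓ ha') ha ha' (transport_apply hΓL a)
    (transport_apply hΓL a') hk
  have e1 : (2⁻¹ : ℝ) • (2 * π * ħ) • k = (π * ħ) • k := by
    rw [smul_smul]; congr 1; ring
  rw [e1] at e
  refine Eq.trans (integral_congr_ae (Filter.Eventually.of_forall fun ξ => ?_)) (e.trans ?_)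
  · simp only [corr]
    ring
  refine integral_congr_ae (Filter.Eventually.of_forall fun θ => ?_)
  have e2 : (2⁻¹ : ℝ) • w (θ, (2 * π * ħ) • k) = (π * ħ) • B (θ, (2 * π * ħ) • k) k := by
    rw [hB, map_smul, smul_smul]; congr 1; ring
  have e3 : (2 * π * ħ)⁻¹ * phaseDiff S w (θ, (2 * π * ħ) • k) = D (θ, (2 * π * ħ) • k) k := by
    rw [hD, map_smul, smul_eq_mul, inv_mul_cancel_left₀ hs]
  simp only [e2, e3, corr, sub_eq_add_neg (inner ℝ l _ : ℝ), wave_add]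
  ring

end PhaseData

end Forms

/-! ### The microlocal Weyl symbol -/

section Microlocal

open Set

variable {d : ℕ} {g : E d → E d} {S J b χ : E d → ℝ} {w : E d × E d → E d} {K V L : Set (E d)}
  {B : E d × E d → E d →L[ℝ] E d} {D : E d × E d → E d →L[ℝ] ℝ} {Γ : E d → E d}
  {Q : E d × E d → ℂ} {N : ℕ} {ħ : ℝ}

theorem half_smul_smul (ħ : ℝ) (k : E d) : (2⁻¹ : ℝ) • (2 * π * ħ) • k = (π * ħ) • k := by
  rw [smul_smul]; congr 1; ring

theorem exists_cutoff_of_isCompact {T : Set (E d)} (hT : IsCompact T) :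
    ∃ R, ∃ ρ : E d → ℝ, ContDiff ℝ ∞ ρ ∧ HasCompactSupport ρ ∧ (∀ x, ‖x‖ ≤ R → ρ x = 1) ∧
      ∀ x ∈ T, ‖x‖ ≤ R := by
  obtain ⟨R, hR⟩ := hT.isBounded.exists_norm_le
  obtain ⟨ρ, h1, h2, h3⟩ := exists_cutoff (V := E d) R
  exact ⟨R, ρ, h1, h2, h3, hR⟩

/-- The phases `e^{iS/ħ}` of the two transports are put into the amplitude; the supports of the two
factors `b` confine `ξ` to a ball where `ρ = 1`. -/
theorem exists_imageForm_bound (hS : HasTemperateGrowth S) (hb : ContDiff ℝ ∞ b)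
    (hbc : HasCompactSupport b) (hΓ : HasTemperateGrowth Γ) (N : ℕ) :
    ∃ (C : ℝ) (M : ℕ), 0 ≤ C ∧ ∀ (ħ : ℝ) (ψ φ : 𝓢(E d, ℂ)),
      (Continuous fun κ : E d × E d => bessel^[N] (fun k => imageForm ħ
        (transport ħ S b Γ (fourierH ħ ψ)) (transport ħ S b Γ (fourierH ħ φ)) k κ.2) κ.1) ∧
      ∀ k l, ‖bessel^[N] (fun k => imageForm ħ
        (transport ħ S b Γ (fourierH ħ ψ)) (transport ħ S b Γ (fourierH ħ φ)) k l) k‖ ≤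
        C * (1 + ‖(k, (l, (2 * π * ħ, (2 * π * ħ)⁻¹)))‖) ^ M *
        (weightedNorm (M + d + 1) ψ * weightedNorm (M + d + 1) φ) := by
  obtain ⟨R, ρ, hρ, hρc, hρ1, hR⟩ := exists_cutoff_of_isCompact hbc.isCompact
  obtain ⟨C₀, hC₀⟩ := hb.continuous.bounded_above_of_compact_support hbc
  have hbt := hasTemperateGrowth_of_hasCompactSupport hb hbc
  have hm : HasTemperateGrowth fun v : E d × ((E d × (ℝ × ℝ)) × E d) =>
      v.2.2 - (2⁻¹ : ℝ) • (v.2.1.2.1 • v.1) := by fun_prop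
  have hp : HasTemperateGrowth fun v : E d × ((E d × (ℝ × ℝ)) × E d) =>
      v.2.2 + (2⁻¹ : ℝ) • (v.2.1.2.1 • v.1) := by fun_prop
  have b1 := hbt.comp hm
  have b2 := hbt.comp hp
  have s1 := hS.comp (hΓ.comp hm)
  have s2 := hS.comp (hΓ.comp hp)
  simp only [Function.comp_def] at b1 b2 s1 s2
  set a : E d × ((E d × (ℝ × ℝ)) × E d) → ℂ := fun v =>
    ((v.2.1.2.2 ^ d : ℝ) : ℂ) * wave (inner ℝ v.2.1.1 v.2.2) *
      (((b (v.2.2 - (2⁻¹ : ℝ) • (v.2.1.2.1 • v.1)) : ℝ) : ℂ) *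
        ((b (v.2.2 + (2⁻¹ : ℝ) • (v.2.1.2.1 • v.1)) : ℝ) : ℂ)) *
      wave (v.2.1.2.2 * (S (Γ (v.2.2 - (2⁻¹ : ℝ) • (v.2.1.2.1 • v.1))) -
        S (Γ (v.2.2 + (2⁻¹ : ℝ) • (v.2.1.2.1 • v.1))))) with ha
  have hat : HasTemperateGrowth a := by
    have : HasTemperateGrowth fun v : E d × ((E d × (ℝ × ℝ)) × E d) => v.2.1.2.2 ^ d :=
      HasTemperateGrowth.pow (by fun_prop) d
    fun_prop
  have haρ : ∀ v, a v ≠ 0 → ρ v.2.2 = 1 := by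
    intro v hv
    apply hρ1
    have h1 : b (v.2.2 - (2⁻¹ : ℝ) • (v.2.1.2.1 • v.1)) ≠ 0 := fun h0 => hv (by simp [ha, h0])
    have h2 : b (v.2.2 + (2⁻¹ : ℝ) • (v.2.1.2.1 • v.1)) ≠ 0 := fun h0 => hv (by simp [ha, h0])
    have h3 := hR _ (subset_tsupport _ h1)
    have h4 := hR _ (subset_tsupport _ h2)
    have e : v.2.2 = (2⁻¹ : ℝ) • ((v.2.2 - (2⁻¹ : ℝ) • (v.2.1.2.1 • v.1)) +
        (v.2.2 + (2⁻¹ : ℝ) • (v.2.1.2.1 • v.1))) := by module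
    have h5 := norm_add_le (v.2.2 - (2⁻¹ : ℝ) • (v.2.1.2.1 • v.1))
        (v.2.2 + (2⁻¹ : ℝ) • (v.2.1.2.1 • v.1))
    rw [e, norm_smul, Real.norm_of_nonneg (by norm_num)]
    linarith
  have hab : ∀ k p, ∃ C, ∀ θ, ‖a (k, (p, θ))‖ ≤ C := by
    intro k p
    refine ⟨|p.2.2 ^ d| * (C₀ * C₀), fun θ => ?_⟩
    have h0 : 0 ≤ C₀ := (norm_nonneg _).trans (hC₀ 0)
    simp only [ha, norm_mul, norm_wave, mul_one, Complex.norm_real]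
    rw [Real.norm_eq_abs (p.2.2 ^ d)]
    gcongr <;> exact hC₀ _
  obtain ⟨C, M, hC, h⟩ := exists_form_bound hρ hρc hat (hΓ.comp hm) (hΓ.comp hp) haρ hab N
  refine ⟨C, M, hC, fun ħ ψ φ => h ħ (2 * π * ħ) ψ φ _ fun k l => ?_⟩
  rw [imageForm]
  refine integral_congr_ae (Filter.Eventually.of_forall fun ξ => ?_)
  simp only [ha, corr, transport, half_smul_smul, Function.comp_apply, map_mul, conj_wave,
    Complex.conj_ofReal]
  rw [mul_sub, sub_eq_add_neg ((2 * π * ħ)⁻¹ * _), wave_add, inv_pow]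
  push_cast
  ring

namespace PhaseData

theorem exists_chordForm_bound (h : PhaseData g S J w K V) (hχ : ContDiff ℝ ∞ χ)
    (hχc : HasCompactSupport χ) (hDt : HasTemperateGrowth D)
    (hB : ∀ θ κ, w (θ, κ) = B (θ, κ) κ) (N : ℕ) :
    ∃ (C : ℝ) (M : ℕ), 0 ≤ C ∧ ∀ (ħ : ℝ) (ψ φ : 𝓢(E d, ℂ)),
      (Continuous fun κ : E d × E d => bessel^[N] (fun k => chordForm (amplitude g J w χ)
        (midMap g w) B D ħ (fourierH ħ ψ) (fourierH ħ φ) k κ.2) κ.1) ∧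
      ∀ k l, ‖bessel^[N] (fun k => chordForm (amplitude g J w χ)
        (midMap g w) B D ħ (fourierH ħ ψ) (fourierH ħ φ) k l) k‖ ≤
        C * (1 + ‖(k, (l, (2 * π * ħ, (2 * π * ħ)⁻¹)))‖) ^ M *
        (weightedNorm (M + d + 1) ψ * weightedNorm (M + d + 1) φ) := by
  obtain ⟨R, ρ, hρ, hρc, hρ1, hR⟩ := exists_cutoff_of_isCompact h.J_supp.isCompact
  obtain ⟨C₀, hC₀⟩ := (h.amplitude_smooth hχ).continuous.bounded_above_of_compact_support
    (h.amplitude_supp hχc)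
  have hp : HasTemperateGrowth fun v : E d × ((E d × (ℝ × ℝ)) × E d) =>
      (v.2.2, v.2.1.2.1 • v.1) := by fun_prop
  have c1 := (h.temperate_amplitude hχ hχc).comp hp
  have m1 := h.temperate_midMap.comp hp
  have w1 := h.temperate_w.comp hp
  have D1 := hDt.comp hp
  simp only [Function.comp_def] at c1 m1 w1 D1
  set a : E d × ((E d × (ℝ × ℝ)) × E d) → ℂ := fun v =>
    ((v.2.1.2.2 ^ d : ℝ) : ℂ) * (((amplitude g J w χ (v.2.2, v.2.1.2.1 • v.1) : ℝ) : ℂ) *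
      wave (inner ℝ v.2.1.1 (midMap g w (v.2.2, v.2.1.2.1 • v.1)) -
        D (v.2.2, v.2.1.2.1 • v.1) v.1)) with ha
  have hat : HasTemperateGrowth a := by
    have : HasTemperateGrowth fun v : E d × ((E d × (ℝ × ℝ)) × E d) => v.2.1.2.2 ^ d :=
      HasTemperateGrowth.pow (by fun_prop) d
    fun_prop
  have hα : HasTemperateGrowth fun v : E d × ((E d × (ℝ × ℝ)) × E d) =>
      v.2.2 - (2⁻¹ : ℝ) • w (v.2.2, v.2.1.2.1 • v.1) := h.temperate_chord_ends.2.comp hp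
  have hβ : HasTemperateGrowth fun v : E d × ((E d × (ℝ × ℝ)) × E d) =>
      v.2.2 + (2⁻¹ : ℝ) • w (v.2.2, v.2.1.2.1 • v.1) := h.temperate_chord_ends.1.comp hp
  have haρ : ∀ v, a v ≠ 0 → ρ v.2.2 = 1 := by
    intro v hv
    refine hρ1 _ (hR _ ?_)
    have h1 : amplitude g J w χ (v.2.2, v.2.1.2.1 • v.1) ≠ 0 := fun h0 => hv (by simp [ha, h0])
    exact (amplitude_ne_zero h1).1
  have hab : ∀ k p, ∃ C, ∀ θ, ‖a (k, (p, θ))‖ ≤ C := by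
    intro k p
    refine ⟨|p.2.2 ^ d| * C₀, fun θ => ?_⟩
    simp only [ha, norm_mul, norm_wave, mul_one, Complex.norm_real]
    rw [Real.norm_eq_abs (p.2.2 ^ d)]
    gcongr
    exact hC₀ _
  obtain ⟨C, M, hC, hf⟩ := exists_form_bound hρ hρc hat hα hβ haρ hab N
  refine ⟨C, M, hC, fun ħ ψ φ => hf ħ (2 * π * ħ) ψ φ _ fun k l => ?_⟩
  rw [chordForm]
  refine integral_congr_ae (Filter.Eventually.of_forall fun θ => ?_)
  have e2 : (2⁻¹ : ℝ) • w (θ, (2 * π * ħ) • k) = (π * ħ) • B (θ, (2 * π * ħ) • k) k := by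
    rw [hB, map_smul, half_smul_smul]
  simp only [ha, corr, e2, inv_pow]
  push_cast
  ring

/-- The symbol represents the conjugated operator microlocally. -/
theorem hasWeylSymbolOn (h : PhaseData g S J w K V) (hχ : ContDiff ℝ ∞ χ)
    (hχc : HasCompactSupport χ) (hχ1 : ∀ κ, ‖κ‖ ≤ 1 → χ κ = 1)
    (hBt : HasTemperateGrowth B) (hDt : HasTemperateGrowth D)
    (hB : ∀ θ κ, w (θ, κ) = B (θ, κ) κ) (hD : ∀ θ κ, phaseDiff S w (θ, κ) = D (θ, κ) κ)
    {p : E d × E d → ℂ} (hp : PolyBounded p) (hQ : Rapid volume Q) {R : ℝ}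
    (hR : ∀ θ ∈ K, ‖g θ‖ ≤ R)
    (hpQ : ∀ z : E d × E d, ‖z.2‖ ≤ R → p z = superpose Q N planeWave z)
    (hfam : IsSymbolFamily fun ħ z => symbolOf g J w χ B D Q N (z, 2 * π * ħ))
    (hL : IsCompact L) (hLK : L ⊆ K) (hinj : InjOn g L) {𝒢 : A d → A d}
    (h𝒢 : ∀ x, ∀ ξ ∈ L, inner ℝ (𝒢 (cons 0 x)) (sigma ξ) = inner ℝ x (g ξ) + S ξ) :
    HasWeylSymbolOn (conjForm 𝒢 p) (fun ħ z => symbolOf g J w χ B D Q N (z, 2 * π * ħ)) L := by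
  obtain ⟨Γ, b, hΓ, hΓc, hb, hbc, hbΓ, hΓL⟩ := h.exists_inverse hL hLK hinj
  have hΓt := hasTemperateGrowth_of_hasCompactSupport hΓ hΓc
  obtain ⟨C₁, M₁, hC₁, h₁⟩ := exists_imageForm_bound h.temperate_S hb hbc hΓt N
  obtain ⟨C₂, M₂, hC₂, h₂⟩ := h.exists_chordForm_bound hχ hχc hDt hB N
  obtain ⟨δ, hδ, he⟩ := h.imageForm_eq_chordForm hχ1 hB hD hL hLK hinj hbΓ hΓL
  refine ⟨M₁ + M₂ + d + 1, fun n => ?_⟩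
  obtain ⟨C, hC⟩ := exists_remainder_bound (N := N) hQ hδ (C := C₁ + C₂) (by positivity)
    (M₁ + M₂) n
  refine ⟨C, fun ħ h0 h1 ψ φ hψ hφ => ?_⟩
  have hsupp : ∀ ψ : 𝓢(E d, ℂ), (∀ ξ, ξ ∉ L → fourierH ħ ψ ξ = 0) →
      HasCompactSupport (fourierH ħ ψ) := fun ψ hψ => HasCompactSupport.intro hL hψ
  -- `U_𝒢 ψ` is itself a Schwartz function, so the formulas for matrix elements apply to it.
  have htr : ∀ ψ : 𝓢(E d, ℂ), (∀ ξ, ξ ∉ L → fourierH ħ ψ ξ = 0) →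
      ∃ u : 𝓢(E d, ℂ), opU ħ 𝒢 ψ = u ∧ fourierH ħ u = transport ħ S b Γ (fourierH ħ ψ) := by
    intro ψ hψ
    obtain ⟨u, hu1, hu2⟩ := exists_schwartz_fourierH_eq h0
      (contDiff_transport (ħ := ħ) h.S_smooth hb hΓ (contDiff_fourierH ħ ψ))
      (hasCompactSupport_transport hbc _)
    refine ⟨u, ?_, hu1⟩
    ext x
    rw [h.opU_eq hL hLK hinj hbΓ hΓL h𝒢 hψ, hu2]
  have hbd : ∀ ψ : 𝓢(E d, ℂ), (∀ ξ, ξ ∉ L → fourierH ħ ψ ξ = 0) → ∀ η,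
      transport ħ S b Γ (fourierH ħ ψ) η ≠ 0 → ‖η‖ ≤ R := by
    intro ψ hψ η hη
    by_cases hηL : η ∈ g '' L
    · obtain ⟨θ, hθ, rfl⟩ := hηL
      exact hR θ (hLK hθ)
    · exact absurd (transport_eq_zero hbΓ hψ η hηL) hη
  obtain ⟨u, hu, hu'⟩ := htr ψ hψ
  obtain ⟨v, hv, hv'⟩ := htr φ hφ
  have hcd := fun ψ : 𝓢(E d, ℂ) =>
    contDiff_transport (ħ := ħ) h.S_smooth hb hΓ (contDiff_fourierH ħ ψ)
  have hcs := fun ψ : 𝓢(E d, ℂ) =>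
    hasCompactSupport_transport (ħ := ħ) (S := S) (Γ := Γ) hbc (fourierH ħ ψ)
  rw [conjForm, hu, hv, pairing_weylOp_eq_imageForm h0 hp hQ u v (hu' ▸ hcd ψ) (hv' ▸ hcd φ)
    (hu' ▸ hcs ψ) (hv' ▸ hcs φ) (R := R) (hu' ▸ hbd ψ hψ) (hv' ▸ hbd φ hφ) hpQ,
    h.pairing_weylOp_eq_chordForm hχ hχc hBt hDt h0 hQ (hfam.polyBounded h0 h1) ψ φ
      (hsupp ψ hψ) (hsupp φ hφ), hu', hv']
  have hW : ∀ {C' : ℝ} {M : ℕ}, 0 ≤ C' → C' ≤ C₁ + C₂ → M ≤ M₁ + M₂ → ∀ k l : E d,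
      C' * (1 + ‖(k, (l, (2 * π * ħ, (2 * π * ħ)⁻¹)))‖) ^ M *
        (weightedNorm (M + d + 1) ψ * weightedNorm (M + d + 1) φ) ≤
      (C₁ + C₂) * (1 + ‖(k, (l, (2 * π * ħ, (2 * π * ħ)⁻¹)))‖) ^ (M₁ + M₂) *
        (weightedNorm (M₁ + M₂ + d + 1) ψ * weightedNorm (M₁ + M₂ + d + 1) φ) := by
    intro C' M hC' hCC hM k l
    have n1 := weightedNorm_nonneg (M + d + 1) φ
    have n2 := weightedNorm_nonneg (M₁ + M₂ + d + 1) ψ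
    gcongr
    · exact mul_nonneg (weightedNorm_nonneg _ _) n1
    · linarith [norm_nonneg (k, (l, (2 * π * ħ, (2 * π * ħ)⁻¹)))]
    · exact weightedNorm_mono (by omega) ψ
    · exact weightedNorm_mono (by omega) φ
  refine (hC ħ h0 h1 _ _
    (weightedNorm (M₁ + M₂ + d + 1) ψ * weightedNorm (M₁ + M₂ + d + 1) φ)
    (mul_nonneg (weightedNorm_nonneg _ _) (weightedNorm_nonneg _ _)) (h₁ ħ ψ φ).1 (h₂ ħ ψ φ).1
    (fun k l => ((h₁ ħ ψ φ).2 k l).trans (hW hC₁ (by linarith) (by omega) k l))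
    (fun k l => ((h₂ ħ ψ φ).2 k l).trans (hW hC₂ (by linarith) (by omega) k l))
    (fun k l hk => he ħ _ _ k l h0 hψ hφ hk)).trans_eq ?_
  ring

end PhaseData

end Microlocal

/-! ### Geometry of the hemisphere and regularity of `g` -/

section Hemisphere

open Set Topology

variable {d : ℕ} (G : A d ≃L[ℝ] A d) (γ : A d)

theorem inner_cons (s t : ℝ) (x y : E d) :
    inner ℝ (cons s x) (cons t y) = s * t + inner ℝ x y := by
  simp only [cons, PiLp.inner_apply, Fin.sum_univ_succ, Fin.cons_zero, Fin.cons_succ]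
  simp [mul_comm]

theorem proj_cons (s : ℝ) (x : E d) : proj (cons s x) = x := by
  simp [proj, cons]

theorem cons_proj (X : A d) : cons (X 0) (proj X) = X := by
  simp [proj, cons]

/-- The projection `proj` as a continuous linear map. -/
def projCLM (d : ℕ) : A d →L[ℝ] E d :=
  LinearMap.toContinuousLinearMap
    { toFun := proj
      map_add' := fun X Y => by ext i; simp [proj, Fin.tail]
      map_smul' := fun c X => by ext i; simp [proj, Fin.tail] }

/-- The map `(s, x) ↦ cons s x` as a continuous linear map. -/
def consCLM (d : ℕ) : ℝ × E d →L[ℝ] A d :=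
  LinearMap.toContinuousLinearMap
    { toFun := fun z => cons z.1 z.2
      map_add' := fun X Y => by
        ext i; refine Fin.cases ?_ (fun j => ?_) i <;> simp [cons]
      map_smul' := fun c X => by
        ext i; refine Fin.cases ?_ (fun j => ?_) i <;> simp [cons] }

theorem contDiffAt_sigma {ξ : E d} (hξ : ‖ξ‖ < 1) : ContDiffAt ℝ ∞ (sigma : E d → A d) ξ := by
  have h1 : 1 - ‖ξ‖ ^ 2 ≠ 0 := by nlinarith [norm_nonneg ξ]
  have h2 : ContDiffAt ℝ ∞ (fun ξ : E d => (Real.sqrt (1 - ‖ξ‖ ^ 2), ξ)) ξ :=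
    ((contDiffAt_const.sub (contDiff_norm_sq ℝ).contDiffAt).sqrt h1).prodMk contDiffAt_id
  exact (consCLM d).contDiff.contDiffAt.comp ξ h2

theorem inner_sigma_self {ξ : E d} (hξ : ‖ξ‖ ≤ 1) : inner ℝ (sigma ξ) (sigma ξ) = (1 : ℝ) := by
  rw [sigma, inner_cons, Real.mul_self_sqrt (by nlinarith [norm_nonneg ξ]),
    real_inner_self_eq_norm_sq]
  ring

theorem proj_sigma (ξ : E d) : proj (sigma ξ) = ξ := proj_cons _ _

/-- The derivative of `⟨σ, σ⟩ = 1`: the image of `dσ` is tangent to the sphere. -/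
theorem inner_fderiv_sigma {ξ : E d} (hξ : ‖ξ‖ < 1) (v : E d) :
    inner ℝ (fderiv ℝ sigma ξ v) (sigma ξ) = (0 : ℝ) := by
  have h1 := ((contDiffAt_sigma hξ).differentiableAt (by simp)).hasFDerivAt
  have h2 := h1.inner ℝ h1
  have h3 : HasFDerivAt (fun ξ : E d => inner ℝ (sigma ξ) (sigma ξ)) (0 : E d →L[ℝ] ℝ) ξ := by
    refine (hasFDerivAt_const (1 : ℝ) ξ).congr_of_eventuallyEq ?_
    filter_upwards [(isOpen_lt continuous_norm continuous_const).mem_nhds hξ] with ζ hζ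
    exact inner_sigma_self (le_of_lt hζ)
  have h4 := congrArg (fun T : E d →L[ℝ] ℝ => T v) (h2.unique h3)
  simp only [ContinuousLinearMap.comp_apply, ContinuousLinearMap.prod_apply,
    fderivInnerCLM_apply, zero_apply] at h4
  rw [real_inner_comm] at h4
  linarith

theorem proj_fderiv_sigma {ξ : E d} (hξ : ‖ξ‖ < 1) (v : E d) :
    proj (fderiv ℝ sigma ξ v) = v := by
  have h1 := ((contDiffAt_sigma hξ).differentiableAt (by simp)).hasFDerivAt
  have h2 := (projCLM d).hasFDerivAt.comp ξ h1
  have h3 : HasFDerivAt (fun ξ : E d => ξ) (ContinuousLinearMap.id ℝ (E d)) ξ := hasFDerivAt_id ξ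
  have h4 : (projCLM d ∘ sigma : E d → E d) = fun ξ => ξ := by
    ext1 ξ; exact proj_sigma ξ
  rw [h4] at h2
  exact congrArg (fun T : E d →L[ℝ] E d => T v) (h2.unique h3)

/-- The open set of frequencies of non-grazing rays that are transverse to `G 𝒫₀`. -/
def regularSet : Set (E d) := {ξ | ‖ξ‖ < 1 ∧ G.symm (sigma ξ) 0 ≠ 0}

theorem isOpen_regularSet : IsOpen (regularSet G) := by
  rw [isOpen_iff_mem_nhds]
  rintro ξ ⟨h1, h2⟩
  have h3 : ContinuousAt (fun ξ => G.symm (sigma ξ) 0) ξ := by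
    have h4 : Continuous fun X : A d => G.symm X 0 := by fun_prop
    exact h4.continuousAt.comp (contDiffAt_sigma h1).continuousAt
  filter_upwards [(isOpen_lt continuous_norm continuous_const).mem_nhds h1,
    h3.eventually_ne h2] with ζ h5 h6
  exact ⟨h5, h6⟩

theorem region_subset_regularSet {ε : ℝ} (hε : 0 < ε) : region G ε ⊆ regularSet G := by
  rintro ξ ⟨h1, h2⟩
  exact ⟨by linarith, fun h3 => h2 ⟨G.symm (sigma ξ), h3, G.apply_symm_apply _⟩⟩

theorem contDiffAt_gMap {ξ : E d} (hξ : ‖ξ‖ < 1) : ContDiffAt ℝ ∞ (gMap G) ξ :=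
  ((projCLM d).comp (ContinuousLinearMap.adjoint (G : A d →L[ℝ] A d))).contDiff.contDiffAt.comp ξ
    (contDiffAt_sigma hξ)

theorem fderiv_gMap {ξ : E d} (hξ : ‖ξ‖ < 1) (v : E d) : fderiv ℝ (gMap G) ξ v =
    proj (ContinuousLinearMap.adjoint (G : A d →L[ℝ] A d) (fderiv ℝ sigma ξ v)) := by
  have h1 := ((contDiffAt_sigma hξ).differentiableAt (by simp)).hasFDerivAt
  have h2 := ((projCLM d).comp
    (ContinuousLinearMap.adjoint (G : A d →L[ℝ] A d))).hasFDerivAt.comp ξ h1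
  have h3 : fderiv ℝ (gMap G) ξ = _ := h2.fderiv
  rw [h3]
  rfl

/-- If `dg v = 0`, then `Y = ᵗG dσ(v)` has only an `x₀` component. Tangency gives `⟨Y, G⁻¹σ⟩ =
⟨dσ(v), σ⟩ = 0`, and transversality says that `G⁻¹σ` has a nonzero `x₀` component. Hence `Y = 0`, so
`dσ(v) = 0` and `v = 0`. -/
theorem det_fderiv_gMap_ne_zero {ξ : E d} (hξ : ξ ∈ regularSet G) :
    (fderiv ℝ (gMap G) ξ).det ≠ 0 := by
  refine det_ne_zero_of_injective fun v hv => ?_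
  rw [fderiv_gMap G hξ.1] at hv
  set Y := ContinuousLinearMap.adjoint (G : A d →L[ℝ] A d) (fderiv ℝ sigma ξ v) with hY
  have h1 : inner ℝ Y (G.symm (sigma ξ)) = (0 : ℝ) := by
    rw [hY, ContinuousLinearMap.adjoint_inner_left]
    simpa using inner_fderiv_sigma hξ.1 v
  rw [← cons_proj Y, ← cons_proj (G.symm (sigma ξ)), hv, inner_cons, inner_zero_left,
    add_zero] at h1
  have h2 : Y 0 = 0 := (mul_eq_zero.1 h1).resolve_right hξ.2
  have h3 : Y = 0 := by
    rw [← cons_proj Y, hv, h2]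
    exact (consCLM d).map_zero
  have h4 : fderiv ℝ sigma ξ v = 0 := by
    refine ext_inner_right ℝ fun X => ?_
    have h5 : inner ℝ Y (G.symm X) = (0 : ℝ) := by rw [h3, inner_zero_left]
    rw [hY, ContinuousLinearMap.adjoint_inner_left] at h5
    simpa using h5
  rw [← proj_fderiv_sigma hξ.1 v, h4]
  exact (projCLM d).map_zero

theorem contDiffOn_gMap : ContDiffOn ℝ ∞ (gMap G) (regularSet G) :=
  fun _ h => (contDiffAt_gMap G h.1).contDiffWithinAt

theorem contDiffOn_phase : ContDiffOn ℝ ∞ (fun ξ : E d => (inner ℝ γ (sigma ξ) : ℝ))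
    (regularSet G) :=
  fun _ h => (contDiffAt_const.inner ℝ (contDiffAt_sigma h.1)).contDiffWithinAt

theorem contDiffOn_jac : ContDiffOn ℝ ∞ (jac G) (regularSet G) := by
  intro ξ h
  have h1 : ContDiffAt ℝ ∞ (fderiv ℝ (gMap G)) ξ := (contDiffAt_gMap G h.1).fderiv_right (by simp)
  have h2 : ContDiffAt ℝ ∞ (fun ξ => (fderiv ℝ (gMap G) ξ).det) ξ :=
    contDiff_det.contDiffAt.comp ξ h1
  have h3 := det_fderiv_gMap_ne_zero G h
  exact ((h2.abs h3).inv (abs_ne_zero.2 h3)).contDiffWithinAt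

/-- The phase of the propagator is affine in the position. -/
theorem inner_affine_sigma (x ξ : E d) : inner ℝ (affine G γ (cons 0 x)) (sigma ξ) =
    (inner ℝ x (gMap G ξ) + inner ℝ γ (sigma ξ) : ℝ) := by
  have h : inner ℝ (G (cons 0 x)) (sigma ξ) = (inner ℝ x (gMap G ξ) : ℝ) := by
    have h1 := ContinuousLinearMap.adjoint_inner_right (G : A d →L[ℝ] A d) (cons 0 x) (sigma ξ)
    rw [ContinuousLinearEquiv.coe_coe] at h1
    rw [← h1, ← cons_proj (ContinuousLinearMap.adjoint (G : A d →L[ℝ] A d) (sigma ξ)), inner_cons,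
      zero_mul, zero_add]
    rfl
  rw [affine, inner_add_left, h]

/-- The phase of the propagator near a compact set of regular frequencies, extended to smooth data
on the whole space. -/
theorem exists_phaseData {K : Set (E d)} (hK : IsCompact K) (hKG : K ⊆ regularSet G) :
    ∃ (g : E d → E d) (S J : E d → ℝ) (w : E d × E d → E d) (V : Set (E d)),
      PhaseData g S J w K V ∧ ∀ ξ ∈ V, g ξ = gMap G ξ ∧ S ξ = inner ℝ γ (sigma ξ) ∧
        fderiv ℝ g ξ = fderiv ℝ (gMap G) ξ ∧
        gradient S ξ = gradient (fun ξ : E d => (inner ℝ γ (sigma ξ) : ℝ)) ξ := by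
  obtain ⟨g, g1, g2, O₁, o1, k1, u1, e1⟩ :=
    exists_contDiff_extension hK (isOpen_regularSet G) hKG (contDiffOn_gMap G)
  obtain ⟨S, s1, s2, O₂, o2, k2, u2, e2⟩ :=
    exists_contDiff_extension hK (isOpen_regularSet G) hKG (contDiffOn_phase G γ)
  obtain ⟨J, j1, j2, O₃, o3, k3, u3, e3⟩ :=
    exists_contDiff_extension hK (isOpen_regularSet G) hKG (contDiffOn_jac G)
  have hg : ∀ ξ ∈ O₁, fderiv ℝ g ξ = fderiv ℝ (gMap G) ξ := fun ξ hξ =>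
    Filter.EventuallyEq.fderiv_eq (Filter.eventually_of_mem (o1.mem_nhds hξ) e1)
  have hdet : ∀ ξ ∈ O₁, (fderiv ℝ g ξ).det ≠ 0 := fun ξ hξ => by
    rw [hg ξ hξ]
    exact det_fderiv_gMap_ne_zero G (u1 hξ)
  obtain ⟨w, w1, w2, w3, w4, w5⟩ := exists_chord g1 hK fun ξ hξ => hdet ξ (k1 hξ)
  refine ⟨g, S, J, w, O₁ ∩ O₂ ∩ O₃, ⟨hK, (o1.inter o2).inter o3,
    subset_inter (subset_inter k1 k2) k3, g1, g2, s1, s2, j1, j2, w1, w2, w3,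
    fun ξ hξ => hdet ξ hξ.1.1, fun ξ hξ => ?_, w4, w5⟩,
    fun ξ hξ => ⟨e1 ξ hξ.1.1, e2 ξ hξ.1.2, hg ξ hξ.1.1, ?_⟩⟩
  · rw [e3 ξ hξ.2, hg ξ hξ.1.1, jac]
  · rw [gradient, gradient]
    congr 1
    exact Filter.EventuallyEq.fderiv_eq (Filter.eventually_of_mem (o2.mem_nhds hξ.1.2) e2)

end Hemisphere

/-! ### Assembly of the theorem -/

theorem exists_even_cutoff (d : ℕ) : ∃ χ : E d → ℝ, ContDiff ℝ ∞ χ ∧ HasCompactSupport χ ∧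
    (∀ κ, ‖κ‖ ≤ 1 → χ κ = 1) ∧ ∀ κ, χ (-κ) = χ κ := by
  obtain ⟨χ, h1, h2, h3⟩ := exists_cutoff (V := E d) 1
  refine ⟨fun κ => χ κ * χ (-κ), h1.mul (h1.comp contDiff_neg), h2.mul_right, fun κ hκ => ?_,
    fun κ => ?_⟩
  · beta_reduce
    rw [h3 κ hκ, h3 (-κ) (by rwa [norm_neg]), one_mul]
  · beta_reduce
    rw [neg_neg, mul_comm]

theorem PhaseData.jac_eq {d : ℕ} {G : A d ≃L[ℝ] A d} {g : E d → E d} {S J : E d → ℝ}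
    {w : E d × E d → E d} {K V : Set (E d)} (h : PhaseData g S J w K V) {ξ : E d} (hξ : ξ ∈ V)
    (hg : fderiv ℝ g ξ = fderiv ℝ (gMap G) ξ) : J ξ = jac G ξ := by
  rw [h.J_eq ξ hξ, hg, jac]

end TiltedHologram

end

open TiltedHologram in
theorem mainTheorem4 {d : ℕ}
    (G : TiltedHologram.A d ≃L[ℝ] TiltedHologram.A d) (γ : TiltedHologram.A d)
    (p₀ : TiltedHologram.E d × TiltedHologram.E d → ℂ) (hp : TiltedHologram.IsSymbol p₀)
    (ε : ℝ) (hε : 0 < ε)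
    (K : Set (TiltedHologram.E d)) (hK : IsCompact K) (hKreg : K ⊆ TiltedHologram.region G ε) :
    ∃ t : ℝ → TiltedHologram.E d × TiltedHologram.E d → ℂ,
      TiltedHologram.IsSymbolFamily t ∧
      TiltedHologram.EqUpToSq t
        (fun z => (TiltedHologram.jac G z.2 : ℂ) * p₀ (TiltedHologram.kappa G γ z)) K ∧
      ∀ L : Set (TiltedHologram.E d), IsCompact L → L ⊆ K →
        Set.InjOn (TiltedHologram.gMap G) L →
        TiltedHologram.HasWeylSymbolOn
          (TiltedHologram.conjForm (TiltedHologram.affine G γ) p₀) t L := by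
  obtain ⟨g, S, J, w, V, h, hV⟩ :=
    exists_phaseData G γ hK (hKreg.trans (region_subset_regularSet G hε))
  obtain ⟨χ, hχ, hχc, hχ1, hχe⟩ := exists_even_cutoff d
  obtain ⟨B, D, hB, hD, hBw, hDw, hBd, hDB⟩ := h.exists_factors
  obtain ⟨U, hU, hKU, hUV, hinv⟩ := h.exists_inverse_fderiv hBd
  -- The extended `g` is bounded on the whole space, so one density `Q` represents `p₀` at all the
  -- image frequencies that occur.
  obtain ⟨R, hR⟩ := h.g_smooth.continuous.bounded_above_of_compact_support h.g_supp
  obtain ⟨N, Q, hQ, hpQ⟩ := hp.exists_density R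
  have hT : Function.HasTemperateGrowth (symbolOf g J w χ B D Q N) :=
    h.temperate_symbolOf hχ hχc hB hD hQ
  have hT0 : ∀ z s, z.2 ∉ tsupport J → symbolOf g J w χ B D Q N (z, s) = 0 :=
    h.symbolOf_eq_zero hχ hχc hB hD
  have hTe : ∀ z s, symbolOf g J w χ B D Q N (z, -s) = symbolOf g J w χ B D Q N (z, s) :=
    h.symbolOf_neg hχ hχc hB hD hχe hBw hDw
  have hT1 : ∀ z, z.2 ∈ U →
      symbolOf g J w χ B D Q N (z, 0) = (jac G z.2 : ℂ) * p₀ (kappa G γ z) := by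
    rintro ⟨x, θ⟩ hθ
    obtain ⟨v1, -, v3, v4⟩ := hV θ (hUV hθ)
    have e : kappa G γ (x, θ) =
        ((ContinuousLinearMap.adjoint (fderiv ℝ g θ)).inverse (x - gradient S θ), g θ) := by
      rw [kappa, kappaLin, kappaTrans, ← v1, ← v3, ← v4]
    rw [h.symbolOf_zero hχ hχc hB hD (hχ1 0 (by simp)) (hUV hθ) (hDB θ) (hinv θ hθ).1
      (hinv θ hθ).2 x _ rfl, h.jac_eq (hUV hθ) v3, e]
    exact congrArg _ (hpQ (_, g θ) (hR θ)).symm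
  have hfam : IsSymbolFamily fun ħ z => symbolOf g J w χ B D Q N (z, 2 * Real.pi * ħ) :=
    isSymbolFamily_of_temperate hT h.J_supp.isCompact hT0
  -- The family is built from `K` alone; `L` enters only through the inverse of `g` and the
  -- threshold `δ`, so one `t` serves every `L`.
  refine ⟨_, hfam, ?_, fun L hL hLK hinj => ?_⟩
  · exact eqUpToSq_of_even hT hTe hK hU hKU hT1
  · refine h.hasWeylSymbolOn hχ hχc hχ1 hB hD hBw hDw hp.polyBounded hQ (fun θ _ => hR θ)
      (fun z hz => ?_) hfam hL hLK ?_ fun x ξ hξ => ?_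
    · rw [hpQ z hz, superpose_eq_of_wave temperate_planeWave (a := 1) (y := z.1) (η := z.2)
        fun k l => by rw [planeWave, one_mul], one_mul]
    · exact hinj.congr fun ξ hξ => (hV ξ (h.subset (hLK hξ))).1.symm
    · obtain ⟨v1, v2, -, -⟩ := hV ξ (h.subset (hLK hξ))
      rw [inner_affine_sigma, v1, v2]
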